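/- Let $n\ge 2$ and $G=\mathrm{SL}(n,\mathbb R)$. For $\xi\in\mathbb R^{n-1}$ let $u(\xi)\in G$ be the matrix with first row $(1,\xi_1,\dots,\xi_{n-1})$ whose other rows are those of the identity matrix. For $2\le m\le n$ let $$Q_m=\left\{\begin{pmatrix} g & w\\ 0& I_{n-m}\end{pmatrix}: g\in \mathrm{SL}(m,\mathbb R),\ w\in \mathrm M_{m\times(n-m)}(\mathbb R)\right\}\subset G.$$ Let $k\ge 1$ and let $n-1\ge m_1>m_2>\dots>m_k\ge 1$ be integers. With $E_{i,j}$ the elementary matrices of size $n\times n$, put $$\mathcal A_\ell=m_\ell E_{1,1}-\sum_{j=2}^{m_\ell+1}E_{j,j}\quad(1\le \ell\le k),\qquad \mathcal A(t)=t_1\mathcal A_1+\dots+t_k\mathcal A_k\quad (t\in\mathbb R^k).$$ Let $V$ be a finite-dimensional continuous real linear representation of $G$, and let $\mathcal T=(t_i)_{i\in\mathbb N}$ be a sequence in $(\mathbb R_{\ge 0})^k$ each of whose coordinates tends to $\infty$. Define the subspaces $$V^{\mp}(\mathcal T)=\{v\in V:\exp(\pm\mathcal A(t_i))v\to 0\ \text{as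 } i\to\infty\},$$ $$V^0(\mathcal T)=\{v\in V:\text{both }\exp(\mathcal A(t_i))v\text{ and }\exp(-\mathcal A(t_i))v\text{ converge in }V\text{ as } i\to\infty\},$$ and assume that $V=V^+(\mathcal T)\oplus V^0(\mathcal T)\oplus V^-(\mathcal T)$. Let $\phi:[a,b]\to\mathbb R^{n-1}$ be a differentiable curve whose image is not contained in a proper affine subspace of $\mathbb R^{n-1}$. If $v\in V$ satisfies $$u(\phi(s))v\in V^0(\mathcal T)+V^-(\mathcal T)\quad\text{for all } s\in[a,b],$$ then $v$ is fixed by the subgroup $Q_{m_1+1}$. -/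

import Mathlib

open Filter Topology Set

namespace ExpandingTranslates

/-- The matrix `A_l = m E_{1,1} - ∑_{j=2}^{m+1} E_{j,j}` of size `n = d + 1`
(the rows and columns are numbered from `0` in Lean). -/
noncomputable def cartanMatrix (d m : ℕ) : Matrix (Fin (d + 1)) (Fin (d + 1)) ℝ :=
  Matrix.single 0 0 (m : ℝ)
    - ∑ j : Fin (d + 1), if 1 ≤ (j : ℕ) ∧ (j : ℕ) ≤ m then Matrix.single j j (1 : ℝ) else 0

/-- `A(t) = t_1 A_1 + ... + t_k A_k`, where `A_l` is built from `m_l`. -/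
noncomputable def cartanSum (d : ℕ) {k : ℕ} (m : Fin k → ℕ) (t : Fin k → ℝ) :
    Matrix (Fin (d + 1)) (Fin (d + 1)) ℝ :=
  ∑ l, t l • cartanMatrix d (m l)

theorem cartanMatrix_eq_diagonal (d m : ℕ) :
    cartanMatrix d m = Matrix.diagonal (fun i : Fin (d + 1) =>
      if i = 0 then (m : ℝ) else if (i : ℕ) ≤ m then -1 else 0) := by
  ext i j
  simp only [cartanMatrix, Matrix.sub_apply, Matrix.sum_apply, Matrix.diagonal_apply]
  rw [Finset.sum_eq_single i]
  · by_cases hij : i = j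
    · subst hij
      by_cases h0 : i = 0
      · subst h0; simp
      · have h1 : 1 ≤ (i : ℕ) := Nat.one_le_iff_ne_zero.mpr (fun h => h0 (Fin.ext h))
        by_cases h2 : (i : ℕ) ≤ m <;> simp [h0, h1, h2, Ne.symm h0]
    · rw [Matrix.single_apply]
      rw [if_neg (fun h : 0 = i ∧ 0 = j => hij (h.1.symm.trans h.2)), if_neg hij]
      split_ifs <;> simp [hij]
  · intro b _ hb
    split_ifs
    · simp [hb]
    · simp
  · simp

theorem exp_cartanSum (d : ℕ) {k : ℕ} (m : Fin k → ℕ) (t : Fin k → ℝ) :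
    NormedSpace.exp (cartanSum d m t) = Matrix.diagonal (fun i : Fin (d + 1) =>
      Real.exp (∑ l, t l *
        (if i = 0 then (m l : ℝ) else if (i : ℕ) ≤ m l then -1 else 0))) := by
  have h : cartanSum d m t = Matrix.diagonal (fun i : Fin (d + 1) =>
      ∑ l, t l * (if i = 0 then (m l : ℝ) else if (i : ℕ) ≤ m l then -1 else 0)) := by
    ext i j
    simp only [cartanSum, cartanMatrix_eq_diagonal, Matrix.sum_apply, Matrix.smul_apply,
      Matrix.diagonal_apply, smul_eq_mul]
    split_ifs <;> simp
  rw [h, Matrix.exp_diagonal]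
  congr 1
  ext i
  rw [Pi.coe_exp, Real.exp_eq_exp_ℝ]

theorem sum_cartan_entries (d m : ℕ) (hm : m ≤ d) :
    ∑ i : Fin (d + 1), (if i = 0 then (m : ℝ) else if (i : ℕ) ≤ m then -1 else 0) = 0 := by
  rw [Fin.sum_univ_succ]
  have h : ∀ i : Fin d, (if i.succ = 0 then (m : ℝ)
      else if ((i.succ : Fin (d + 1)) : ℕ) ≤ m then (-1 : ℝ) else 0)
      = if (i : ℕ) < m then -1 else 0 := by
    intro i
    simp [Fin.succ_ne_zero]
  rw [Finset.sum_congr rfl (fun i _ => h i),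
    Fin.sum_univ_eq_sum_range (fun i => if i < m then (-1 : ℝ) else 0) d,
    ← Finset.sum_filter]
  have h2 : (Finset.range d).filter (fun i => i < m) = Finset.range m := by
    ext x
    simp only [Finset.mem_filter, Finset.mem_range]
    omega
  simp [h2]

/-- `exp(A(t))` as an element of `SL(n, ℝ)`, `n = d + 1`, for `m_1, ..., m_k ≤ n - 1`. -/
noncomputable def expCartan (d : ℕ) {k : ℕ} (m : Fin k → ℕ) (hm : ∀ l, m l ≤ d)
    (t : Fin k → ℝ) : Matrix.SpecialLinearGroup (Fin (d + 1)) ℝ :=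
  ⟨NormedSpace.exp (cartanSum d m t), by
    rw [exp_cartanSum, Matrix.det_diagonal, ← Real.exp_sum, Finset.sum_comm]
    simp only [← Finset.mul_sum]
    simp [sum_cartan_entries d _ (hm _)]⟩

/-- The unipotent matrix `u(ξ)` with first row `(1, ξ_1, ..., ξ_{n-1})` and all other rows as in
the identity matrix; `n = d + 1`. -/
noncomputable def unipotent {d : ℕ} (ξ : EuclideanSpace ℝ (Fin d)) :
    Matrix.SpecialLinearGroup (Fin (d + 1)) ℝ :=
  ⟨1 + ∑ j : Fin d, Matrix.single 0 j.succ (ξ j), by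
    rw [Matrix.det_of_isUpperTriangular]
    · refine Finset.prod_eq_one (fun i _ => ?_)
      simp only [Matrix.add_apply, Matrix.sum_apply, Matrix.one_apply_eq, add_eq_left]
      refine Finset.sum_eq_zero (fun j _ => ?_)
      rw [Matrix.single_apply, if_neg]
      rintro ⟨h1, h2⟩
      exact Fin.succ_ne_zero j (h2.trans h1.symm)
    · intro i j hij
      have hij' : j < i := hij
      have h0 : (0 : Fin (d + 1)) ≠ i := (lt_of_le_of_lt (Fin.zero_le j) hij').ne
      simp only [Matrix.add_apply, Matrix.sum_apply, Matrix.one_apply_ne hij'.ne', zero_add]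
      exact Finset.sum_eq_zero (fun l _ => by simp [h0])⟩

/-- The subgroup `Q_m` of `SL(N, ℝ)` of the block matrices `[g, w; 0, I_{N-m}]` with
`g ∈ SL(m, ℝ)`: the rows with (one-based) number larger than `m` are those of the identity matrix;
that `det g = 1` is then automatic, see `mem_Q_iff`. -/
def Q (N m : ℕ) : Subgroup (Matrix.SpecialLinearGroup (Fin N) ℝ) where
  carrier := {x | ∀ i : Fin N, m ≤ (i : ℕ) →
    Matrix.vecMul (Pi.single i 1) (x : Matrix (Fin N) (Fin N) ℝ) = Pi.single i 1}
  one_mem' := by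
    intro i _
    simp
  mul_mem' := by
    intro x y hx hy i hi
    rw [Matrix.SpecialLinearGroup.coe_mul, ← Matrix.vecMul_vecMul, hx i hi, hy i hi]
  inv_mem' := by
    intro x hx i hi
    have h : Matrix.vecMul (Matrix.vecMul (Pi.single i 1) (x : Matrix (Fin N) (Fin N) ℝ))
        ((x⁻¹ : Matrix.SpecialLinearGroup (Fin N) ℝ) : Matrix (Fin N) (Fin N) ℝ)
        = Pi.single i 1 := by
      rw [Matrix.vecMul_vecMul, ← Matrix.SpecialLinearGroup.coe_mul, mul_inv_cancel]
      simp
    rwa [hx i hi] at h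

theorem mem_Q_iff (m r : ℕ) (x : Matrix.SpecialLinearGroup (Fin (m + r)) ℝ) :
    x ∈ Q (m + r) m ↔ ∃ (g : Matrix.SpecialLinearGroup (Fin m) ℝ) (w : Matrix (Fin m) (Fin r) ℝ),
      Matrix.reindex finSumFinEquiv.symm finSumFinEquiv.symm
        (x : Matrix (Fin (m + r)) (Fin (m + r)) ℝ)
        = Matrix.fromBlocks (g : Matrix (Fin m) (Fin m) ℝ) w 0 1 := by
  constructor
  · intro hx
    set y := Matrix.reindex finSumFinEquiv.symm finSumFinEquiv.symm
      (x : Matrix (Fin (m + r)) (Fin (m + r)) ℝ) with hy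
    have hrow : ∀ (i : Fin r) (j : Fin m ⊕ Fin r),
        y (Sum.inr i) j = if Sum.inr i = j then 1 else 0 := by
      intro i j
      have h := congrFun (hx (Fin.natAdd m i) (by simp)) (finSumFinEquiv j)
      rw [Matrix.single_one_vecMul] at h
      have h2 : y (Sum.inr i) j
          = (x : Matrix (Fin (m + r)) (Fin (m + r)) ℝ) (Fin.natAdd m i) (finSumFinEquiv j) := by
        simp [hy]
      rw [h2]
      refine Eq.trans h ?_
      rw [Pi.single_apply, ← finSumFinEquiv_apply_right]
      simp only [EmbeddingLike.apply_eq_iff_eq, eq_comm]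
    have hblock : y = Matrix.fromBlocks y.toBlocks₁₁ y.toBlocks₁₂ 0 1 := by
      ext i j
      rcases i with i | i <;> rcases j with j | j
      · rfl
      · rfl
      · simp [hrow]
      · simp [hrow, Matrix.one_apply]
    have hdet : y.toBlocks₁₁.det = 1 := by
      have h1 : y.det = 1 := by
        rw [hy, Matrix.det_reindex_self]
        exact x.2
      rw [hblock, Matrix.det_fromBlocks_zero₂₁] at h1
      simpa using h1
    exact ⟨⟨y.toBlocks₁₁, hdet⟩, y.toBlocks₁₂, hblock⟩
  · rintro ⟨g, w, h⟩ i hi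
    obtain ⟨i, rfl⟩ : ∃ i' : Fin r, i = finSumFinEquiv (Sum.inr i') :=
      ⟨⟨i - m, by omega⟩, by ext; simp; omega⟩
    ext j
    obtain ⟨j, rfl⟩ := finSumFinEquiv.surjective j
    have h2 := congrFun (congrFun h (Sum.inr i)) j
    rw [Matrix.reindex_apply, Matrix.submatrix_apply, Equiv.symm_symm] at h2
    rw [Matrix.single_one_vecMul]
    refine Eq.trans h2 ?_
    simp only [Pi.single_apply, EmbeddingLike.apply_eq_iff_eq]
    rcases j with j | j
    · simp [Matrix.fromBlocks]
    · simp [Matrix.fromBlocks, Matrix.one_apply, eq_comm]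

section Subspaces

variable {G V : Type*} [Monoid G] [NormedAddCommGroup V] [NormedSpace ℝ V]

/-- The vectors `v` with `ρ(g_i) v → 0`. -/
def contracted (ρ : Representation ℝ G V) (g : ℕ → G) : Submodule ℝ V where
  carrier := {v | Tendsto (fun i => ρ (g i) v) atTop (𝓝 0)}
  zero_mem' := by simp
  add_mem' := by
    intro v w hv hw
    simpa using Tendsto.add hv hw
  smul_mem' := by
    intro c v hv
    simpa using Tendsto.const_smul hv c

/-- The vectors `v` such that `ρ(g_i) v` converges in `V`. -/
def convergent (ρ : Representation ℝ G V) (g : ℕ → G) : Submodule ℝ V where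
  carrier := {v | ∃ w, Tendsto (fun i => ρ (g i) v) atTop (𝓝 w)}
  zero_mem' := ⟨0, by simp⟩
  add_mem' := by
    rintro v w ⟨v', hv⟩ ⟨w', hw⟩
    exact ⟨v' + w', by simpa using Tendsto.add hv hw⟩
  smul_mem' := by
    rintro c v ⟨v', hv⟩
    exact ⟨c • v', by simpa using Tendsto.const_smul hv c⟩

end Subspaces

section Decomposition

variable {d k : ℕ} {V : Type*} [NormedAddCommGroup V] [NormedSpace ℝ V]

/-- `V⁻(T) = {v | exp(A(t_i)) v → 0}`. -/
noncomputable def Vminus (ρ : Representation ℝ (Matrix.SpecialLinearGroup (Fin (d + 1)) ℝ) V)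
    (m : Fin k → ℕ) (hm : ∀ l, m l ≤ d) (T : ℕ → Fin k → ℝ) : Submodule ℝ V :=
  contracted ρ (fun i => expCartan d m hm (T i))

/-- `V⁺(T) = {v | exp(-A(t_i)) v → 0}`. -/
noncomputable def Vplus (ρ : Representation ℝ (Matrix.SpecialLinearGroup (Fin (d + 1)) ℝ) V)
    (m : Fin k → ℕ) (hm : ∀ l, m l ≤ d) (T : ℕ → Fin k → ℝ) : Submodule ℝ V :=
  contracted ρ (fun i => (expCartan d m hm (T i))⁻¹)

/-- `V⁰(T)`: the vectors `v` for which both `exp(A(t_i)) v` and `exp(-A(t_i)) v` converge. -/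
noncomputable def Vzero (ρ : Representation ℝ (Matrix.SpecialLinearGroup (Fin (d + 1)) ℝ) V)
    (m : Fin k → ℕ) (hm : ∀ l, m l ≤ d) (T : ℕ → Fin k → ℝ) : Submodule ℝ V :=
  convergent ρ (fun i => (expCartan d m hm (T i))⁻¹) ⊓
    convergent ρ (fun i => expCartan d m hm (T i))

end Decomposition

end ExpandingTranslates

/-! Foundation. A continuous finite-dimensional representation of `SL(n, ℝ)` is, up to a polynomial
factor, polynomial in the matrix entries: root subgroups act through nilpotent generators, and the
generic matrix, normalised to determinant one, is a product of elementary matrices over the field of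
rational functions. This yields a differential `dR`, and an inner product for which the adjoint of
`R g` is `R gᵀ` (`exists_adjoint_transpose`). Diagonal matrices then act by commuting symmetric
operators.

From the sequence to one flow. The weights occurring in `V⁰` are bounded along `T`, and those
occurring in `V⁻` tend to `-∞`. Subtracting a bounded correction from a far term of `T` gives a
vector `t` with positive coordinates at which the former vanish and the latter are nonpositive
(`exists_pos_of_bounded`). So all `u(φ(s)) v` have bounded orbits under `exp(xA)`, `x ≥ 0`, where `A
= A(t)`. On the first `m₁ + 1` coordinates, suitably ordered, `A` is trace-free with nonincreasing
entries, all negative except the first; on the other coordinates it is zero.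

Core case (`IsTransposeRep.apply_eq_self_of_bounded`): the block is the whole group. Write `u_s g =
b_s k_s` with `b_s` lower triangular with positive diagonal and `k_s` orthogonal. Conjugates of
`b_s⁻¹` by `exp(xA)`, `x ≥ 0`, stay bounded, so `k_s g⁻¹ v` has no component of positive `A`-weight.
Choose `g` minimising a positive combination over `s` of `exp(2 ∑ A_i log (b_s)_{ii})`; minimisers
exist because the first rows of the `u_s` span. Varying `g` along the moment matrix of `v' = g⁻¹ v`
gives a positive combination of the nonpositive numbers `⟪dR(A) k_s v', k_s v'⟫`; it vanishes at the
minimum, so `dR(A)` kills every `k_s v'`. For neighbouring `s`, `s'` an `LU` decomposition relates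
`k_s` and `k_s'`, and shows that `v'` is annihilated by the rank one matrix with column `x_s` and
row `x_s' - ⟪x_s, x_s'⟫ x_s`, where `x_s` is the first row of `k_s`. Along a fine chain of
parameters these matrices suffice to show that all of `sl` annihilates `v'`. Hence `v'` is fixed,
and `v = v'`.

General case (`IsTransposeRep.fixed_of_bounded`). The identity matrix of the upper left block grades
the space, and the upper right corner raises the degree by one. Going upwards in the degree, each
component of `v` is fixed by the block group and killed by the corner: orthogonally to the image of
the corner the core case applies, and inside that image the expansion by `exp(x A_0)` together with
the spanning hypothesis leaves nothing. -/

namespace ExpandingTranslates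

/-! ### One-parameter groups in Banach algebras. -/

section OneParameter

variable {𝔸 : Type*} [NormedRing 𝔸] [NormedAlgebra ℝ 𝔸] [CompleteSpace 𝔸]

/-- A continuous one-parameter group in a Banach algebra is an exponential. -/
theorem exists_exp_of_continuous_add (T : ℝ → 𝔸) (hT : Continuous T) (h0 : T 0 = 1)
    (hadd : ∀ x y, T (x + y) = T x * T y) :
    ∃ N : 𝔸, ∀ x, T x = NormedSpace.exp (x • N) := by
  have hint : ∀ a b : ℝ, IntervalIntegrable T MeasureTheory.volume a b :=
    fun a b => hT.intervalIntegrable a b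
  have hd0 : HasDerivAt (fun δ : ℝ => ∫ y in (0 : ℝ)..δ, T y) 1 0 := by
    have := intervalIntegral.integral_hasDerivAt_right (hint 0 0)
      (hT.stronglyMeasurableAtFilter _ _) hT.continuousAt
    simpa [h0] using this
  -- For small `δ ≠ 0` the mean of `T` over `[0, δ]` is close to `1`, hence invertible. Dividing by
  -- this integral turns the continuity of `T` into differentiability.
  obtain ⟨δ, hδ⟩ : ∃ δ : ℝ, IsUnit (∫ y in (0 : ℝ)..δ, T y) := by
    have h1 : Tendsto (fun δ : ℝ => δ⁻¹ • ∫ y in (0 : ℝ)..δ, T y) (𝓝[≠] 0) (𝓝 1) := by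
      have := hd0.tendsto_slope_zero
      simpa using this
    have h2 : ∀ᶠ δ in 𝓝[≠] (0 : ℝ), IsUnit (δ⁻¹ • ∫ y in (0 : ℝ)..δ, T y) :=
      h1.eventually (Units.isOpen.mem_nhds (by simp))
    obtain ⟨δ, h3, h4⟩ := (h2.and self_mem_nhdsWithin).exists
    refine ⟨δ, ?_⟩
    have h5 : δ ≠ 0 := h4
    have := h3.smul (Units.mk0 δ h5)
    simpa [Units.smul_def, smul_smul, h5] using this
  obtain ⟨J, hJ⟩ := hδ
  have hTx : ∀ x, T x * (J : 𝔸) = ∫ y in x..(x + δ), T y := by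
    intro x
    rw [hJ, ← ContinuousLinearMap.mul_apply' ℝ 𝔸,
      ← ContinuousLinearMap.intervalIntegral_comp_comm _ (hint _ _)]
    simp only [ContinuousLinearMap.mul_apply', ← hadd]
    simp
  have hder : ∃ N : 𝔸, HasDerivAt T N 0 := by
    have h6 : HasDerivAt (fun x : ℝ => ∫ y in x..(x + δ), T y) (T (0 + δ) - T 0) 0 := by
      have e : (fun x : ℝ => ∫ y in x..(x + δ), T y)
          = fun x => (∫ y in (0 : ℝ)..(x + δ), T y) - ∫ y in (0 : ℝ)..x, T y := by
        funext x
        rw [intervalIntegral.integral_interval_sub_left (hint _ _) (hint _ _)]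
      rw [e]
      refine HasDerivAt.sub ?_ ?_
      · have := intervalIntegral.integral_hasDerivAt_right (hint 0 (0 + δ))
          (hT.stronglyMeasurableAtFilter _ _) (hT.continuousAt (x := 0 + δ))
        exact HasDerivAt.comp_add_const 0 δ this
      · rw [h0]; exact hd0
    refine ⟨(T (0 + δ) - T 0) * (J⁻¹ : 𝔸ˣ), ?_⟩
    have h7 := h6.mul_const ((J⁻¹ : 𝔸ˣ) : 𝔸)
    refine h7.congr_of_eventuallyEq (Eventually.of_forall fun x => ?_)
    simp [← hTx]
  obtain ⟨N, hN⟩ := hder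
  refine ⟨N, ?_⟩
  have hNx : ∀ x, HasDerivAt T (T x * N) x := by
    intro x
    have h8 : HasDerivAt (fun y => T (y - x)) N x := by
      have : HasDerivAt T N (x - x) := by simpa using hN
      exact this.comp_sub_const x x
    have h9 := h8.const_mul (T x)
    refine h9.congr_of_eventuallyEq (Eventually.of_forall fun y => ?_)
    simp [← hadd]
  have hconst : ∀ x, T x * NormedSpace.exp (x • (-N)) = 1 := by
    have hd : ∀ x, HasDerivAt (fun x : ℝ => T x * NormedSpace.exp (x • (-N))) 0 x := by
      intro x
      have := (hNx x).mul (hasDerivAt_exp_smul_const' (𝕂 := ℝ) (-N) x)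
      refine this.congr_deriv ?_
      rw [neg_mul, mul_neg, mul_assoc, add_neg_cancel]
    intro x
    have := is_const_of_deriv_eq_zero (fun x => (hd x).differentiableAt) (fun x => (hd x).deriv) x 0
    simpa [h0] using this
  intro x
  have h10 : NormedSpace.exp (x • (-N)) * NormedSpace.exp (x • N) = (1 : 𝔸) := by
    let _ : NormedAlgebra ℚ 𝔸 := NormedAlgebra.restrictScalars ℚ ℝ 𝔸
    rw [← NormedSpace.exp_add_of_commute]
    · simp
    · exact (((Commute.refl N).neg_left).smul_left x).smul_right x
  calc T x = T x * (NormedSpace.exp (x • (-N)) * NormedSpace.exp (x • N)) := by rw [h10, mul_one]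
    _ = NormedSpace.exp (x • N) := by rw [← mul_assoc, hconst, one_mul]

end OneParameter

/-! ### Root subgroups act polynomially. -/

section Transvection

open Matrix Matrix.SpecialLinearGroup

variable {n : Type*} [Fintype n] [DecidableEq n]
  {𝔸 : Type*} [NormedRing 𝔸] [NormedAlgebra ℝ 𝔸] [FiniteDimensional ℝ 𝔸]

/-- The scaling factor differs from a root of unity, which forces the generator of the root subgroup
to act nilpotently. -/
theorem diag2n_mul_transvection {i j : n} (hij : i ≠ j) (x : ℝ) :
    diag2n hij (2 : ℝ) two_ne_zero * transvection hij x
      = transvection hij (4 * x) * diag2n hij (2 : ℝ) two_ne_zero := by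
  ext k l
  simp only [coe_mul, diag2n_coe, transvection_coe, Matrix.add_apply, Matrix.one_apply,
    Matrix.diagonal_mul, Matrix.mul_diagonal, Matrix.single_apply]
  grind

/-- In a continuous finite-dimensional representation of `SL(n, ℝ)`, the root subgroups act
polynomially. -/
theorem exists_map_transvection_eq_sum (R : SpecialLinearGroup n ℝ →* 𝔸) (hR : Continuous R)
    {i j : n} (hij : i ≠ j) :
    ∃ (K : ℕ) (C : ℕ → 𝔸), ∀ x : ℝ,
      R (transvection hij x) = ∑ k ∈ Finset.range K, x ^ k • C k := by
  have : CompleteSpace 𝔸 := FiniteDimensional.complete ℝ 𝔸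
  have hcont : Continuous fun x : ℝ => (transvection hij x : SpecialLinearGroup n ℝ) := by
    refine Continuous.subtype_mk ?_ _
    refine continuous_matrix fun k l => ?_
    simp only [Matrix.transvection, Matrix.add_apply, Matrix.single_apply]
    split_ifs <;> fun_prop
  obtain ⟨N, hN⟩ := exists_exp_of_continuous_add (fun x => R (transvection hij x))
    (hR.comp hcont) (by simp [transvection_coeff_zero]) (fun x y => by
      simp [transvection_add])
  set a := R (diag2n hij (2 : ℝ) two_ne_zero) with ha
  set b := R (diag2n hij (2 : ℝ) two_ne_zero)⁻¹ with hb
  have hba : b * a = 1 := by rw [ha, hb, ← map_mul]; simp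
  have hab : a * b = 1 := by rw [ha, hb, ← map_mul]; simp
  have hconj : a * N * b = (4 : ℝ) • N := by
    have h1 : HasDerivAt (fun x : ℝ => a * NormedSpace.exp (x • N) * b) (a * N * b) 0 := by
      have := ((hasDerivAt_exp_smul_const' (𝕂 := ℝ) N (0 : ℝ)).const_mul a).mul_const b
      simpa using this
    have h2 : HasDerivAt (fun x : ℝ => NormedSpace.exp (x • ((4 : ℝ) • N))) ((4 : ℝ) • N) 0 := by
      have := hasDerivAt_exp_smul_const' (𝕂 := ℝ) ((4 : ℝ) • N) (0 : ℝ)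
      simpa using this
    refine h1.unique (h2.congr_of_eventuallyEq (Eventually.of_forall fun x => ?_))
    have h3 := congrArg R (diag2n_mul_transvection hij x)
    rw [map_mul, map_mul, hN, hN, ← ha] at h3
    simp only [h3, mul_assoc, hab, mul_one, smul_smul]
    rw [mul_comm]
  have hpow : ∀ k, a * N ^ k * b = ((4 : ℝ) ^ k) • N ^ k := by
    intro k
    induction k with
    | zero => simp [hab]
    | succ k ih =>
      have : a * N ^ (k + 1) * b = (a * N ^ k * b) * (a * N * b) := by
        rw [pow_succ]
        simp only [mul_assoc]
        rw [← mul_assoc b a, hba, one_mul]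
      rw [this, ih, hconj, smul_mul_smul_comm, ← pow_succ, ← pow_succ]
  -- A nonzero power `N ^ k` is an eigenvector of conjugation by `a` with eigenvalue `4 ^ k`. These
  -- eigenvalues are distinct, and only finitely many can occur on the finite-dimensional `𝔸`.
  obtain ⟨K, hK⟩ : ∃ K, N ^ K = 0 := by
    by_contra! hne
    let f : Module.End ℝ 𝔸 := LinearMap.mulLeft ℝ a ∘ₗ LinearMap.mulRight ℝ b
    have hf : ∀ k : ℕ, f.HasEigenvalue ((4 : ℝ) ^ k) := fun k =>
      Module.End.hasEigenvalue_of_hasEigenvector (x := N ^ k)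
        ⟨Module.End.mem_eigenspace_iff.mpr (by
          simp only [f, LinearMap.comp_apply, LinearMap.mulLeft_apply, LinearMap.mulRight_apply,
            ← mul_assoc, hpow]), hne k⟩
    have hinj : Function.Injective fun k : ℕ => (4 : ℝ) ^ k :=
      pow_right_injective₀ (by norm_num) (by norm_num)
    exact Set.infinite_of_injective_forall_mem hinj hf f.finite_hasEigenvalue
  refine ⟨K, fun k => ((k.factorial : ℝ)⁻¹) • N ^ k, fun x => ?_⟩
  rw [hN, NormedSpace.exp_eq_tsum ℝ]
  refine (tsum_eq_sum (s := Finset.range K) ?_).trans ?_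
  rotate_left
  · refine Finset.sum_congr rfl fun k _ => ?_
    rw [smul_pow, smul_comm]
  · intro k hk
    rw [smul_pow, pow_eq_zero_of_le (by simpa using hk) hK]
    simp

end Transvection

/-! ### Polynomial maps, generic points and specialization of rational functions. -/

section PolynomialMaps

open Matrix Matrix.SpecialLinearGroup

variable {n : Type*} {W W' : Type*} [AddCommGroup W] [Module ℝ W] [AddCommGroup W'] [Module ℝ W']

/-- Polynomial maps from square matrices to a real vector space. -/
inductive PolyMap : (Matrix n n ℝ → W) → Prop
  | const (c : W) : PolyMap fun _ => c
  | add {f g : Matrix n n ℝ → W} : PolyMap f → PolyMap g → PolyMap fun x => f x + g x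
  | coord (i j : n) {f : Matrix n n ℝ → W} : PolyMap f → PolyMap fun x => x i j • f x

namespace PolyMap

theorem map (L : W →ₗ[ℝ] W') {f : Matrix n n ℝ → W} (hf : PolyMap f) :
    PolyMap fun x => L (f x) := by
  induction hf with
  | const c => exact const _
  | add _ _ h1 h2 => simpa using h1.add h2
  | coord i j _ h => simpa using h.coord i j

theorem sum {ι : Type*} (s : Finset ι) {f : ι → Matrix n n ℝ → W} (hf : ∀ i ∈ s, PolyMap (f i)) :
    PolyMap fun x => ∑ i ∈ s, f i x := by
  classical
  induction s using Finset.induction_on with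
  | empty => simpa using const (0 : W)
  | insert a s ha ih =>
    simp only [Finset.sum_insert ha]
    exact (hf a (by simp)).add (ih fun i hi => hf i (by simp [hi]))

theorem smul {p : Matrix n n ℝ → ℝ} (hp : PolyMap p) {f : Matrix n n ℝ → W} (hf : PolyMap f) :
    PolyMap fun x => p x • f x := by
  induction hp with
  | const c => exact hf.map (LinearMap.lsmul ℝ W c)
  | add _ _ h1 h2 => simpa [add_smul] using h1.add h2
  | coord i j _ h => simpa [mul_smul] using h.coord i j

theorem mul {𝔸 : Type*} [Ring 𝔸] [Algebra ℝ 𝔸] {f g : Matrix n n ℝ → 𝔸} (hf : PolyMap f)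
    (hg : PolyMap g) : PolyMap fun x => f x * g x := by
  induction hf with
  | const c => exact hg.map (LinearMap.mulLeft ℝ c)
  | add _ _ h1 h2 => simpa [add_mul] using h1.add h2
  | coord i j _ h => simpa using h.coord i j

theorem comp_mul_right [Fintype n] {f : Matrix n n ℝ → W} (hf : PolyMap f) (h : Matrix n n ℝ) :
    PolyMap fun x => f (x * h) := by
  induction hf with
  | const c => exact const _
  | add _ _ h1 h2 => exact h1.add h2
  | @coord i j f _ ih =>
    simp only [Matrix.mul_apply, Finset.sum_smul]
    refine sum _ fun k _ => ?_
    have := (ih.map (LinearMap.lsmul ℝ W (h k j))).coord i k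
    simpa [mul_smul] using this

theorem comp_mul_left [Fintype n] {f : Matrix n n ℝ → W} (hf : PolyMap f) (h : Matrix n n ℝ) :
    PolyMap fun x => f (h * x) := by
  induction hf with
  | const c => exact const _
  | add _ _ h1 h2 => exact h1.add h2
  | @coord i j f _ ih =>
    simp only [Matrix.mul_apply, Finset.sum_smul]
    refine sum _ fun k _ => ?_
    have := (ih.map (LinearMap.lsmul ℝ W (h i k))).coord k j
    convert this using 2
    rw [LinearMap.lsmul_apply, smul_smul, mul_comm]

/-- Evaluation of a polynomial in the matrix entries. -/
noncomputable def evalMat (p : MvPolynomial (n × n) ℝ) (g : Matrix n n ℝ) : ℝ :=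
  MvPolynomial.eval (fun ij : n × n => g ij.1 ij.2) p

theorem evalMat_polyMap (p : MvPolynomial (n × n) ℝ) : PolyMap (evalMat p) := by
  induction p using MvPolynomial.induction_on with
  | C a =>
    convert const a using 2
    simp [evalMat]
  | add p q hp hq =>
    have := hp.add hq
    convert this using 2
    simp [evalMat]
  | mul_X p ij h =>
    have := h.coord ij.1 ij.2
    convert this using 2
    simp [evalMat, mul_comm]

@[simp] theorem evalMat_mul (p q : MvPolynomial (n × n) ℝ) (g : Matrix n n ℝ) :
    evalMat (p * q) g = evalMat p g * evalMat q g := by simp [evalMat]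

@[simp] theorem evalMat_add (p q : MvPolynomial (n × n) ℝ) (g : Matrix n n ℝ) :
    evalMat (p + q) g = evalMat p g + evalMat q g := by simp [evalMat]

theorem exists_evalMat_ne_zero {p : MvPolynomial (n × n) ℝ} (hp : p ≠ 0) :
    ∃ g, evalMat p g ≠ 0 := by
  by_contra! h
  refine hp (MvPolynomial.funext fun x => ?_)
  have := h (fun i j => x (i, j))
  simpa [evalMat] using this

end PolyMap

open PolyMap

/-- The filter of sets of matrices that contain a nonempty Zariski open set. -/
def genericFilter (n : Type*) : Filter (Matrix n n ℝ) where
  sets := {S | ∃ p : MvPolynomial (n × n) ℝ, p ≠ 0 ∧ ∀ g, evalMat p g ≠ 0 → g ∈ S}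
  univ_sets := ⟨1, one_ne_zero, fun _ _ => trivial⟩
  sets_of_superset := fun ⟨p, hp, h⟩ hST => ⟨p, hp, fun g hg => hST (h g hg)⟩
  inter_sets := by
    rintro S T ⟨p, hp, h⟩ ⟨q, hq, h'⟩
    refine ⟨p * q, mul_ne_zero hp hq, fun g hg => ?_⟩
    rw [evalMat_mul] at hg
    exact ⟨h g (left_ne_zero_of_mul hg), h' g (right_ne_zero_of_mul hg)⟩

theorem eventually_generic {P : Matrix n n ℝ → Prop} : (∀ᶠ g in genericFilter n, P g) ↔
    ∃ p : MvPolynomial (n × n) ℝ, p ≠ 0 ∧ ∀ g, evalMat p g ≠ 0 → P g := Iff.rfl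

theorem eventually_evalMat_ne_zero {p : MvPolynomial (n × n) ℝ} (hp : p ≠ 0) :
    ∀ᶠ g in genericFilter n, evalMat p g ≠ 0 := ⟨p, hp, fun _ h => h⟩

/-- The value at a matrix of a rational function of the entries (zero at the poles). -/
noncomputable def ratEval (x : FractionRing (MvPolynomial (n × n) ℝ)) (g : Matrix n n ℝ) : ℝ :=
  evalMat (IsLocalization.sec (nonZeroDivisors (MvPolynomial (n × n) ℝ)) x).1 g /
    evalMat (IsLocalization.sec (nonZeroDivisors (MvPolynomial (n × n) ℝ)) x).2 g

local notation "𝔽" => FractionRing (MvPolynomial (n × n) ℝ)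

/-- `ratEval` uses one chosen fraction for `x`. Any other fraction for `x` has the same value off
the zeros of the two denominators, which is why evaluation is shown to be compatible with sums and
products only generically. -/
theorem ratEval_eq {x : 𝔽} {p q : MvPolynomial (n × n) ℝ} (hq : q ≠ 0)
    (h : x * algebraMap _ 𝔽 q = algebraMap _ 𝔽 p) :
    ∀ᶠ g in genericFilter n, ratEval x g = evalMat p g / evalMat q g := by
  have h1 := IsLocalization.sec_spec (nonZeroDivisors (MvPolynomial (n × n) ℝ)) x
  set a := IsLocalization.sec (nonZeroDivisors (MvPolynomial (n × n) ℝ)) x with ha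
  have hden : (a.2 : MvPolynomial (n × n) ℝ) ≠ 0 := nonZeroDivisors.coe_ne_zero _
  have h2 : p * a.2 = a.1 * q := by
    apply IsFractionRing.injective (MvPolynomial (n × n) ℝ) 𝔽
    rw [map_mul, map_mul, ← h, ← h1]; ring
  filter_upwards [eventually_evalMat_ne_zero hq, eventually_evalMat_ne_zero hden] with g hg1 hg2
  have h3 := congrArg (fun r => evalMat r g) h2
  simp only [evalMat_mul] at h3
  rw [ratEval, ← ha, div_eq_div_iff hg2 hg1, h3]

theorem ratEval_spec (x : 𝔽) : ∃ p q : MvPolynomial (n × n) ℝ, q ≠ 0 ∧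
    x * algebraMap _ 𝔽 q = algebraMap _ 𝔽 p ∧
    ∀ᶠ g in genericFilter n, evalMat q g ≠ 0 ∧ ratEval x g = evalMat p g / evalMat q g := by
  have h1 := IsLocalization.sec_spec (nonZeroDivisors (MvPolynomial (n × n) ℝ)) x
  refine ⟨_, _, nonZeroDivisors.coe_ne_zero _, h1, ?_⟩
  exact (eventually_evalMat_ne_zero (nonZeroDivisors.coe_ne_zero _)).and
    (ratEval_eq (nonZeroDivisors.coe_ne_zero _) h1)

theorem ratEval_algebraMap (p : MvPolynomial (n × n) ℝ) :
    ∀ᶠ g in genericFilter n, ratEval (algebraMap _ 𝔽 p) g = evalMat p g := by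
  filter_upwards [ratEval_eq (x := algebraMap _ 𝔽 p) (p := p) one_ne_zero (by simp)] with g hg
  simpa [evalMat] using hg

theorem ratEval_mul (x y : 𝔽) :
    ∀ᶠ g in genericFilter n, ratEval (x * y) g = ratEval x g * ratEval y g := by
  obtain ⟨p, q, hq, h, hx⟩ := ratEval_spec x
  obtain ⟨p', q', hq', h', hy⟩ := ratEval_spec y
  filter_upwards [hx, hy, ratEval_eq (x := x * y) (p := p * p') (mul_ne_zero hq hq')
    (by rw [map_mul, map_mul, ← h, ← h']; ring)] with g h1 h2 h3
  rw [h1.2, h2.2, h3, evalMat_mul, evalMat_mul]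
  field_simp

theorem ratEval_add (x y : 𝔽) :
    ∀ᶠ g in genericFilter n, ratEval (x + y) g = ratEval x g + ratEval y g := by
  obtain ⟨p, q, hq, h, hx⟩ := ratEval_spec x
  obtain ⟨p', q', hq', h', hy⟩ := ratEval_spec y
  filter_upwards [hx, hy, ratEval_eq (x := x + y) (p := p * q' + p' * q) (mul_ne_zero hq hq')
    (by rw [map_mul, map_add, map_mul, map_mul, ← h, ← h']; ring)] with g h1 h2 h3
  rw [h1.2, h2.2, h3]
  simp only [evalMat_mul, evalMat_add]
  have := h1.1
  have := h2.1
  field_simp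

theorem ratEval_one : ∀ᶠ g in genericFilter n, ratEval (1 : 𝔽) g = 1 := by
  simpa [evalMat] using ratEval_algebraMap (n := n) 1

theorem ratEval_zero : ∀ᶠ g in genericFilter n, ratEval (0 : 𝔽) g = 0 := by
  simpa [evalMat] using ratEval_algebraMap (n := n) 0

theorem ratEval_sum {ι : Type*} (s : Finset ι) (x : ι → 𝔽) :
    ∀ᶠ g in genericFilter n, ratEval (∑ i ∈ s, x i) g = ∑ i ∈ s, ratEval (x i) g := by
  classical
  induction s using Finset.induction_on with
  | empty => simpa using ratEval_zero
  | insert a s ha ih =>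
    filter_upwards [ih, ratEval_add (x a) (∑ i ∈ s, x i)] with g h1 h2
    rw [Finset.sum_insert ha, Finset.sum_insert ha, h2, h1]

/-- Generic evaluation of a matrix of rational functions. -/
noncomputable def ratEvalMat (M : Matrix n n 𝔽) (g : Matrix n n ℝ) : Matrix n n ℝ :=
  M.map fun x => ratEval x g

theorem ratEvalMat_mul [Fintype n] (M N : Matrix n n 𝔽) :
    ∀ᶠ g in genericFilter n, ratEvalMat (M * N) g = ratEvalMat M g * ratEvalMat N g := by
  have h1 : ∀ᶠ g in genericFilter n, ∀ i j k,
      ratEval (M i k * N k j) g = ratEval (M i k) g * ratEval (N k j) g := by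
    simp only [eventually_all]
    exact fun i j k => ratEval_mul _ _
  have h2 : ∀ᶠ g in genericFilter n, ∀ i j,
      ratEval (∑ k, M i k * N k j) g = ∑ k, ratEval (M i k * N k j) g := by
    simp only [eventually_all]
    exact fun i j => ratEval_sum _ _
  filter_upwards [h1, h2] with g h3 h4
  ext i j
  simp [ratEvalMat, Matrix.mul_apply, h4, h3]

variable {𝔸 : Type*} [Ring 𝔸] [Algebra ℝ 𝔸]

/-- Rational maps from square matrices to a real algebra. -/
def IsRatMap (f : Matrix n n ℝ → 𝔸) : Prop :=
  ∃ w : MvPolynomial (n × n) ℝ, w ≠ 0 ∧ ∃ P : Matrix n n ℝ → 𝔸, PolyMap P ∧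
    ∀ᶠ g in genericFilter n, evalMat w g • f g = P g

theorem IsRatMap.mul {f g : Matrix n n ℝ → 𝔸} (hf : IsRatMap f) (hg : IsRatMap g) :
    IsRatMap fun x => f x * g x := by
  obtain ⟨w, hw, P, hP, h⟩ := hf
  obtain ⟨w', hw', P', hP', h'⟩ := hg
  refine ⟨w * w', mul_ne_zero hw hw', _, hP.mul hP', ?_⟩
  filter_upwards [h, h'] with x h1 h2
  rw [evalMat_mul, ← h1, ← h2, smul_mul_smul_comm]

theorem isRatMap_sum_pow (x : 𝔽) (K : ℕ) (C : ℕ → 𝔸) :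
    IsRatMap fun g => ∑ k ∈ Finset.range K, ratEval x g ^ k • C k := by
  obtain ⟨p, q, hq, -, hx⟩ := ratEval_spec x
  -- The factor `q ^ K` clears the denominators of all powers `(p / q) ^ k` with `k < K`.
  refine ⟨q ^ K, pow_ne_zero _ hq,
    fun g => ∑ k ∈ Finset.range K, evalMat (p ^ k * q ^ (K - k)) g • C k, ?_, ?_⟩
  · exact PolyMap.sum _ fun k _ => (evalMat_polyMap _).smul (PolyMap.const _)
  · filter_upwards [hx] with g hg
    rw [Finset.smul_sum]
    refine Finset.sum_congr rfl fun k hk => ?_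
    rw [smul_smul, hg.2]
    congr 1
    have h1 : K = k + (K - k) := by have := Finset.mem_range.mp hk; omega
    have h2 := hg.1
    have e : ∀ (r : MvPolynomial (n × n) ℝ) (m : ℕ), evalMat (r ^ m) g = evalMat r g ^ m := by
      intro r m; simp [evalMat]
    rw [evalMat_mul, e, e, e, div_pow]
    conv_lhs => rw [h1, pow_add]
    field_simp

end PolynomialMaps
-- Continuous representations are rational.
section Rationality

open Matrix Matrix.SpecialLinearGroup PolyMap

variable {n : Type*} [Fintype n] [DecidableEq n]

/-- Each half of the product represents a Weyl group element; their quotient is diagonal. This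
reduces the diagonal generators of `SL` to root subgroups. -/
theorem diag2n_eq_prod_transvection {F : Type*} [Field F] {i j : n} (hij : i ≠ j) (a : F)
    (ha : a ≠ 0) :
    diag2n hij a ha = transvection hij a * transvection hij.symm (-a⁻¹) * transvection hij a *
      transvection hij (-1) * transvection hij.symm 1 * transvection hij (-1) := by
  have h1 : (transvection hij a * transvection hij.symm (-a⁻¹) * transvection hij a :
      SpecialLinearGroup n F).1
      = 1 - Matrix.single i i 1 - Matrix.single j j 1 + Matrix.single i j a
        - Matrix.single j i a⁻¹ := by
    simp only [coe_mul, transvection_coe, Matrix.mul_add, Matrix.add_mul, mul_one, one_mul,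
      Matrix.single_mul_single_same, Matrix.single_mul_single_of_ne _ _ _ _ hij.symm]
    ext k l
    simp only [Matrix.add_apply, Matrix.sub_apply, Matrix.one_apply, Matrix.single_apply,
      Matrix.zero_apply]
    grind
  have h2 : (transvection hij (-1) * transvection hij.symm 1 * transvection hij (-1) :
      SpecialLinearGroup n F).1
      = 1 - Matrix.single i i 1 - Matrix.single j j 1 - Matrix.single i j 1
        + Matrix.single j i 1 := by
    simp only [coe_mul, transvection_coe, Matrix.mul_add, Matrix.add_mul, mul_one, one_mul,
      Matrix.single_mul_single_same, Matrix.single_mul_single_of_ne _ _ _ _ hij.symm]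
    ext k l
    simp only [Matrix.add_apply, Matrix.sub_apply, Matrix.one_apply, Matrix.single_apply,
      Matrix.zero_apply]
    grind
  apply Subtype.ext
  rw [mul_assoc _ (transvection hij.symm 1), mul_assoc _ (transvection hij (-1)), coe_mul,
    ← mul_assoc (transvection hij (-1)), h1, h2]
  simp only [Matrix.mul_add, Matrix.add_mul, Matrix.mul_sub, Matrix.sub_mul, mul_one, one_mul,
      Matrix.single_mul_single_same, Matrix.single_mul_single_of_ne _ _ _ _ hij,
      Matrix.single_mul_single_of_ne _ _ _ _ hij.symm]
  rw [diag2n_coe]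
  ext k l
  simp only [Matrix.add_apply, Matrix.sub_apply, Matrix.one_apply, Matrix.single_apply,
    Matrix.diagonal_apply, Matrix.zero_apply]
  grind

variable {𝔸 : Type*} [NormedRing 𝔸] [NormedAlgebra ℝ 𝔸] [FiniteDimensional ℝ 𝔸]

local notation "𝔽" => FractionRing (MvPolynomial (n × n) ℝ)

theorem exists_ratEval_transvection (R : SpecialLinearGroup n ℝ →* 𝔸) (hR : Continuous R)
    {i j : n} (hij : i ≠ j) (a : 𝔽) :
    ∃ f : Matrix n n ℝ → SpecialLinearGroup n ℝ,
      (∀ᶠ g in genericFilter n, (f g : Matrix n n ℝ)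
        = ratEvalMat (transvection hij a : SpecialLinearGroup n 𝔽).1 g) ∧
      IsRatMap fun g => R (f g) := by
  refine ⟨fun g => transvection hij (ratEval a g), ?_, ?_⟩
  · filter_upwards [ratEval_one, ratEval_zero, ratEval_add 1 a] with g h1 h0 h2
    ext k l
    simp only [transvection_coe, ratEvalMat, Matrix.map_apply, Matrix.add_apply, Matrix.one_apply,
      Matrix.single_apply]
    split_ifs <;> simp_all
  · obtain ⟨K, C, h⟩ := exists_map_transvection_eq_sum R hR hij
    simp only [h]
    exact isRatMap_sum_pow a K C

/-- Every element of `SL(n)` over the field of rational functions in the matrix entries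
specializes, and its image in a finite-dimensional representation is rational. -/
theorem exists_ratEval_specialLinearGroup [Nontrivial n] (R : SpecialLinearGroup n ℝ →* 𝔸)
    (hR : Continuous R) (M : SpecialLinearGroup n 𝔽) :
    ∃ f : Matrix n n ℝ → SpecialLinearGroup n ℝ,
      (∀ᶠ g in genericFilter n, (f g : Matrix n n ℝ) = ratEvalMat M.1 g) ∧
      IsRatMap fun g => R (f g) := by
  have hmul : ∀ A B : SpecialLinearGroup n 𝔽,
      (∃ f : Matrix n n ℝ → SpecialLinearGroup n ℝ,
        (∀ᶠ g in genericFilter n, (f g : Matrix n n ℝ) = ratEvalMat A.1 g) ∧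
        IsRatMap fun g => R (f g)) →
      (∃ f : Matrix n n ℝ → SpecialLinearGroup n ℝ,
        (∀ᶠ g in genericFilter n, (f g : Matrix n n ℝ) = ratEvalMat B.1 g) ∧
        IsRatMap fun g => R (f g)) →
      ∃ f : Matrix n n ℝ → SpecialLinearGroup n ℝ,
        (∀ᶠ g in genericFilter n, (f g : Matrix n n ℝ) = ratEvalMat (A * B).1 g) ∧
        IsRatMap fun g => R (f g) := by
    rintro A B ⟨f, h1, h2⟩ ⟨f', h1', h2'⟩
    refine ⟨fun g => f g * f' g, ?_, ?_⟩
    · filter_upwards [h1, h1', ratEvalMat_mul A.1 B.1] with g e1 e2 e3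
      rw [coe_mul, coe_mul, e1, e2, e3]
    · simp only [map_mul]
      exact h2.mul h2'
  refine diagonal_transvection_induction' _ M ?_ ?_ hmul
  · intro i j hij c hc
    rw [diag2n_eq_prod_transvection]
    have ht := fun (i j : n) (hij : i ≠ j) (a : 𝔽) => exists_ratEval_transvection R hR hij a
    exact hmul _ _ (hmul _ _ (hmul _ _ (hmul _ _ (hmul _ _ (ht _ _ _ _) (ht _ _ _ _))
      (ht _ _ _ _)) (ht _ _ _ _)) (ht _ _ _ _)) (ht _ _ _ _)
  · intro i j hij a
    exact exists_ratEval_transvection R hR hij a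

/-- A continuous finite-dimensional representation of `SL(n, ℝ)` becomes polynomial after
multiplication by a nonzero polynomial. -/
theorem exists_polyMap_smul_eq [Nontrivial n] (R : SpecialLinearGroup n ℝ →* 𝔸)
    (hR : Continuous R) :
    ∃ (w : Matrix n n ℝ → ℝ) (P : Matrix n n ℝ → 𝔸), PolyMap w ∧ PolyMap P ∧
      (∃ g₀ : SpecialLinearGroup n ℝ, w g₀ ≠ 0) ∧
      ∀ g : SpecialLinearGroup n ℝ, w g • R g = P g := by
  obtain ⟨i₀, -⟩ := exists_pair_ne n
  let X : Matrix n n 𝔽 := (Matrix.mvPolynomialX n n ℝ).map (algebraMap _ 𝔽)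
  have hX : X.det = algebraMap _ 𝔽 (Matrix.mvPolynomialX n n ℝ).det := by
    rw [RingHom.map_det]; rfl
  have hX0 : X.det ≠ 0 := by
    rw [hX]
    intro h
    exact Matrix.det_mvPolynomialX_ne_zero n ℝ
      (IsFractionRing.injective (MvPolynomial (n × n) ℝ) 𝔽 (by simpa using h))
  -- Dividing one column of the generic matrix by its determinant gives a point of `SL` over the
  -- field of rational functions.
  let D : Matrix n n 𝔽 := Matrix.diagonal (Function.update 1 i₀ X.det⁻¹)
  have hdet : (X * D).det = 1 := by
    rw [Matrix.det_mul, Matrix.det_diagonal, Finset.prod_update_of_mem (Finset.mem_univ _)]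
    simp [hX0]
  obtain ⟨f, hf, w, hw, P, hP, h⟩ := exists_ratEval_specialLinearGroup R hR ⟨X * D, hdet⟩
  have hgen : ∀ᶠ g in genericFilter n,
      (f g : Matrix n n ℝ) = g * Matrix.diagonal (Function.update 1 i₀ g.det⁻¹) := by
    have h1 : ∀ᶠ g in genericFilter n, ∀ i j, ratEval (X i j) g = g i j := by
      simp only [eventually_all]
      intro i j
      filter_upwards [ratEval_algebraMap (n := n) (MvPolynomial.X (i, j))] with g hg
      simpa [X, evalMat, Matrix.mvPolynomialX] using hg
    have h2 : ∀ᶠ g in genericFilter n, ratEval (X.det⁻¹) g = g.det⁻¹ := by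
      have h3 := ratEval_eq (n := n) (x := X.det⁻¹) (p := 1)
        (Matrix.det_mvPolynomialX_ne_zero n ℝ) (by rw [← hX]; simp [hX0])
      filter_upwards [h3] with g hg
      rw [hg]
      have h4 : evalMat (Matrix.mvPolynomialX n n ℝ).det g = g.det := by
        rw [evalMat, RingHom.map_det]
        congr 1
        ext i j
        simp [Matrix.mvPolynomialX]
      rw [h4]
      simp [evalMat]
    filter_upwards [hf, ratEvalMat_mul X D, h1, h2, ratEval_one, ratEval_zero]
      with g e1 e2 e3 e4 e5 e6
    rw [e1, e2]
    congr 1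
    · ext i j; exact e3 i j
    · ext i j
      simp only [ratEvalMat, D, Matrix.map_apply, Matrix.diagonal_apply]
      split_ifs with hij
      · by_cases hi : i = i₀
        · subst hi; simpa using e4
        · simpa [hi] using e5
      · exact e6
  obtain ⟨w', hw', hall⟩ := eventually_generic.mp (hgen.and h)
  have hdet0 : ((Matrix.mvPolynomialX n n ℝ).det * (w' * w)) ≠ 0 :=
    mul_ne_zero (Matrix.det_mvPolynomialX_ne_zero n ℝ) (mul_ne_zero hw' hw)
  obtain ⟨g₁, hg₁⟩ := exists_evalMat_ne_zero hdet0
  have hdet1 : evalMat (Matrix.mvPolynomialX n n ℝ).det g₁ = g₁.det := by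
    rw [evalMat, RingHom.map_det]
    congr 1
    ext i j
    simp [Matrix.mvPolynomialX]
  rw [evalMat_mul, hdet1] at hg₁
  set c := g₁.det with hc
  have hc0 : c ≠ 0 := left_ne_zero_of_mul hg₁
  have hDD : ∀ x : ℝ, x ≠ 0 → (Matrix.diagonal (Function.update 1 i₀ x) : Matrix n n ℝ) *
      Matrix.diagonal (Function.update 1 i₀ x⁻¹) = 1 := by
    intro x hx
    rw [Matrix.diagonal_mul_diagonal, ← Matrix.diagonal_one]
    congr 1
    funext i
    by_cases hi : i = i₀
    · subst hi; simp [hx]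
    · simp [hi]
  have hdD : ∀ x : ℝ, (Matrix.diagonal (Function.update 1 i₀ x) : Matrix n n ℝ).det = x := by
    intro x
    rw [Matrix.det_diagonal, Finset.prod_update_of_mem (Finset.mem_univ _)]
    simp
  -- A nonzero polynomial may vanish identically on `SL`. Translation by `Dc` carries `SL` onto the
  -- matrices of determinant `c`, among them the generic point `g₁`. The extra factor `w'` below
  -- makes both sides vanish at the matrices where specialization is not controlled.
  let Dc : Matrix n n ℝ := Matrix.diagonal (Function.update 1 i₀ c)
  refine ⟨fun g => evalMat (w' * w) (g * Dc), fun g => evalMat w' (g * Dc) • P (g * Dc),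
    (evalMat_polyMap _).comp_mul_right Dc,
    ((evalMat_polyMap _).smul hP).comp_mul_right Dc, ?_, ?_⟩
  · refine ⟨⟨g₁ * Matrix.diagonal (Function.update 1 i₀ c⁻¹), ?_⟩, ?_⟩
    · rw [Matrix.det_mul, hdD, ← hc, mul_inv_cancel₀ hc0]
    · have : (g₁ * Matrix.diagonal (Function.update 1 i₀ c⁻¹)) * Dc = g₁ := by
        have h5 := hDD c⁻¹ (inv_ne_zero hc0)
        rw [inv_inv] at h5
        rw [mul_assoc, h5, mul_one]
      simp only [this]
      exact right_ne_zero_of_mul hg₁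
  · intro g
    by_cases h0 : evalMat w' ((g : Matrix n n ℝ) * Dc) = 0
    · simp [h0]
    · obtain ⟨h6, h7⟩ := hall _ h0
      have h8 : f ((g : Matrix n n ℝ) * Dc) = g := by
        apply Subtype.ext
        have hd : ((g : Matrix n n ℝ) * Dc).det = c := by
          rw [Matrix.det_mul, det_coe, one_mul, hdD]
        rw [h6, hd, mul_assoc, hDD c hc0, mul_one]
      simp only [h8] at h7
      change evalMat (w' * w) ((g : Matrix n n ℝ) * Dc) • R g =
        evalMat w' ((g : Matrix n n ℝ) * Dc) • P ((g : Matrix n n ℝ) * Dc)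
      rw [← h7, evalMat_mul, mul_smul]

end Rationality
-- The differential of a representation and exponentials in `SL`.
section Differential

open Matrix Matrix.SpecialLinearGroup

variable {n : Type*}

/-- A single linear map serves all curves through `g₀`; this is what makes the differential of a
representation linear. -/
theorem PolyMap.exists_hasDerivAt {W : Type*} [NormedAddCommGroup W] [NormedSpace ℝ W]
    {f : Matrix n n ℝ → W} (hf : PolyMap f) (g₀ : Matrix n n ℝ) :
    ∃ L : Matrix n n ℝ →ₗ[ℝ] W, ∀ (γ : ℝ → Matrix n n ℝ) (Z : Matrix n n ℝ), γ 0 = g₀ →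
      (∀ i j, HasDerivAt (fun x => γ x i j) (Z i j) 0) →
      HasDerivAt (fun x => f (γ x)) (L Z) 0 := by
  induction hf with
  | const c => exact ⟨0, fun γ Z _ _ => by simpa using hasDerivAt_const 0 c⟩
  | add _ _ h1 h2 =>
    obtain ⟨L1, h1⟩ := h1
    obtain ⟨L2, h2⟩ := h2
    exact ⟨L1 + L2, fun γ Z h0 hZ => (h1 γ Z h0 hZ).add (h2 γ Z h0 hZ)⟩
  | @coord i j f _ h =>
    obtain ⟨L, h⟩ := h
    refine ⟨(g₀ i j) • L + (Matrix.entryLinearMap ℝ ℝ i j).smulRight (f g₀), fun γ Z h0 hZ => ?_⟩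
    refine HasDerivAt.congr_deriv (f := fun x => γ x i j • f (γ x))
      ((hZ i j).smul (h γ Z h0 hZ)) ?_
    simp [h0]

variable [Fintype n] [DecidableEq n]
  {𝔸 : Type*} [NormedRing 𝔸] [NormedAlgebra ℝ 𝔸]

/-- `dR` is the differential of `R`, extended to all matrices by zero on the scalars. -/
structure IsDifferential (R : SpecialLinearGroup n ℝ →* 𝔸) (dR : Matrix n n ℝ →ₗ[ℝ] 𝔸) :
    Prop where
  map_one : dR 1 = 0
  hasDerivAt : ∀ (γ : ℝ → SpecialLinearGroup n ℝ) (Z : Matrix n n ℝ), γ 0 = 1 → Z.trace = 0 →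
    (∀ i j, HasDerivAt (fun x => (γ x : Matrix n n ℝ) i j) (Z i j) 0) →
    HasDerivAt (fun x => R (γ x)) (dR Z) 0

/-- The projection of a matrix to its trace-free part. -/
noncomputable def traceFree : Matrix n n ℝ →ₗ[ℝ] Matrix n n ℝ :=
  LinearMap.id - ((Fintype.card n : ℝ)⁻¹ • Matrix.traceLinearMap n ℝ ℝ).smulRight 1

theorem traceFree_apply (Z : Matrix n n ℝ) :
    traceFree Z = Z - ((Fintype.card n : ℝ)⁻¹ * Z.trace) • (1 : Matrix n n ℝ) := by
  simp [traceFree]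

theorem traceFree_of_trace_eq_zero {Z : Matrix n n ℝ} (h : Z.trace = 0) : traceFree Z = Z := by
  simp [traceFree_apply, h]

theorem trace_traceFree [Nonempty n] (Z : Matrix n n ℝ) : (traceFree Z).trace = 0 := by
  have h : (Fintype.card n : ℝ) ≠ 0 := by positivity
  rw [traceFree_apply, Matrix.trace_sub, Matrix.trace_smul, Matrix.trace_one, smul_eq_mul,
    mul_right_comm, inv_mul_cancel₀ h, one_mul, sub_self]

/-- Differentiate `R (γ x) = R g₀⁻¹ * P (g₀ γ x) / w (g₀ γ x)`; the shift by `g₀` is needed because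
`w` may vanish at `1`. Composing with `traceFree` lets scalars act by zero, so that matrix units,
rank one matrices and the degree matrix of a block may be inserted later without correcting their
trace. -/
theorem exists_isDifferential [Nontrivial n] [FiniteDimensional ℝ 𝔸]
    (R : SpecialLinearGroup n ℝ →* 𝔸) (hR : Continuous R) :
    ∃ dR : Matrix n n ℝ →ₗ[ℝ] 𝔸, IsDifferential R dR := by
  obtain ⟨w, P, hw, hP, ⟨g₀, hg₀⟩, h⟩ := exists_polyMap_smul_eq R hR
  obtain ⟨L1, hL1⟩ := (hw.comp_mul_left g₀.1).exists_hasDerivAt 1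
  obtain ⟨L2, hL2⟩ := (((PolyMap.const (R g₀⁻¹)).mul hP).comp_mul_left g₀.1).exists_hasDerivAt 1
  refine ⟨((w g₀)⁻¹ • L2 - ((w g₀ ^ 2)⁻¹ • L1).smulRight (R g₀⁻¹ * P g₀)) ∘ₗ traceFree, ?_, ?_⟩
  · have : traceFree (1 : Matrix n n ℝ) = 0 := by
      simp [traceFree_apply]
    simp [this]
  · intro γ Z h0 htr hZ
    have h1 := hL1 (fun x => γ x) Z (by simp [h0]) hZ
    have h2 := hL2 (fun x => γ x) Z (by simp [h0]) hZ
    have h3 : ∀ x, R (γ x) = (w (g₀.1 * γ x))⁻¹ • (R g₀⁻¹ * P (g₀.1 * γ x)) ∨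
        w (g₀.1 * γ x) = 0 := by
      intro x
      by_cases hx : w (g₀.1 * γ x) = 0
      · exact Or.inr hx
      · left
        have h4 := h (g₀ * γ x)
        rw [coe_mul] at h4
        rw [← h4, mul_smul_comm, smul_smul, inv_mul_cancel₀ hx, one_smul, ← map_mul]
        simp
    have hne : w (g₀.1 * (γ 0 : Matrix n n ℝ)) ≠ 0 := by simpa [h0] using hg₀
    have h5 := (h1.inv hne).smul h2
    have h6 : HasDerivAt (fun x => R (γ x)) _ 0 := h5.congr_of_eventuallyEq (by
      have h7 : ∀ᶠ x in 𝓝 (0 : ℝ), w (g₀.1 * (γ x : Matrix n n ℝ)) ≠ 0 :=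
        h1.continuousAt.eventually_ne hne
      filter_upwards [h7] with x hx
      simpa [hx] using h3 x)
    refine h6.congr_deriv ?_
    simp only [h0, coe_one, mul_one, LinearMap.comp_apply, traceFree_of_trace_eq_zero htr,
      LinearMap.sub_apply, LinearMap.smul_apply, LinearMap.smulRight_apply, Pi.inv_apply]
    rw [sub_eq_add_neg, ← neg_smul]
    congr 2
    rw [smul_eq_mul]
    ring

open scoped Matrix.Norms.Operator

theorem hasDerivAt_exp_smul_apply (Z : Matrix n n ℝ) (x : ℝ) (i j : n) :
    HasDerivAt (fun x : ℝ => NormedSpace.exp (x • Z) i j) ((NormedSpace.exp (x • Z) * Z) i j) x := by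
  have h := hasDerivAt_exp_smul_const (𝕂 := ℝ) Z x
  exact ((Matrix.entryLinearMap ℝ ℝ i j).toContinuousLinearMap.hasFDerivAt.comp_hasDerivAt x h)

/-- The determinant is polynomial, so its derivative along a curve depends only on the velocity; the
curve `exp (xZ)` may be replaced by `1 + xZ`. -/
theorem hasDerivAt_det_exp_smul (Z : Matrix n n ℝ) :
    HasDerivAt (fun x : ℝ => (NormedSpace.exp (x • Z)).det) Z.trace 0 := by
  have hdet : PolyMap (fun g : Matrix n n ℝ => g.det) := by
    have := PolyMap.evalMat_polyMap (Matrix.mvPolynomialX n n ℝ).det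
    convert this using 2 with g
    rw [PolyMap.evalMat, RingHom.map_det]
    congr 1
    ext i j
    simp [Matrix.mvPolynomialX]
  obtain ⟨L, hL⟩ := hdet.exists_hasDerivAt 1
  have h1 := hL (fun x => NormedSpace.exp (x • Z)) Z (by simp) (fun i j => by
    simpa using hasDerivAt_exp_smul_apply Z 0 i j)
  have h2 := hL (fun x => 1 + x • Z) Z (by simp) (fun i j => by
    simpa using ((hasDerivAt_id (0 : ℝ)).mul_const (Z i j)).const_add ((1 : Matrix n n ℝ) i j))
  have h3 : HasDerivAt (fun x : ℝ => (1 + x • Z).det) Z.trace 0 := by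
    rw [funext fun x : ℝ => Matrix.det_one_add_smul x Z]
    set q := Polynomial.divX (Polynomial.divX (1 + (Polynomial.X : Polynomial ℝ) •
      Z.map Polynomial.C).det)
    have h4 : HasDerivAt (fun x : ℝ => 1 + Z.trace * x + q.eval x * x ^ 2)
        (Z.trace * 1 + (q.derivative.eval 0 * 0 ^ 2 + q.eval 0 * (2 * 0 ^ 1 * 1))) 0 := by
      refine HasDerivAt.add (((hasDerivAt_id (0 : ℝ)).const_mul _).const_add 1) ?_
      exact (q.hasDerivAt 0).mul ((hasDerivAt_id (0 : ℝ)).pow 2)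
    simpa using h4
  rw [h2.unique h3] at h1
  exact h1

theorem det_exp_of_trace_eq_zero {Z : Matrix n n ℝ} (hZ : Z.trace = 0) :
    (NormedSpace.exp Z).det = 1 := by
  have hd : ∀ x : ℝ, HasDerivAt (fun x : ℝ => (NormedSpace.exp (x • Z)).det) 0 x := by
    intro x
    have h1 : HasDerivAt (fun y : ℝ => (NormedSpace.exp ((y - x) • Z)).det) 0 x := by
      have h0 : HasDerivAt (fun x : ℝ => (NormedSpace.exp (x • Z)).det) 0 (x - x) := by
        simpa [hZ] using hasDerivAt_det_exp_smul Z
      exact h0.comp_sub_const x x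
    have h2 := h1.const_mul (NormedSpace.exp (x • Z)).det
    rw [mul_zero] at h2
    refine h2.congr_of_eventuallyEq (Eventually.of_forall fun y => ?_)
    simp only
    rw [← Matrix.det_mul, ← Matrix.exp_add_of_commute _ _
      (((Commute.refl Z).smul_left x).smul_right (y - x)), ← add_smul]
    congr 3
    ring
  have := is_const_of_deriv_eq_zero (fun x => (hd x).differentiableAt) (fun x => (hd x).deriv) 1 0
  simpa using this

/-- The exponential of the trace-free part of a matrix, as an element of `SL(n, ℝ)`. -/
noncomputable def expSL (Z : Matrix n n ℝ) : SpecialLinearGroup n ℝ :=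
  if h : Z.trace = 0 then ⟨NormedSpace.exp Z, det_exp_of_trace_eq_zero h⟩ else 1

theorem coe_expSL {Z : Matrix n n ℝ} (hZ : Z.trace = 0) :
    (expSL Z : Matrix n n ℝ) = NormedSpace.exp Z := by
  simp [expSL, hZ]

end Differential
-- The differential as an equivariant Lie algebra map.
section Differential

open Matrix Matrix.SpecialLinearGroup
open scoped Matrix.Norms.Operator

variable {n : Type*} [Fintype n] [DecidableEq n]

theorem expSL_zero : expSL (0 : Matrix n n ℝ) = 1 := by
  ext i j
  rw [coe_expSL (by simp)]
  simp

theorem expSL_add_smul {Z : Matrix n n ℝ} (hZ : Z.trace = 0) (x y : ℝ) :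
    expSL ((x + y) • Z) = expSL (x • Z) * expSL (y • Z) := by
  apply Subtype.ext
  rw [coe_mul, coe_expSL (by simp [hZ]), coe_expSL (by simp [hZ]), coe_expSL (by simp [hZ]),
    add_smul, Matrix.exp_add_of_commute]
  exact ((Commute.refl Z).smul_left x).smul_right y

theorem expSL_neg {Z : Matrix n n ℝ} (hZ : Z.trace = 0) : expSL (-Z) = (expSL Z)⁻¹ := by
  rw [eq_inv_iff_mul_eq_one]
  have := expSL_add_smul hZ (-1) 1
  simpa [expSL_zero] using this.symm

theorem expSL_transpose {Z : Matrix n n ℝ} (hZ : Z.trace = 0) :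
    expSL Zᵀ = (expSL Z).transpose := by
  apply Subtype.ext
  rw [coe_expSL (by simp [hZ]), coe_transpose, coe_expSL hZ, Matrix.exp_transpose]

theorem expSL_conj (g : SpecialLinearGroup n ℝ) {Z : Matrix n n ℝ} (hZ : Z.trace = 0) :
    expSL (g.1 * Z * (g⁻¹).1) = g * expSL Z * g⁻¹ := by
  have hinv : (g⁻¹).1 * g.1 = 1 := by rw [← coe_mul]; simp
  have hinv' : g.1 * (g⁻¹).1 = 1 := by rw [← coe_mul]; simp
  have h1 : g.1⁻¹ = (g⁻¹).1 := Matrix.inv_eq_right_inv hinv'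
  apply Subtype.ext
  rw [coe_mul, coe_mul, coe_expSL hZ, coe_expSL (by
    rw [Matrix.trace_mul_comm, ← mul_assoc, hinv, one_mul, hZ]), ← h1]
  exact Matrix.exp_conj _ _ (Matrix.isUnit_iff_isUnit_det _ |>.2 (by simp))

theorem hasDerivAt_expSL {Z : Matrix n n ℝ} (hZ : Z.trace = 0) (i j : n) :
    HasDerivAt (fun x : ℝ => (expSL (x • Z) : Matrix n n ℝ) i j) (Z i j) 0 := by
  have : (fun x : ℝ => (expSL (x • Z) : Matrix n n ℝ) i j)
      = fun x : ℝ => NormedSpace.exp (x • Z) i j := by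
    funext x
    rw [coe_expSL (by simp [hZ])]
  rw [this]
  simpa using hasDerivAt_exp_smul_apply Z 0 i j

variable {𝔸 : Type*} [NormedRing 𝔸] [NormedAlgebra ℝ 𝔸]
  {R : SpecialLinearGroup n ℝ →* 𝔸} {dR : Matrix n n ℝ →ₗ[ℝ] 𝔸}

namespace IsDifferential

theorem map_oneParameter [CompleteSpace 𝔸] (h : IsDifferential R dR) (γ : ℝ → SpecialLinearGroup n ℝ)
    {Z : Matrix n n ℝ} (hZ : Z.trace = 0) (h0 : γ 0 = 1) (hadd : ∀ x y, γ (x + y) = γ x * γ y)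
    (hγ : ∀ i j, HasDerivAt (fun x => (γ x : Matrix n n ℝ) i j) (Z i j) 0) (x : ℝ) :
    R (γ x) = NormedSpace.exp (x • dR Z) := by
  have h1 := h.hasDerivAt γ Z h0 hZ hγ
  have h2 : ∀ x, HasDerivAt (fun y => R (γ y)) (R (γ x) * dR Z) x := by
    intro x
    have h3 : HasDerivAt (fun y => R (γ (y - x))) (dR Z) x := by
      refine HasDerivAt.comp_sub_const (f := fun y => R (γ y)) x x ?_
      simpa using h1
    refine (h3.const_mul (R (γ x))).congr_of_eventuallyEq (Eventually.of_forall fun y => ?_)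
    simp only
    rw [← map_mul, ← hadd]
    simp
  obtain ⟨N, hN⟩ := exists_exp_of_continuous_add (fun x => R (γ x))
    (continuous_iff_continuousAt.2 fun x => (h2 x).continuousAt) (by simp [h0])
    (fun x y => by simp [hadd])
  have h4 : HasDerivAt (fun x : ℝ => R (γ x)) N 0 := by
    have := hasDerivAt_exp_smul_const (𝕂 := ℝ) N (0 : ℝ)
    rw [funext hN]
    simpa using this
  rw [hN, h1.unique h4]

theorem map_expSL [CompleteSpace 𝔸] (h : IsDifferential R dR) {Z : Matrix n n ℝ} (hZ : Z.trace = 0) (x : ℝ) :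
    R (expSL (x • Z)) = NormedSpace.exp (x • dR Z) :=
  h.map_oneParameter (fun x => expSL (x • Z)) hZ (by simp [expSL_zero])
    (fun x y => expSL_add_smul hZ x y) (hasDerivAt_expSL hZ) x

theorem map_transvection [CompleteSpace 𝔸] (h : IsDifferential R dR) {i j : n} (hij : i ≠ j) (x : ℝ) :
    R (transvection hij x) = NormedSpace.exp (x • dR (Matrix.single i j 1)) := by
  refine h.map_oneParameter (fun x => transvection hij x) (by simp [hij]) (by simp)
    (fun x y => by simp [transvection_add]) (fun k l => ?_) x
  have : (fun x : ℝ => (transvection hij x : SpecialLinearGroup n ℝ).1 k l)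
      = fun x : ℝ => (1 : Matrix n n ℝ) k l + x * Matrix.single i j 1 k l := by
    funext x
    rw [transvection_coe, Matrix.add_apply]
    simp [Matrix.single_apply]
  rw [this]
  simpa using ((hasDerivAt_id (0 : ℝ)).mul_const (Matrix.single i j (1 : ℝ) k l)).const_add
    ((1 : Matrix n n ℝ) k l)

theorem map_traceFree (h : IsDifferential R dR) (Z : Matrix n n ℝ) : dR (traceFree Z) = dR Z := by
  simp [traceFree_apply, h.map_one]

theorem conj [Nonempty n] (h : IsDifferential R dR) (g : SpecialLinearGroup n ℝ)
    (Y : Matrix n n ℝ) : R g * dR Y * R g⁻¹ = dR (g.1 * Y * (g⁻¹).1) := by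
  have hinv : (g⁻¹).1 * g.1 = 1 := by rw [← coe_mul]; simp
  have hinv' : g.1 * (g⁻¹).1 = 1 := by rw [← coe_mul]; simp
  have key : ∀ Z : Matrix n n ℝ, Z.trace = 0 → R g * dR Z * R g⁻¹ = dR (g.1 * Z * (g⁻¹).1) := by
    intro Z hZ
    have htr : (g.1 * Z * (g⁻¹).1).trace = 0 := by
      rw [Matrix.trace_mul_comm, ← mul_assoc, hinv, one_mul, hZ]
    have h1 := h.hasDerivAt _ Z (by simp [expSL_zero]) hZ (hasDerivAt_expSL hZ)
    have h2 := h.hasDerivAt _ _ (by simp [expSL_zero]) htr (hasDerivAt_expSL htr)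
    refine ((h1.const_mul (R g)).mul_const (R g⁻¹)).unique ?_
    refine h2.congr_of_eventuallyEq (Eventually.of_forall fun x => ?_)
    simp only
    rw [← map_mul, ← map_mul, ← expSL_conj g (by simp [hZ])]
    simp
  have h1 := key _ (trace_traceFree Y)
  rw [h.map_traceFree] at h1
  rw [h1, traceFree_apply, mul_sub, sub_mul, map_sub, mul_smul_comm, smul_mul_assoc, mul_one,
    hinv', map_smul, h.map_one, smul_zero, sub_zero]

/-- Differentiate at `x = 0` the conjugation formula for `exp (xX)` acting on `Y`. -/
theorem lie [CompleteSpace 𝔸] [Nonempty n] (h : IsDifferential R dR) (X Y : Matrix n n ℝ) :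
    dR (X * Y - Y * X) = dR X * dR Y - dR Y * dR X := by
  have key : ∀ X : Matrix n n ℝ, X.trace = 0 →
      dR (X * Y - Y * X) = dR X * dR Y - dR Y * dR X := by
    intro X hX
    have h1 : HasDerivAt (fun x : ℝ => NormedSpace.exp (x • dR X)) (dR X) 0 := by
      simpa using hasDerivAt_exp_smul_const (𝕂 := ℝ) (dR X) (0 : ℝ)
    have h2 : HasDerivAt (fun x : ℝ => NormedSpace.exp (x • -dR X)) (-dR X) 0 := by
      simpa using hasDerivAt_exp_smul_const (𝕂 := ℝ) (-dR X) (0 : ℝ)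
    have h3 : HasDerivAt (fun x : ℝ => NormedSpace.exp (x • X)) X 0 := by
      have := hasDerivAt_exp_smul_const (𝕂 := ℝ) X (0 : ℝ)
      rwa [zero_smul, NormedSpace.exp_zero, one_mul] at this
    have h4 : HasDerivAt (fun x : ℝ => NormedSpace.exp (x • -X)) (-X) 0 := by
      have := hasDerivAt_exp_smul_const (𝕂 := ℝ) (-X) (0 : ℝ)
      rwa [zero_smul, NormedSpace.exp_zero, one_mul] at this
    have h5 := (h1.mul_const (dR Y)).mul h2
    have h6 := dR.toContinuousLinearMap.hasFDerivAt.comp_hasDerivAt (0 : ℝ)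
      ((h3.mul_const Y).mul h4)
    have h7 := h6.unique (h5.congr_of_eventuallyEq (Eventually.of_forall fun x => ?_))
    · rw [sub_eq_add_neg, sub_eq_add_neg, ← mul_neg, ← mul_neg]
      simp only [zero_smul, NormedSpace.exp_zero, one_mul, mul_one] at h7
      exact h7
    · have hc := h.conj (expSL (x • X)) Y
      rw [coe_expSL (by simp [hX]), ← expSL_neg (by simp [hX]), coe_expSL (by simp [hX]),
        ← smul_neg, h.map_expSL hX, h.map_expSL (by simp [hX]), map_neg] at hc
      exact hc.symm
  have h1 := key _ (trace_traceFree X)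
  rw [h.map_traceFree] at h1
  rw [← h1, traceFree_apply]
  congr 1
  simp [sub_mul, mul_sub]

end IsDifferential

section Vectors

variable {E : Type*} [NormedAddCommGroup E] [NormedSpace ℝ E] [CompleteSpace E]

theorem exp_apply_of_apply_eq_zero {N : E →L[ℝ] E} {w : E} (hw : N w = 0) :
    NormedSpace.exp N w = w := by
  have hd : ∀ x : ℝ, HasDerivAt (fun x : ℝ => NormedSpace.exp (x • N) w) 0 x := by
    intro x
    have h := ((ContinuousLinearMap.apply ℝ E w).hasFDerivAt.comp_hasDerivAt x
      (hasDerivAt_exp_smul_const (𝕂 := ℝ) N x))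
    simpa [hw, Function.comp_def] using h
  have := is_const_of_deriv_eq_zero (fun x => (hd x).differentiableAt) (fun x => (hd x).deriv) 1 0
  simpa using this

end Vectors

end Differential
-- An inner product taking transposes to adjoints.
section InvariantInnerProduct

open Matrix Matrix.SpecialLinearGroup
open scoped InnerProductSpace

universe u

variable {n : Type u} [Fintype n] [DecidableEq n]

/-- Polynomial maps are linear functions of the coordinates of an orbit of a matrix representation
that is compatible with transposition. -/
theorem PolyMap.exists_coefficients {W : Type*} [AddCommGroup W] [Module ℝ W]
    {f : Matrix n n ℝ → W} (hf : PolyMap f) :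
    ∃ (I : Type u) (_ : Fintype I) (_ : DecidableEq I) (K : Matrix n n ℝ → Matrix I I ℝ)
      (x : Matrix n n ℝ → I → ℝ) (L : (I → ℝ) →ₗ[ℝ] W), K 1 = 1 ∧
      (∀ g h, K (g * h) = K g * K h) ∧ (∀ h, K hᵀ = (K h)ᵀ) ∧
      (∀ g h, x (g * h) = x g ᵥ* K h) ∧ ∀ g, f g = L (x g) := by
  induction hf with
  | const c =>
    refine ⟨PUnit, inferInstance, inferInstance, fun _ => 1, fun _ _ => 1,
      (LinearMap.proj PUnit.unit).smulRight c, rfl, by simp, by simp, by simp, by simp⟩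
  | add _ _ h1 h2 =>
    obtain ⟨I, _, _, K, x, L, hK1, hKm, hKt, hx, hL⟩ := h1
    obtain ⟨I', _, _, K', x', L', hK1', hKm', hKt', hx', hL'⟩ := h2
    refine ⟨I ⊕ I', inferInstance, inferInstance, fun g => Matrix.fromBlocks (K g) 0 0 (K' g),
      fun g => Sum.elim (x g) (x' g),
      L ∘ₗ LinearMap.funLeft ℝ ℝ Sum.inl + L' ∘ₗ LinearMap.funLeft ℝ ℝ Sum.inr, ?_, ?_, ?_, ?_, ?_⟩
    · simp [hK1, hK1']
    · simp [hKm, hKm', Matrix.fromBlocks_multiply]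
    · simp [hKt, hKt', Matrix.fromBlocks_transpose]
    · intro g h
      simp only [hx, hx', Matrix.vecMul_fromBlocks]
      simp
    · intro g
      simp only [hL, hL']
      rfl
  | @coord i j f _ h =>
    obtain ⟨I, _, _, K, x, L, hK1, hKm, hKt, hx, hL⟩ := h
    -- Under `g ↦ g h` the entries of `g` transform by `1 ⊗ h`. Multiplication by a coordinate
    -- therefore tensors the coefficient representation with this one, and transposes are respected.
    refine ⟨(n × n) × I, inferInstance, inferInstance,
      fun g => Matrix.kronecker (Matrix.kronecker 1 g) (K g),
      fun g p => g p.1.1 p.1.2 * x g p.2, L ∘ₗ LinearMap.funLeft ℝ ℝ (fun a => ((i, j), a)),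
      ?_, ?_, ?_, ?_, ?_⟩
    · simp [hK1]
    · intro g h
      simp only [hKm]
      rw [Matrix.kronecker, Matrix.kronecker, ← Matrix.mul_kronecker_mul, ← Matrix.mul_kronecker_mul, one_mul]
    · intro h
      simp [hKt, ← Matrix.kroneckerMap_transpose]
    · intro g h
      funext ⟨⟨a, b⟩, c⟩
      simp only [hx, Matrix.mul_apply, Matrix.vecMul, dotProduct, Fintype.sum_prod_type, Matrix.kronecker,
        Matrix.kroneckerMap_apply]
      symm
      rw [Finset.sum_eq_single a]
      · simp only [Matrix.one_apply_eq, one_mul]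
        rw [Finset.sum_mul_sum]
        refine Finset.sum_congr rfl fun k _ => Finset.sum_congr rfl fun l _ => ?_
        ring
      · intro a' _ ha
        simp [Matrix.one_apply_ne ha]
      · simp
    · intro g
      simp only [hL, ← map_smul]
      rfl

set_option maxHeartbeats 1000000 in
/-- A finite dimensional representation whose matrix coefficients are, up to a common factor,
coefficients of a representation compatible with an involution `t` has an inner product for
which the adjoint of `ρ g` is `ρ (t g)`. -/
theorem exists_adjoint_of_coefficients {G V E₀ T E : Type*} [Group G]
    [AddCommGroup V] [Module ℝ V] [AddCommGroup E₀] [Module ℝ E₀]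
    [NormedAddCommGroup T] [InnerProductSpace ℝ T] [FiniteDimensional ℝ T]
    [NormedAddCommGroup E] [InnerProductSpace ℝ E] [FiniteDimensional ℝ E]
    (ρ : G →* (V →ₗ[ℝ] V)) (L₀ : V →ₗ[ℝ] E₀) (hL₀ : Function.Injective L₀) (t : G → G)
    (KT : G → T →ₗ[ℝ] T) (KE : G → E →ₗ[ℝ] E) (evT : T →ₗ[ℝ] (G → ℝ)) (ev : E →ₗ[ℝ] (G → E₀))
    (KT_adj : ∀ h τ τ', ⟪KT h τ, τ'⟫_ℝ = ⟪τ, KT (t h) τ'⟫_ℝ)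
    (KE_adj : ∀ h σ σ', ⟪KE h σ, σ'⟫_ℝ = ⟪σ, KE (t h) σ'⟫_ℝ)
    (KT_inv : ∀ h τ, KT h⁻¹ (KT h τ) = τ)
    (evT_KT : ∀ τ g h, evT (KT h τ) g = evT τ (g * h))
    (ev_KE : ∀ σ g h, ev (KE h σ) g = ev σ (g * h))
    (τ₀ : T) (hτ₀ : ∀ v, ∃ σ, ∀ g, ev σ g = evT τ₀ g • L₀ (ρ g v)) (g₀ : G) (hg₀ : evT τ₀ g₀ ≠ 0) :
    ∃ (r : ℕ) (L : V ≃ₗ[ℝ] EuclideanSpace ℝ (Fin r)), ∀ g v v',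
      ⟪L (ρ g v), L v'⟫_ℝ = ⟪L v, L (ρ (t g) v')⟫_ℝ := by
  -- The kernel of `ev` is stable and the adjoints of the operators `KE h` are again such operators,
  -- so the orthogonal complement is stable; on it `ev` is injective.
  let N : Submodule ℝ E := (LinearMap.ker ev)ᗮ
  have hN : ∀ h, ∀ σ ∈ N, KE h σ ∈ N := by
    intro h σ hσ
    rw [Submodule.mem_orthogonal'] at hσ ⊢
    intro σ' hσ'
    rw [KE_adj]
    refine hσ _ ?_
    rw [LinearMap.mem_ker] at hσ' ⊢
    funext g
    rw [ev_KE, hσ']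
    rfl
  have hinj : LinearMap.ker (ev ∘ₗ N.subtype) = ⊥ := by
    rw [LinearMap.ker_eq_bot']
    rintro ⟨σ, hσ⟩ h0
    have := (Submodule.mem_orthogonal' _ _).1 hσ σ h0
    exact Subtype.ext (inner_self_eq_zero.1 this)
  obtain ⟨s, hs⟩ := LinearMap.exists_leftInverse_of_injective _ hinj
  let F : V →ₗ[ℝ] T →ₗ[ℝ] (G → E₀) :=
    LinearMap.mk₂ ℝ (fun v τ g => evT τ g • L₀ (ρ g v))
      (fun v v' τ => by funext g; simp)
      (fun c v τ => by funext g; simp [smul_comm c])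
      (fun v τ τ' => by funext g; simp [add_smul])
      (fun c v τ => by funext g; simp [mul_smul])
  have hF : ∀ v τ g, F v τ g = evT τ g • L₀ (ρ g v) := fun v τ g => rfl
  -- `W` consists of the common factors that turn every orbit map of `ρ` into a function coming from
  -- `E`; it is stable and contains `τ₀`.
  let W : Submodule ℝ T :=
    { carrier := {τ | ∀ v, F v τ ∈ LinearMap.range ev}
      zero_mem' := fun v => by rw [map_zero]; exact zero_mem _
      add_mem' := fun h h' v => by rw [map_add]; exact add_mem (h v) (h' v)
      smul_mem' := fun c τ h v => by rw [map_smul]; exact Submodule.smul_mem _ c (h v) }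
  have hW : ∀ h, ∀ τ ∈ W, KT h τ ∈ W := by
    intro h τ hτ v
    obtain ⟨σ, hσ⟩ := hτ (ρ h⁻¹ v)
    refine ⟨KE h σ, ?_⟩
    funext g
    rw [ev_KE, hσ, hF, hF, evT_KT, ← Module.End.mul_apply, ← map_mul]
    simp
  -- For `τ ∈ W` this is the unique element of `N` representing the function `F v τ`; for other `τ`
  -- the value produced by the left inverse `s` has no meaning. In this way `V` becomes an
  -- equivariant subspace of `Hom(W, N)`.
  let β : V →ₗ[ℝ] T →ₗ[ℝ] N := F.compr₂ s
  have hβ : ∀ v, ∀ τ ∈ W, ev (β v τ) = F v τ := by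
    intro v τ hτ
    obtain ⟨σ, hσ⟩ := hτ v
    obtain ⟨σ₁, h1, σ₂, h2, rfl⟩ := (LinearMap.ker ev).exists_add_mem_mem_orthogonal σ
    have h3 : F v τ = (ev ∘ₗ N.subtype) ⟨σ₂, h2⟩ := by
      rw [← hσ, map_add, h1, zero_add]
      rfl
    have h4 : β v τ = ⟨σ₂, h2⟩ := by
      change s (F v τ) = _
      rw [h3, ← LinearMap.comp_apply, hs]
      rfl
    rw [h4, h3]
    rfl
  have hβK : ∀ h v, ∀ τ ∈ W, KE h (β v τ) = β (ρ h v) (KT h τ) := by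
    intro h v τ hτ
    have h1 : (⟨KE h (β v τ), hN h _ (β v τ).2⟩ : N) = β (ρ h v) (KT h τ) := by
      apply LinearMap.ker_eq_bot.1 hinj
      change ev (KE h (β v τ)) = ev (β (ρ h v) (KT h τ))
      rw [hβ _ _ (hW h τ hτ)]
      funext g
      rw [ev_KE, hβ _ _ hτ, hF, hF, evT_KT, map_mul]
      rfl
    exact congrArg Subtype.val h1
  let b := stdOrthonormalBasis ℝ W
  -- The inner product sought is the Hilbert-Schmidt product of `Hom(W, N)`, computed in an
  -- orthonormal basis of `W`.
  let Φ : V →ₗ[ℝ] PiLp 2 (fun _ : Fin (Module.finrank ℝ W) => N) :=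
    (WithLp.linearEquiv 2 ℝ (Fin (Module.finrank ℝ W) → N)).symm.toLinearMap ∘ₗ
      LinearMap.pi fun j => β.flip (b j)
  have hΦ : ∀ v j, Φ v j = β v (b j) := fun v j => rfl
  have hexp : ∀ τ ∈ W, ∑ k, ⟪(b k : T), τ⟫_ℝ • (b k : T) = τ := by
    intro τ hτ
    have := congrArg Subtype.val (b.sum_repr' ⟨τ, hτ⟩)
    rwa [Submodule.coe_sum] at this
  have hΦadj : ∀ h v v', ⟪Φ (ρ h v), Φ v'⟫_ℝ = ⟪Φ v, Φ (ρ (t h) v')⟫_ℝ := by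
    intro h v v'
    simp only [PiLp.inner_apply, hΦ]
    have h1 : ∀ j, ⟪β (ρ h v) (b j), β v' (b j)⟫_ℝ
        = ∑ k, ⟪(b j : T), KT h (b k)⟫_ℝ * ⟪β v (KT h⁻¹ (b j)), β (ρ (t h) v') (b k)⟫_ℝ := by
      intro j
      have h2 : (β (ρ h v) (b j) : E) = KE h (β v (KT h⁻¹ (b j))) := by
        rw [hβK _ _ _ (hW _ _ (b j).2)]
        have := KT_inv h⁻¹ (b j)
        rw [inv_inv] at this
        rw [this]
      rw [Submodule.coe_inner, h2, KE_adj, hβK _ _ _ (b j).2, ← Submodule.coe_inner]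
      conv_lhs => rw [← hexp _ (hW (t h) _ (b j).2)]
      simp only [map_sum, map_smul, inner_sum, real_inner_smul_right]
      refine Finset.sum_congr rfl fun k _ => ?_
      congr 1
      rw [← KT_adj, real_inner_comm]
    simp only [h1]
    rw [Finset.sum_comm]
    refine Finset.sum_congr rfl fun k _ => ?_
    have h3 : ∑ j, ⟪(b j : T), KT h (b k)⟫_ℝ • KT h⁻¹ (b j) = b k := by
      have := congrArg (KT h⁻¹) (hexp _ (hW h _ (b k).2))
      simpa only [map_sum, map_smul, KT_inv] using this
    have h4 := congrArg (β v) h3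
    rw [← h4]
    simp only [map_sum, map_smul, sum_inner, Submodule.coe_inner, Submodule.coe_smul, real_inner_smul_left]
  have hΦinj : LinearMap.ker Φ = ⊥ := by
    rw [LinearMap.ker_eq_bot']
    intro v hv
    have h0 : ∀ τ ∈ W, β v τ = 0 := by
      intro τ hτ
      rw [← hexp τ hτ]
      simp only [map_sum, map_smul, ← hΦ, hv]
      simp
    have h1 : F v τ₀ g₀ = 0 := by
      have h2 : τ₀ ∈ W := fun v => (hτ₀ v).imp fun σ hσ => funext hσ
      rw [← hβ v τ₀ h2, h0 _ h2]
      simp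
    rw [hF, smul_eq_zero_iff_right hg₀] at h1
    have h3 := (injective_iff_map_eq_zero L₀).1 hL₀ _ h1
    have h4 := congrArg (ρ g₀⁻¹) h3
    rwa [← Module.End.mul_apply, ← map_mul, inv_mul_cancel, map_one, map_zero] at h4
  let e : V ≃ₗ[ℝ] LinearMap.range Φ := LinearEquiv.ofInjective Φ (LinearMap.ker_eq_bot.1 hΦinj)
  let e' := (stdOrthonormalBasis ℝ (LinearMap.range Φ)).repr
  refine ⟨_, e.trans e'.toLinearEquiv, fun g v v' => ?_⟩
  have h1 : ∀ v, (e.trans e'.toLinearEquiv) v = e' (e v) := fun v => rfl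
  rw [h1, h1, h1, h1, e'.inner_map_map, e'.inner_map_map]
  exact hΦadj g v v'

/-- The relation `w g • R g = P g` exhibits the matrix coefficients of `R`, up to the factor `w`, as
coefficients of a representation compatible with transposition. Treating `w` and `P` as one
polynomial map places both in the same coefficient representation; `w` itself provides `τ₀`, and `g
↦ P g v` provides the elements `σ`. -/
theorem exists_adjoint_transpose [Nontrivial n] {V : Type*} [NormedAddCommGroup V]
    [NormedSpace ℝ V] [FiniteDimensional ℝ V] (R : SpecialLinearGroup n ℝ →* (V →L[ℝ] V))
    (hR : Continuous R) :
    ∃ (r : ℕ) (L : V ≃ₗ[ℝ] EuclideanSpace ℝ (Fin r)), ∀ (g : SpecialLinearGroup n ℝ) (v v' : V),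
      ⟪L (R g v), L v'⟫_ℝ = ⟪L v, L (R g.transpose v')⟫_ℝ := by
  obtain ⟨w, P, hw, hP, ⟨g₀, hg₀⟩, hwP⟩ := exists_polyMap_smul_eq R hR
  have hpair : PolyMap fun g => (w g, P g) := by
    have h1 := hw.map (LinearMap.inl ℝ ℝ (V →L[ℝ] V))
    have h2 := hP.map (LinearMap.inr ℝ ℝ (V →L[ℝ] V))
    simpa using h1.add h2
  obtain ⟨I, _, _, K, x, L, hK1, hKm, hKt, hx, hL⟩ := hpair.exists_coefficients
  have hLw : ∀ g, (LinearMap.fst ℝ ℝ (V →L[ℝ] V) ∘ₗ L) (x g) = w g := fun g => by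
    rw [LinearMap.comp_apply, ← hL]
    rfl
  have hLP : ∀ g, (LinearMap.snd ℝ ℝ (V →L[ℝ] V) ∘ₗ L) (x g) = P g := fun g => by
    rw [LinearMap.comp_apply, ← hL]
    rfl
  set Lw := LinearMap.fst ℝ ℝ (V →L[ℝ] V) ∘ₗ L
  set LP := LinearMap.snd ℝ ℝ (V →L[ℝ] V) ∘ₗ L
  let L₀ : V ≃L[ℝ] EuclideanSpace ℝ (Fin (Module.finrank ℝ V)) := toEuclidean
  refine exists_adjoint_of_coefficients (T := EuclideanSpace ℝ I)
    (E := PiLp 2 (fun _ : I => EuclideanSpace ℝ (Fin (Module.finrank ℝ V))))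
    (G := SpecialLinearGroup n ℝ)
    ((ContinuousLinearMap.toLinearMapRingHom : (V →L[ℝ] V) →+* (V →ₗ[ℝ] V)).toMonoidHom.comp R)
    L₀.toLinearMap L₀.injective SpecialLinearGroup.transpose
    (fun h => Matrix.toEuclideanLin (K h))
    (fun h =>
      { toFun := fun σ => WithLp.toLp 2 fun i => ∑ j, K h i j • σ j
        map_add' := fun σ σ' => by
          ext i
          simp [smul_add, Finset.sum_add_distrib]
        map_smul' := fun c σ => by
          ext i
          simp [Finset.smul_sum, mul_left_comm c] })
    { toFun := fun τ g => x g ⬝ᵥ τ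
      map_add' := fun τ τ' => by
        funext g
        simp
      map_smul' := fun c τ => by
        funext g
        simp }
    { toFun := fun σ g => ∑ i, x g i • σ i
      map_add' := fun σ σ' => by
        funext g
        simp [smul_add, Finset.sum_add_distrib]
      map_smul' := fun c σ => by
        funext g
        simp [Finset.smul_sum, smul_comm c] }
    ?_ ?_ ?_ ?_ ?_ (WithLp.toLp 2 fun i => Lw (Pi.single i 1)) ?_ g₀ ?_
  · intro h τ τ'
    simp only [PiLp.inner_apply, coe_transpose, hKt, Matrix.toLpLin_apply, Matrix.mulVec,
      dotProduct, Matrix.transpose_apply, RCLike.inner_apply, conj_trivial, Finset.sum_mul,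
      Finset.mul_sum]
    rw [Finset.sum_comm]
    refine Finset.sum_congr rfl fun i _ => Finset.sum_congr rfl fun j _ => ?_
    ring
  · intro h σ σ'
    have hin : ∀ a b : PiLp 2 (fun _ : I => EuclideanSpace ℝ (Fin (Module.finrank ℝ V))),
        ⟪a, b⟫_ℝ = ∑ i, ⟪a i, b i⟫_ℝ := fun a b => PiLp.inner_apply a b
    rw [hin, hin]
    simp only [LinearMap.coe_mk, AddHom.coe_mk, coe_transpose, hKt, Matrix.transpose_apply, sum_inner,
      inner_sum, real_inner_smul_left, real_inner_smul_right]
    rw [Finset.sum_comm]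
  · intro h τ
    have h1 : K (h⁻¹).1 * K h.1 = 1 := by
      rw [← hKm, ← coe_mul, inv_mul_cancel, coe_one, hK1]
    apply (WithLp.linearEquiv 2 ℝ (I → ℝ)).injective
    change K (h⁻¹).1 *ᵥ (K h.1 *ᵥ (τ : I → ℝ)) = τ
    rw [Matrix.mulVec_mulVec, h1, Matrix.one_mulVec]
  · intro τ g h
    simp only [LinearMap.coe_mk, AddHom.coe_mk, coe_mul, hx, Matrix.toLpLin_apply,
      Matrix.dotProduct_mulVec]
  · intro σ g h
    simp only [LinearMap.coe_mk, AddHom.coe_mk, coe_mul, hx, Matrix.vecMul, dotProduct,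
      Finset.smul_sum, Finset.sum_smul, smul_smul]
    rw [Finset.sum_comm]
  · intro v
    refine ⟨WithLp.toLp 2 fun i => L₀ (LP (Pi.single i 1) v), fun g => ?_⟩
    have h1 := hwP g
    have h2 : P g = ∑ i, x g i • LP (Pi.single i 1) := by
      rw [← hLP]
      conv_lhs => rw [pi_eq_sum_univ' (x g)]
      simp only [map_sum, map_smul]
    have h3 : w g = x g ⬝ᵥ fun i => Lw (Pi.single i 1) := by
      rw [← hLw]
      conv_lhs => rw [pi_eq_sum_univ' (x g)]
      simp only [map_sum, map_smul, dotProduct, smul_eq_mul]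
    have h4 := congrArg L₀ (DFunLike.congr_fun (h1.trans h2) v)
    simp only [LinearMap.coe_mk, AddHom.coe_mk]
    rw [← h3]
    simp only [_root_.smul_apply, _root_.sum_apply, map_sum,
      map_smul] at h4
    exact h4.symm
  · have h3 : w g₀ = x g₀ ⬝ᵥ fun i => Lw (Pi.single i 1) := by
      rw [← hLw]
      conv_lhs => rw [pi_eq_sum_univ' (x g₀)]
      simp only [map_sum, map_smul, dotProduct, smul_eq_mul]
    simp only [LinearMap.coe_mk, AddHom.coe_mk]
    rw [← h3]
    exact hg₀

end InvariantInnerProduct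
-- Triangular decompositions and leading minors.
section Triangular

open Matrix Matrix.SpecialLinearGroup

variable {n : Type*} [Fintype n] [LinearOrder n]

theorem coe_inv_eq (g : SpecialLinearGroup n ℝ) : (g⁻¹).1 = g.1⁻¹ :=
  (Matrix.inv_eq_right_inv (by rw [← coe_mul]; simp)).symm

theorem isLowerTriangular_inv {b : SpecialLinearGroup n ℝ} (hb : b.1.IsLowerTriangular) :
    (b⁻¹).1.IsLowerTriangular := by
  rw [coe_inv_eq]
  have : Invertible b.1 := Matrix.invertibleOfIsUnitDet _ (by simp)
  exact Matrix.blockTriangular_inv_of_blockTriangular hb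

theorem isUpperTriangular_inv {b : SpecialLinearGroup n ℝ} (hb : b.1.IsUpperTriangular) :
    (b⁻¹).1.IsUpperTriangular := by
  rw [coe_inv_eq]
  have : Invertible b.1 := Matrix.invertibleOfIsUnitDet _ (by simp)
  exact Matrix.blockTriangular_inv_of_blockTriangular hb

theorem mul_apply_self_of_isUpperTriangular {A B : Matrix n n ℝ} (hA : A.IsUpperTriangular)
    (hB : B.IsUpperTriangular) (i : n) : (A * B) i i = A i i * B i i := by
  rw [Matrix.mul_apply, Finset.sum_eq_single i]
  · intro k _ hk
    rcases lt_or_gt_of_ne hk with h | h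
    · rw [hA h, zero_mul]
    · rw [hB h, mul_zero]
  · simp

/-- The block of a matrix formed by the rows and columns before `j`. -/
def lead (P : Matrix n n ℝ) (j : n) : Matrix {i // i < j} {i // i < j} ℝ :=
  P.submatrix Subtype.val Subtype.val


theorem lead_transpose {n : Type*} [LinearOrder n] (P : Matrix n n ℝ) (j : n) : lead Pᵀ j = (lead P j)ᵀ := rfl

theorem lead_mul_of_isLowerTriangular {b : Matrix n n ℝ} (hb : b.IsLowerTriangular)
    (P : Matrix n n ℝ) (j : n) : lead (b * P) j = lead b j * lead P j := by
  ext i l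
  simp only [lead, Matrix.submatrix_apply, Matrix.mul_apply]
  rw [← Fintype.sum_subtype_add_sum_subtype (fun k => k < j), add_eq_left]
  refine Finset.sum_eq_zero fun k _ => ?_
  rw [hb (show i.1 < k.1 from i.2.trans_le (not_lt.1 k.2)), zero_mul]

theorem det_lead_of_isLowerTriangular {b : Matrix n n ℝ} (hb : b.IsLowerTriangular) (j : n) :
    (lead b j).det = ∏ i : {i // i < j}, b i i := by
  rw [Matrix.det_of_isLowerTriangular]
  · rfl
  · intro i k hik
    exact hb (show i.1 < k.1 from hik)

theorem det_lead_mul_mul_transpose {b : Matrix n n ℝ} (hb : b.IsLowerTriangular)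
    (P : Matrix n n ℝ) (j : n) :
    (lead (b * P * bᵀ) j).det = (∏ i : {i // i < j}, b i i) ^ 2 * (lead P j).det := by
  have h1 : b * P * bᵀ = (b * (b * Pᵀ)ᵀ) := by
    rw [Matrix.transpose_mul, Matrix.transpose_transpose, mul_assoc]
  rw [h1, lead_mul_of_isLowerTriangular hb, lead_transpose, lead_mul_of_isLowerTriangular hb,
    lead_transpose, Matrix.det_mul, Matrix.det_transpose, Matrix.det_mul, Matrix.det_transpose,
    det_lead_of_isLowerTriangular hb]
  ring

theorem exists_isUpperTriangular_mul (P : Matrix n n ℝ) (hP : ∀ j, (lead P j).det ≠ 0) :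
    ∃ N : SpecialLinearGroup n ℝ, N.1.IsUpperTriangular ∧ (∀ i, N i i = 1) ∧
      (P * N.1).IsLowerTriangular := by
  -- Column `j` of `N` comes from the linear system of the leading block before `j`, so that the
  -- entries of `P * N` above the diagonal cancel.
  let c : ∀ j : n, {i // i < j} → ℝ := fun j => (lead P j)⁻¹ *ᵥ fun k => P k j
  let N : Matrix n n ℝ := Matrix.of fun i j => if h : i < j then - c j ⟨i, h⟩ else if i = j then 1 else 0
  have hN : N.IsUpperTriangular := by
    intro i j hij
    have hij : j < i := hij
    simp [N, hij.not_gt, hij.ne']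
  have hN1 : ∀ i, N i i = 1 := fun i => by simp [N]
  refine ⟨⟨N, ?_⟩, hN, hN1, ?_⟩
  · rw [Matrix.det_of_isUpperTriangular hN]
    simp [hN1]
  · intro i j hij
    have hij : i < j := hij
    change (P * N) i j = 0
    rw [Matrix.mul_apply, ← Fintype.sum_subtype_add_sum_subtype (fun k => k < j),
      Fintype.sum_eq_single (⟨j, lt_irrefl j⟩ : {k // ¬ k < j})]
    · have h1 : (lead P j *ᵥ c j) ⟨i, hij⟩ = P i j := by
        rw [Matrix.mulVec_mulVec, Matrix.mul_nonsing_inv _ (isUnit_iff_ne_zero.2 (hP j)),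
          Matrix.one_mulVec]
      simp only [hN1, mul_one]
      rw [← h1, Matrix.mulVec, dotProduct, ← Finset.sum_add_distrib]
      refine Finset.sum_eq_zero fun k _ => ?_
      simp [N, lead, k.2]
    · rintro ⟨k, hk⟩ hkj
      have h2 : j < k := lt_of_le_of_ne (not_lt.1 hk) fun h => hkj (Subtype.ext h.symm)
      change P i k * N k j = 0
      rw [hN h2, mul_zero]

/-- The `LU` decomposition. -/
theorem exists_lower_mul_upper (P : SpecialLinearGroup n ℝ) (hP : ∀ j, (lead P.1 j).det ≠ 0) :
    ∃ b N : SpecialLinearGroup n ℝ, b.1.IsLowerTriangular ∧ N.1.IsUpperTriangular ∧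
      (∀ i, N i i = 1) ∧ P = b * N := by
  obtain ⟨N, hN, hN1, hPN⟩ := exists_isUpperTriangular_mul P.1 hP
  refine ⟨P * N, N⁻¹, hPN, isUpperTriangular_inv hN, fun i => ?_, by simp⟩
  have h1 := mul_apply_self_of_isUpperTriangular hN (isUpperTriangular_inv hN) i
  rw [← coe_mul, mul_inv_cancel, coe_one, Matrix.one_apply_eq, hN1, one_mul] at h1
  exact h1.symm

theorem posDef_mul_transpose (M : SpecialLinearGroup n ℝ) : (M.1 * M.1ᵀ).PosDef := by
  have h := Matrix.PosDef.one (n := n) (R := ℝ)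
  have h2 := h.mul_mul_conjTranspose_same (B := M.1) (by
    rw [Matrix.vecMul_injective_iff_isUnit, Matrix.isUnit_iff_isUnit_det]; simp)
  simpa [Matrix.conjTranspose_eq_transpose_of_trivial] using h2

theorem det_lead_pos (M : SpecialLinearGroup n ℝ) (j : n) : 0 < (lead (M.1 * M.1ᵀ) j).det :=
  ((posDef_mul_transpose M).submatrix Subtype.val_injective).det_pos

/-- Every matrix in `SL` is the product of a lower triangular matrix with positive diagonal and
of an orthogonal matrix. -/
theorem exists_lower_mul_orthogonal (M : SpecialLinearGroup n ℝ) :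
    ∃ b k : SpecialLinearGroup n ℝ, b.1.IsLowerTriangular ∧ (∀ i, 0 < b i i) ∧
      k * k.transpose = 1 ∧ M = b * k := by
  obtain ⟨N, hN, hN1, hPN⟩ := exists_isUpperTriangular_mul _ fun j => (det_lead_pos M j).ne'
  have hNt : (N.transpose).1.IsLowerTriangular := fun i j hij => hN hij
  -- The product is lower triangular and symmetric, hence diagonal; its positive square root `δ`
  -- corrects the triangular factor so that the remaining factor is orthogonal.
  have hdiag : N.1ᵀ * (M.1 * M.1ᵀ * N.1) =
      Matrix.diagonal fun i => (N.1ᵀ * (M.1 * M.1ᵀ * N.1)) i i := by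
    have h1 := Matrix.BlockTriangular.mul hNt hPN
    ext i j
    rcases lt_trichotomy i j with h | rfl | h
    · rw [Matrix.diagonal_apply_ne _ h.ne]
      exact h1 h
    · simp
    · rw [Matrix.diagonal_apply_ne _ h.ne']
      have h2 : N.1ᵀ * (M.1 * M.1ᵀ * N.1) = (N.1ᵀ * (M.1 * M.1ᵀ * N.1))ᵀ := by
        simp [Matrix.transpose_mul, mul_assoc]
      rw [h2]
      exact h1 h
  set d := fun i => (N.1ᵀ * (M.1 * M.1ᵀ * N.1)) i i with hd
  have hNM : N.1ᵀ * (M.1 * M.1ᵀ * N.1) = (N.transpose * M).1 * (N.transpose * M).1ᵀ := by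
    simp [Matrix.transpose_mul, mul_assoc]
  have hdpos : ∀ i, 0 < d i := by
    intro i
    rw [hd]
    simp only [hNM]
    exact (posDef_mul_transpose _).diag_pos
  have hdetd : ∏ i, d i = 1 := by
    rw [← Matrix.det_diagonal, ← hdiag, hNM]
    simp
  have hdets : ∏ i, √(d i) = 1 := by
    rw [← Real.sqrt_prod _ fun i _ => (hdpos i).le, hdetd, Real.sqrt_one]
  let δ : SpecialLinearGroup n ℝ := ⟨Matrix.diagonal fun i => √(d i), by
    rw [Matrix.det_diagonal, hdets]⟩
  have hδt : δ.1ᵀ = δ.1 := Matrix.diagonal_transpose _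
  have hδ : δ.1 * δ.1 = Matrix.diagonal d := by
    simp only [δ, Matrix.diagonal_mul_diagonal]
    congr 1
    funext i
    exact Real.mul_self_sqrt (hdpos i).le
  refine ⟨(N.transpose)⁻¹ * δ, δ⁻¹ * (N.transpose * M), ?_, ?_, ?_, ?_⟩
  · exact Matrix.BlockTriangular.mul (isLowerTriangular_inv hNt) (Matrix.blockTriangular_diagonal _)
  · intro i
    have h1 : ((N.transpose)⁻¹ * δ : SpecialLinearGroup n ℝ) i i = (N⁻¹) i i * √(d i) := by
      rw [coe_mul]
      change ((N.transpose)⁻¹.1 * Matrix.diagonal fun i => √(d i)) i i = _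
      rw [Matrix.mul_diagonal, coe_inv_eq, coe_inv_eq, coe_transpose, ← Matrix.transpose_nonsing_inv]
      rfl
    have h2 := mul_apply_self_of_isUpperTriangular hN (isUpperTriangular_inv hN) i
    rw [← coe_mul, mul_inv_cancel, coe_one, Matrix.one_apply_eq, hN1, one_mul] at h2
    rw [h1, ← h2, one_mul]
    exact Real.sqrt_pos.2 (hdpos i)
  · apply Subtype.ext
    have h1 : (δ⁻¹).1 * δ.1 = 1 := by rw [← coe_mul]; simp
    have h2 : δ.1 * (δ⁻¹).1 = 1 := by rw [← coe_mul]; simp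
    have h3 : (δ⁻¹).1ᵀ = (δ⁻¹).1 := by
      rw [coe_inv_eq, Matrix.transpose_nonsing_inv, hδt]
    rw [coe_mul, coe_transpose, coe_mul, Matrix.transpose_mul, h3, coe_one,
      mul_assoc, ← mul_assoc _ _ (δ⁻¹).1, ← hNM, hdiag, ← hδ, mul_assoc δ.1, h2, mul_one, h1]
  · group

/-- Each eigenvalue satisfies `λ ≤ exp (λ - 1)`, with equality at `λ = 1`, so the estimate is sharp
to first order at the identity. -/
theorem det_le_exp_trace {m : Type*} [Fintype m] [DecidableEq m] {P : Matrix m m ℝ}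
    (hP : P.PosSemidef) : P.det ≤ Real.exp (∑ i, (P i i - 1)) := by
  have h1 := hP.isHermitian.det_eq_prod_eigenvalues
  have h2 := hP.isHermitian.trace_eq_sum_eigenvalues
  simp only [RCLike.ofReal_real_eq_id, id_eq] at h1 h2
  have h3 : ∑ i, (P i i - 1) = ∑ i, (hP.isHermitian.eigenvalues i - 1) := by
    rw [Finset.sum_sub_distrib, Finset.sum_sub_distrib, ← h2]
    rfl
  rw [h1, h3, Real.exp_sum]
  refine Finset.prod_le_prod (fun i _ => hP.eigenvalues_nonneg i) fun i _ => ?_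
  have := Real.add_one_le_exp (hP.isHermitian.eigenvalues i - 1)
  linarith

end Triangular
-- Bounded orbits of symmetric flows.
section SymmetricFlow

open scoped InnerProductSpace

variable {E : Type*} [NormedAddCommGroup E] [InnerProductSpace ℝ E] [FiniteDimensional ℝ E]

theorem exp_smul_apply_of_apply_eq_smul {T : E →L[ℝ] E} {e : E} {c : ℝ} (he : T e = c • e)
    (x : ℝ) : NormedSpace.exp (x • T) e = Real.exp (x * c) • e := by
  have : CompleteSpace E := FiniteDimensional.complete ℝ E
  have hd : ∀ x : ℝ, HasDerivAt (fun x : ℝ => Real.exp (-(x * c)) • NormedSpace.exp (x • T) e) 0 x := by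
    intro x
    have h1 : HasDerivAt (fun x : ℝ => Real.exp (-(x * c))) (Real.exp (-(x * c)) * (-(1 * c))) x :=
      ((hasDerivAt_id x).mul_const c).neg.exp
    have h2 : HasDerivAt (fun x : ℝ => NormedSpace.exp (x • T) e) ((NormedSpace.exp (x • T) * T) e) x :=
      (ContinuousLinearMap.apply ℝ E e).hasFDerivAt.comp_hasDerivAt x
        (hasDerivAt_exp_smul_const (𝕂 := ℝ) T x)
    refine (h1.smul h2).congr_deriv ?_
    rw [mul_apply_eq_comp, he, map_smul, smul_smul, ← add_smul]
    ring_nf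
    simp
  have h := is_const_of_deriv_eq_zero (fun x => (hd x).differentiableAt) (fun x => (hd x).deriv) x 0
  simp only [zero_mul, neg_zero, Real.exp_zero, zero_smul, NormedSpace.exp_zero, one_smul,
    one_apply_eq_self] at h
  calc NormedSpace.exp (x • T) e
      = Real.exp (x * c) • Real.exp (-(x * c)) • NormedSpace.exp (x • T) e := by
        rw [smul_smul, ← Real.exp_add, add_neg_cancel, Real.exp_zero, one_smul]
    _ = _ := by rw [h]

/-- In an orthonormal eigenbasis of `T`, boundedness removes the components of `w` with positive
eigenvalue. The quadratic form is then a sum of nonpositive terms, and it vanishes only if every one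
of them does. -/
theorem inner_le_zero_of_exp_bounded {T : E →L[ℝ] E} (hT : ∀ x y, ⟪T x, y⟫_ℝ = ⟪x, T y⟫_ℝ) {w : E}
    (hw : ∃ C, ∀ x : ℝ, 0 ≤ x → ‖NormedSpace.exp (x • T) w‖ ≤ C) :
    ⟪T w, w⟫_ℝ ≤ 0 ∧ (⟪T w, w⟫_ℝ = 0 → T w = 0) := by
  obtain ⟨C, hC⟩ := hw
  have hsym : (T : E →ₗ[ℝ] E).IsSymmetric := hT
  let b := hsym.eigenvectorBasis rfl
  let l := hsym.eigenvalues rfl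
  have hb : ∀ i, T (b i) = l i • b i := hsym.apply_eigenvectorBasis rfl
  have hexp : w = ∑ i, ⟪b i, w⟫_ℝ • b i := (b.sum_repr' w).symm
  have hTw : T w = ∑ i, (l i * ⟪b i, w⟫_ℝ) • b i := by
    conv_lhs => rw [hexp]
    simp only [map_sum, map_smul, hb, smul_smul, mul_comm]
  have hkey : ∀ i, ⟪b i, w⟫_ℝ = 0 ∨ l i ≤ 0 := by
    intro i
    by_contra! h
    have h1 : ∀ x : ℝ, ⟪b i, NormedSpace.exp (x • T) w⟫_ℝ = Real.exp (x * l i) * ⟪b i, w⟫_ℝ := by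
      intro x
      conv_lhs => rw [hexp]
      simp only [map_sum, map_smul, exp_smul_apply_of_apply_eq_smul (hb _), inner_sum,
        real_inner_smul_right]
      rw [Finset.sum_eq_single i]
      · rw [real_inner_self_eq_norm_sq, b.norm_eq_one]
        ring
      · intro j _ hj
        rw [b.inner_eq_zero hj.symm]
        simp
      · simp
    have h2 : Tendsto (fun x : ℝ => |Real.exp (x * l i) * ⟪b i, w⟫_ℝ|) atTop atTop := by
      simp only [abs_mul, Real.abs_exp]
      refine Tendsto.atTop_mul_const (abs_pos.2 h.1) ?_
      exact Real.tendsto_exp_atTop.comp (tendsto_id.atTop_mul_const h.2)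
    obtain ⟨x, hx1, hx2⟩ := ((h2.eventually_gt_atTop C).and (eventually_ge_atTop 0)).exists
    rw [← h1] at hx1
    have h3 := abs_real_inner_le_norm (b i) (NormedSpace.exp (x • T) w)
    rw [b.norm_eq_one, one_mul] at h3
    linarith [hC x hx2]
  have hin : ⟪T w, w⟫_ℝ = ∑ i, l i * ⟪b i, w⟫_ℝ ^ 2 := by
    rw [hTw, sum_inner]
    refine Finset.sum_congr rfl fun i _ => ?_
    rw [real_inner_smul_left]
    ring
  have hle : ∀ i ∈ Finset.univ, l i * ⟪b i, w⟫_ℝ ^ 2 ≤ 0 := by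
    intro i _
    rcases hkey i with h | h
    · simp [h]
    · exact mul_nonpos_of_nonpos_of_nonneg h (sq_nonneg _)
  refine ⟨hin ▸ Finset.sum_nonpos hle, fun h0 => ?_⟩
  rw [hin, Finset.sum_eq_zero_iff_of_nonpos hle] at h0
  rw [hTw]
  refine Finset.sum_eq_zero fun i hi => ?_
  have h1 := h0 i hi
  have h2 : l i * ⟪b i, w⟫_ℝ = 0 := by
    rcases mul_eq_zero.1 h1 with h | h
    · rw [h, zero_mul]
    · rw [pow_eq_zero_iff two_ne_zero] at h
      rw [h, mul_zero]
  rw [h2, zero_smul]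

theorem apply_eq_zero_of_exp_bounded {T : E →L[ℝ] E} (hT : ∀ x y, ⟪T x, y⟫_ℝ = ⟪x, T y⟫_ℝ) {w : E}
    (hw : ∃ C, ∀ x : ℝ, 0 ≤ x → ‖NormedSpace.exp (x • T) w‖ ≤ C)
    (hw' : ∃ C, ∀ x : ℝ, 0 ≤ x → ‖NormedSpace.exp (x • -T) w‖ ≤ C) : T w = 0 := by
  have h1 := inner_le_zero_of_exp_bounded hT hw
  have h2 := inner_le_zero_of_exp_bounded (T := -T) (fun x y => by simp [hT]) hw'
  refine h1.2 (le_antisymm h1.1 ?_)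
  have := h2.1
  simp only [neg_apply, inner_neg_left] at this
  linarith

end SymmetricFlow

/-! ### Compact subsets of `SL` and contraction by diagonal flows. -/

section CompactSets

open Matrix Matrix.SpecialLinearGroup

variable {n : Type*} [Fintype n] [DecidableEq n]

theorem isCompact_setOf_abs_le (C : ℝ) :
    IsCompact {g : SpecialLinearGroup n ℝ | ∀ i j, |g i j| ≤ C} := by
  have h1 : IsCompact {M : Matrix n n ℝ | ∀ i j, |M i j| ≤ C} := by
    have : {M : Matrix n n ℝ | ∀ i j, |M i j| ≤ C}
        = Set.univ.pi fun _ : n => Set.univ.pi fun _ : n => Set.Icc (-C) C := by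
      ext M
      exact ⟨fun h i _ j _ => abs_le.1 (h i j), fun h i j => abs_le.2 (h i trivial j trivial)⟩
    rw [this]
    exact isCompact_univ_pi fun _ => isCompact_univ_pi fun _ => isCompact_Icc
  exact isClosedEmbedding_val.isCompact_preimage h1

theorem exists_norm_le_of_abs_le {F : Type*} [NormedAddCommGroup F]
    {f : SpecialLinearGroup n ℝ → F} (hf : Continuous f) (C : ℝ) :
    ∃ C', ∀ g : SpecialLinearGroup n ℝ, (∀ i j, |g i j| ≤ C) → ‖f g‖ ≤ C' :=
  (isCompact_setOf_abs_le C).exists_bound_of_continuousOn hf.continuousOn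

theorem coe_expSL_diagonal {A : n → ℝ} (hA : ∑ i, A i = 0) (x : ℝ) :
    (expSL (x • Matrix.diagonal A)).1 = Matrix.diagonal fun i => Real.exp (x * A i) := by
  have htr : (x • Matrix.diagonal A).trace = 0 := by simp [hA]
  rw [coe_expSL htr, ← Matrix.diagonal_smul, Matrix.exp_diagonal]
  congr 1
  ext i
  rw [Pi.coe_exp, Real.exp_eq_exp_ℝ]
  simp

theorem expSL_diagonal_conj_apply {A : n → ℝ} (hA : ∑ i, A i = 0) (b : SpecialLinearGroup n ℝ)
    (x : ℝ) (i j : n) :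
    (expSL (x • Matrix.diagonal A) * b * (expSL (x • Matrix.diagonal A))⁻¹) i j
      = Real.exp (x * (A i - A j)) * b i j := by
  have htr : (x • Matrix.diagonal A).trace = 0 := by simp [hA]
  rw [← expSL_neg htr, ← neg_smul, coe_mul, coe_mul, coe_expSL_diagonal hA, coe_expSL_diagonal hA,
    Matrix.mul_diagonal, Matrix.diagonal_mul, mul_right_comm, ← Real.exp_add]
  congr 2
  ring

/-- The entries of the conjugate are `exp (x (A i - A j)) * b i j`, so for `x ≥ 0` all conjugates
lie in one compact subset of `SL`. -/
theorem exists_norm_conj_le {F : Type*} [NormedAddCommGroup F]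
    {f : SpecialLinearGroup n ℝ → F} (hf : Continuous f) {A : n → ℝ} (hA : ∑ i, A i = 0)
    {b : SpecialLinearGroup n ℝ} (hb : ∀ i j, b i j ≠ 0 → A i ≤ A j) :
    ∃ C, ∀ x : ℝ, 0 ≤ x →
      ‖f (expSL (x • Matrix.diagonal A) * b * (expSL (x • Matrix.diagonal A))⁻¹)‖ ≤ C := by
  obtain ⟨C, hC⟩ := exists_norm_le_of_abs_le hf (∑ i, ∑ j, |b i j|)
  refine ⟨C, fun x hx => hC _ fun i j => ?_⟩
  have h1 : |b i j| ≤ ∑ i, ∑ j, |b i j| :=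
    (Finset.single_le_sum (f := fun j => |b i j|) (fun _ _ => abs_nonneg _)
      (Finset.mem_univ j)).trans
      (Finset.single_le_sum (f := fun i => ∑ j, |b i j|)
        (fun _ _ => Finset.sum_nonneg fun _ _ => abs_nonneg _) (Finset.mem_univ i))
  refine le_trans ?_ h1
  rw [expSL_diagonal_conj_apply hA]
  by_cases h0 : b i j = 0
  · simp [h0]
  · rw [abs_mul, Real.abs_exp]
    refine mul_le_of_le_one_left (abs_nonneg _) (Real.exp_le_one_iff.2 ?_)
    exact mul_nonpos_of_nonneg_of_nonpos hx (sub_nonpos.2 (hb i j h0))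

end CompactSets

/-! ### Representations compatible with transposition. -/

section GoodRepresentations

open Matrix Matrix.SpecialLinearGroup
open scoped InnerProductSpace

variable {n : Type*} [Fintype n] [DecidableEq n]
  {E : Type*} [NormedAddCommGroup E] [InnerProductSpace ℝ E]

/-- A continuous representation `R` with differential `dR` such that the adjoint of `R g` is the
image of the transpose of `g`. -/
structure IsTransposeRep (R : SpecialLinearGroup n ℝ →* (E →L[ℝ] E))
    (dR : Matrix n n ℝ →ₗ[ℝ] (E →L[ℝ] E)) : Prop extends IsDifferential R dR where
  continuous : Continuous R
  inner_map : ∀ g x y, ⟪R g x, y⟫_ℝ = ⟪x, R g.transpose y⟫_ℝ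

namespace IsTransposeRep

variable {R : SpecialLinearGroup n ℝ →* (E →L[ℝ] E)} {dR : Matrix n n ℝ →ₗ[ℝ] (E →L[ℝ] E)}

theorem inner_differential [Nonempty n] (h : IsTransposeRep R dR) (Y : Matrix n n ℝ) (x y : E) :
    ⟪dR Y x, y⟫_ℝ = ⟪x, dR Yᵀ y⟫_ℝ := by
  have key : ∀ Z : Matrix n n ℝ, Z.trace = 0 → ⟪dR Z x, y⟫_ℝ = ⟪x, dR Zᵀ y⟫_ℝ := by
    intro Z hZ
    have hZt : Zᵀ.trace = 0 := by simp [hZ]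
    have h1 := h.hasDerivAt _ Z (by simp [expSL_zero]) hZ (hasDerivAt_expSL hZ)
    have h2 := h.hasDerivAt _ _ (by simp [expSL_zero]) hZt (hasDerivAt_expSL hZt)
    have h3 := (ContinuousLinearMap.apply ℝ E x).hasFDerivAt.comp_hasDerivAt (0 : ℝ) h1
    have h4 := (ContinuousLinearMap.apply ℝ E y).hasFDerivAt.comp_hasDerivAt (0 : ℝ) h2
    have h5 := h3.inner ℝ (hasDerivAt_const (0 : ℝ) y)
    have h6 := (hasDerivAt_const (0 : ℝ) x).inner ℝ h4
    have h7 := h5.unique (h6.congr_of_eventuallyEq (Eventually.of_forall fun a => ?_))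
    · simpa using h7
    · simp only [Function.comp_apply, ContinuousLinearMap.apply_apply]
      rw [h.inner_map, ← transpose_smul, expSL_transpose (by simp [hZ])]
  have h1 := key _ (trace_traceFree Y)
  have h2 : (traceFree Y)ᵀ = traceFree Yᵀ := by simp [traceFree_apply]
  rwa [h2, h.map_traceFree, h.map_traceFree] at h1

theorem map_mul_apply (R : SpecialLinearGroup n ℝ →* (E →L[ℝ] E)) (g k : SpecialLinearGroup n ℝ)
    (x : E) : R (g * k) x = R g (R k x) := by
  rw [map_mul]
  rfl

/-- If `exp(xA)` moves `w` in a bounded set for `x ≥ 0` and `b` is contracted by conjugation with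
`exp(xA)`, then `exp(xA)` moves `R b w` in a bounded set. -/
theorem exists_bound_apply (h : IsTransposeRep R dR) {A : n → ℝ} (hA : ∑ i, A i = 0)
    {b : SpecialLinearGroup n ℝ} (hb : ∀ i j, b i j ≠ 0 → A i ≤ A j) {w : E}
    (hw : ∃ C, ∀ x : ℝ, 0 ≤ x → ‖R (expSL (x • Matrix.diagonal A)) w‖ ≤ C) :
    ∃ C, ∀ x : ℝ, 0 ≤ x → ‖R (expSL (x • Matrix.diagonal A)) (R b w)‖ ≤ C := by
  obtain ⟨C, hC⟩ := hw
  obtain ⟨C', hC'⟩ := exists_norm_conj_le h.continuous hA hb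
  refine ⟨C' * C, fun x hx => ?_⟩
  have h1 : R (expSL (x • Matrix.diagonal A)) (R b w)
      = R (expSL (x • Matrix.diagonal A) * b * (expSL (x • Matrix.diagonal A))⁻¹)
          (R (expSL (x • Matrix.diagonal A)) w) := by
    rw [← map_mul_apply, ← map_mul_apply]
    group
  rw [h1]
  exact (ContinuousLinearMap.le_opNorm _ _).trans
    (mul_le_mul (hC' x hx) (hC x hx) (norm_nonneg _) ((norm_nonneg _).trans (hC' x hx)))

end IsTransposeRep

end GoodRepresentations
-- The convexity argument at a minimiser.
section Minimizers

open Matrix Matrix.SpecialLinearGroup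
open scoped InnerProductSpace

variable {n : Type*} [Fintype n] [LinearOrder n]

/-- The lower triangular factor of a matrix. -/
noncomputable def lowerPart (M : SpecialLinearGroup n ℝ) : SpecialLinearGroup n ℝ :=
  (exists_lower_mul_orthogonal M).choose

/-- The orthogonal factor of a matrix. -/
noncomputable def orthogonalPart (M : SpecialLinearGroup n ℝ) : SpecialLinearGroup n ℝ :=
  (exists_lower_mul_orthogonal M).choose_spec.choose

theorem isLowerTriangular_lowerPart (M : SpecialLinearGroup n ℝ) :
    (lowerPart M).1.IsLowerTriangular :=
  (exists_lower_mul_orthogonal M).choose_spec.choose_spec.1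

theorem lowerPart_apply_self_pos (M : SpecialLinearGroup n ℝ) (i : n) : 0 < lowerPart M i i :=
  (exists_lower_mul_orthogonal M).choose_spec.choose_spec.2.1 i

theorem orthogonalPart_mul_transpose (M : SpecialLinearGroup n ℝ) :
    orthogonalPart M * (orthogonalPart M).transpose = 1 :=
  (exists_lower_mul_orthogonal M).choose_spec.choose_spec.2.2.1

theorem lowerPart_mul_orthogonalPart (M : SpecialLinearGroup n ℝ) :
    lowerPart M * orthogonalPart M = M :=
  (exists_lower_mul_orthogonal M).choose_spec.choose_spec.2.2.2.symm

theorem orthogonalPart_inv (M : SpecialLinearGroup n ℝ) :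
    (orthogonalPart M)⁻¹ = (orthogonalPart M).transpose :=
  inv_eq_of_mul_eq_one_right (orthogonalPart_mul_transpose M)

/-- A lower triangular left factor enters the leading Gram minors only through its diagonal, so the
dependence on `g` is confined to `orthogonalPart M * g`. -/
theorem det_lead_mul_gram (M g : SpecialLinearGroup n ℝ) (j : n) :
    (lead ((M * g).1 * (M * g).1ᵀ) j).det = (∏ i : {i // i < j}, lowerPart M i i) ^ 2 *
      (lead ((orthogonalPart M * g).1 * (orthogonalPart M * g).1ᵀ) j).det := by
  rw [← det_lead_mul_mul_transpose (isLowerTriangular_lowerPart M)]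
  congr 2
  conv_lhs => rw [← lowerPart_mul_orthogonalPart M]
  simp only [coe_mul, Matrix.transpose_mul, mul_assoc]

theorem det_lead_gram (M : SpecialLinearGroup n ℝ) (j : n) :
    (lead (M.1 * M.1ᵀ) j).det = (∏ i : {i // i < j}, lowerPart M i i) ^ 2 := by
  have h1 := det_lead_mul_gram M 1 j
  rw [mul_one, mul_one, ← coe_transpose, ← coe_mul, ← coe_transpose, ← coe_mul,
    orthogonalPart_mul_transpose] at h1
  rw [← coe_transpose, ← coe_mul, h1]
  have h2 : lead (1 : SpecialLinearGroup n ℝ).1 j = 1 :=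
    Matrix.submatrix_one _ Subtype.val_injective
  rw [h2, Matrix.det_one, mul_one]

/-- A product of powers of the leading Gram minors. -/
noncomputable def gramPow (α : n → ℝ) (M : SpecialLinearGroup n ℝ) : ℝ :=
  ∏ j, (lead (M.1 * M.1ᵀ) j).det ^ α j

theorem gramPow_pos (α : n → ℝ) (M : SpecialLinearGroup n ℝ) : 0 < gramPow α M :=
  Finset.prod_pos fun j _ => Real.rpow_pos_of_pos (det_lead_pos M j) _

theorem continuous_gramPow (α : n → ℝ) : Continuous (gramPow α) := by
  refine continuous_finsetProd _ fun j _ => ?_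
  refine Continuous.rpow_const ?_ fun M => Or.inl (det_lead_pos M j).ne'
  refine Continuous.matrix_det ?_
  refine Continuous.matrix_submatrix ?_ _ _
  exact continuous_subtype_val.mul continuous_subtype_val.matrix_transpose

/-- Summation by parts. It converts the exponents `α` of the minors into weights on the diagonal
entries, which are the entries of `A` up to a constant. -/
theorem sum_mul_sum_lt (α x : n → ℝ) :
    ∑ j, α j * ∑ i : {i // i < j}, x i = ∑ i, (∑ j, if i < j then α j else 0) * x i := by
  have h : ∀ j, ∑ i : {i // i < j}, x i = ∑ i, if i < j then x i else 0 := by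
    intro j
    rw [← Fintype.sum_subtype_add_sum_subtype (fun k => k < j)]
    rw [Finset.sum_eq_zero (s := (Finset.univ : Finset {k // ¬ k < j})), add_zero]
    · exact Finset.sum_congr rfl fun i _ => by rw [if_pos i.2]
    · exact fun i _ => by rw [if_neg i.2]
  simp only [h, Finset.mul_sum, Finset.sum_mul]
  rw [Finset.sum_comm]
  refine Finset.sum_congr rfl fun i _ => Finset.sum_congr rfl fun j _ => ?_
  split_ifs <;> simp

/-- The triangular part of `M` factors out of each minor exactly, and `det_le_exp_trace` bounds what
is left. At `g = 1` there is equality, so a minimum of the left side there is also one of this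
smooth majorant. -/
theorem gramPow_mul_le {α : n → ℝ} (hα : ∀ j, 0 ≤ α j) (M g : SpecialLinearGroup n ℝ) :
    gramPow α (M * g) ≤ gramPow α M * Real.exp (∑ i, (∑ j, if i < j then α j else 0) *
      (((orthogonalPart M * g).1 * (orthogonalPart M * g).1ᵀ) i i - 1)) := by
  rw [← sum_mul_sum_lt α fun i => ((orthogonalPart M * g).1 * (orthogonalPart M * g).1ᵀ) i i - 1,
    Real.exp_sum, gramPow, gramPow, ← Finset.prod_mul_distrib]
  refine Finset.prod_le_prod (fun j _ => (Real.rpow_pos_of_pos (det_lead_pos _ j) _).le)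
    fun j _ => ?_
  rw [det_lead_mul_gram, ← det_lead_gram,
    Real.mul_rpow (det_lead_pos _ j).le (det_lead_pos _ j).le, mul_comm (α j), Real.exp_mul]
  refine mul_le_mul_of_nonneg_left ?_ (Real.rpow_pos_of_pos (det_lead_pos _ j) _).le
  refine Real.rpow_le_rpow (det_lead_pos _ j).le ?_ (hα j)
  exact det_le_exp_trace ((posDef_mul_transpose _).submatrix Subtype.val_injective).posSemidef

variable {E : Type*} [NormedAddCommGroup E] [InnerProductSpace ℝ E]
  {R : SpecialLinearGroup n ℝ →* (E →L[ℝ] E)} {dR : Matrix n n ℝ →ₗ[ℝ] (E →L[ℝ] E)}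

/-- A linear form in `Y` is represented by the trace form. The moment matrix is symmetric because
transposes act by adjoints, and trace-free because scalars act by zero. It is the direction in which
a minimiser will be varied. -/
theorem IsTransposeRep.exists_moment [Nonempty n] (h : IsTransposeRep R dR) (v : E) :
    ∃ μ : Matrix n n ℝ, μᵀ = μ ∧ μ.trace = 0 ∧ ∀ Y, ⟪dR Y v, v⟫_ℝ = (Y * μ).trace := by
  have key : ∀ Y : Matrix n n ℝ, ⟪dR Y v, v⟫_ℝ
      = (Y * Matrix.of fun i j => ⟪dR (Matrix.single j i 1) v, v⟫_ℝ).trace := by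
    intro Y
    conv_lhs => rw [Matrix.matrix_eq_sum_single Y]
    simp only [map_sum, _root_.sum_apply, sum_inner, Matrix.trace, Matrix.diag_apply,
      Matrix.mul_apply, Matrix.of_apply]
    refine Finset.sum_congr rfl fun i _ => Finset.sum_congr rfl fun j _ => ?_
    have : Matrix.single i j (Y i j) = Y i j • Matrix.single i j (1 : ℝ) := by simp
    rw [this, map_smul, _root_.smul_apply, real_inner_smul_left]
  refine ⟨_, ?_, ?_, key⟩
  · ext i j
    simp only [Matrix.transpose_apply, Matrix.of_apply]
    rw [h.inner_differential, Matrix.transpose_single, real_inner_comm]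
  · have := key 1
    rw [h.map_one, one_mul] at this
    simpa using this.symm

/-- Vary `g` along the moment matrix of `v' = g⁻¹ v`. The derivative is a combination, with positive
coefficients, of the values of the quadratic form of `dR (diagonal A)` at the vectors `k_s v'`.
These are nonpositive, since `k_s v' = b_s⁻¹ u_s v` has a bounded forward orbit. At a minimum they
must all be zero, and `inner_le_zero_of_exp_bounded` turns this into annihilation. -/
theorem IsTransposeRep.apply_eq_zero_of_isMinOn [FiniteDimensional ℝ E] [Nonempty n] (h : IsTransposeRep R dR)
    {A α : n → ℝ} (hα : ∀ j, 0 ≤ α j) {c : ℝ} (hA : ∀ i, A i = (∑ j, if i < j then α j else 0) + c)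
    (hsum : ∑ i, A i = 0) {ι : Type*} (S : Finset ι) (ω : ι → ℝ) (hω : ∀ s ∈ S, 0 < ω s)
    (u : ι → SpecialLinearGroup n ℝ) (v : E)
    (hv : ∀ s ∈ S, ∃ C, ∀ x : ℝ, 0 ≤ x → ‖R (expSL (x • Matrix.diagonal A)) (R (u s) v)‖ ≤ C)
    (g : SpecialLinearGroup n ℝ)
    (hg : ∀ g', ∑ s ∈ S, ω s * gramPow α (u s * g) ≤ ∑ s ∈ S, ω s * gramPow α (u s * g')) :
    ∀ s ∈ S, dR (Matrix.diagonal A) (R (orthogonalPart (u s * g)) (R g⁻¹ v)) = 0 := by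
  have : CompleteSpace E := FiniteDimensional.complete ℝ E
  have htrA : (Matrix.diagonal A).trace = 0 := by simp [hsum]
  set v' := R g⁻¹ v with hv'
  have hanti : Antitone A := by
    intro i j hij
    rw [hA, hA]
    refine add_le_add (Finset.sum_le_sum fun k _ => ?_) le_rfl
    by_cases hk : j < k
    · rw [if_pos hk, if_pos (hij.trans_lt hk)]
    · rw [if_neg hk]
      split_ifs
      exacts [hα k, le_rfl]
  have hdsym : ∀ x y, ⟪dR (Matrix.diagonal A) x, y⟫_ℝ = ⟪x, dR (Matrix.diagonal A) y⟫_ℝ := by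
    intro x y
    rw [h.inner_differential, Matrix.diagonal_transpose]
  have hneg : ∀ s ∈ S, ⟪dR (Matrix.diagonal A) (R (orthogonalPart (u s * g)) v'),
      R (orthogonalPart (u s * g)) v'⟫_ℝ ≤ 0 ∧
      (⟪dR (Matrix.diagonal A) (R (orthogonalPart (u s * g)) v'),
      R (orthogonalPart (u s * g)) v'⟫_ℝ = 0 →
        dR (Matrix.diagonal A) (R (orthogonalPart (u s * g)) v') = 0) := by
    intro s hs
    refine inner_le_zero_of_exp_bounded hdsym ?_
    have h1 := h.exists_bound_apply hsum (b := (lowerPart (u s * g))⁻¹) (fun i j hij => by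
      refine hanti (not_lt.1 fun hlt => hij ?_)
      exact isLowerTriangular_inv (isLowerTriangular_lowerPart _) hlt) (hv s hs)
    have h2 : R (lowerPart (u s * g))⁻¹ (R (u s) v) = R (orthogonalPart (u s * g)) v' := by
      rw [hv', ← map_mul_apply, ← map_mul_apply]
      congr 2
      rw [inv_mul_eq_iff_eq_mul, ← mul_assoc, lowerPart_mul_orthogonalPart]
      group
    rw [h2] at h1
    simpa only [h.map_expSL htrA] using h1
  obtain ⟨μ, hμt, hμ0, hμ⟩ := h.exists_moment v'
  -- The exponent of the majorant from `gramPow_mul_le` along `exp (τ μ)`. It vanishes at `τ = 0`,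
  -- so the majorant inherits the minimum and the minors need not be differentiated.
  let φ : ι → ℝ → ℝ := fun s τ => ∑ i, (∑ j, if i < j then α j else 0) *
      (((orthogonalPart (u s * g) * expSL (τ • μ)).1 *
        (orthogonalPart (u s * g) * expSL (τ • μ)).1ᵀ) i i - 1)
  have hφ0 : ∀ s, φ s 0 = 0 := by
    intro s
    refine Finset.sum_eq_zero fun i _ => ?_
    rw [zero_smul, expSL_zero, mul_one, ← coe_transpose, ← coe_mul, orthogonalPart_mul_transpose]
    simp
  have hφd : ∀ s, HasDerivAt (φ s) (2 * ⟪dR (Matrix.diagonal A) (R (orthogonalPart (u s * g)) v'),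
      R (orthogonalPart (u s * g)) v'⟫_ℝ) 0 := by
    intro s
    set k := orthogonalPart (u s * g) with hk
    have h1 : φ s = fun τ => ∑ i, (∑ j, if i < j then α j else 0) *
        ((∑ a, ∑ b, k i a * (expSL ((2 * τ) • μ)) a b * k i b) - 1) := by
      funext τ
      refine Finset.sum_congr rfl fun i _ => ?_
      congr 2
      have h2 : (k * expSL (τ • μ)).1 * (k * expSL (τ • μ)).1ᵀ = k.1 * (expSL ((2 * τ) • μ)).1 * k.1ᵀ := by
        rw [two_mul, expSL_add_smul hμ0]
        have h3 : (expSL (τ • μ)).1ᵀ = (expSL (τ • μ)).1 := by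
          rw [← coe_transpose, ← expSL_transpose (by simp [hμ0]), transpose_smul, hμt]
        simp only [coe_mul, Matrix.transpose_mul, h3, mul_assoc]
      rw [h2, Matrix.mul_apply]
      simp only [Matrix.mul_apply, Finset.sum_mul, Matrix.transpose_apply]
      rw [Finset.sum_comm]
    have h2 : ∀ a b, HasDerivAt (fun τ : ℝ => (expSL ((2 * τ) • μ)) a b) (μ a b * (2 * 1)) 0 := by
      intro a b
      have h3 : HasDerivAt (fun x : ℝ => (expSL (x • μ) : Matrix n n ℝ) a b) (μ a b) (2 * 0) := by
        rw [mul_zero]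
        exact hasDerivAt_expSL hμ0 a b
      exact h3.comp (0 : ℝ) ((hasDerivAt_id (0 : ℝ)).const_mul 2)
    rw [h1]
    have h3 := HasDerivAt.fun_sum (u := Finset.univ) fun i _ =>
      ((HasDerivAt.fun_sum (u := Finset.univ) fun a _ => HasDerivAt.fun_sum (u := Finset.univ)
        fun b _ => (((h2 a b).const_mul (k i a)).mul_const (k i b))).sub_const 1).const_mul
        (∑ j, if i < j then α j else 0)
    refine h3.congr_deriv ?_
    have hd : dR (Matrix.diagonal A)
        = dR (Matrix.diagonal fun i => ∑ j, if i < j then α j else 0) := by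
      have : Matrix.diagonal A = (Matrix.diagonal fun i => ∑ j, if i < j then α j else 0)
          + c • (1 : Matrix n n ℝ) := by
        rw [← Matrix.diagonal_one, ← Matrix.diagonal_smul, Matrix.diagonal_add]
        congr 1
        funext i
        simp [hA]
      rw [this, map_add, map_smul, h.map_one, smul_zero, add_zero]
    have h4 : ⟪dR (Matrix.diagonal A) (R k v'), R k v'⟫_ℝ
        = ⟪dR ((k⁻¹).1 * Matrix.diagonal (fun i => ∑ j, if i < j then α j else 0) * k.1) v', v'⟫_ℝ := by
      have h5 := h.conj k⁻¹ (Matrix.diagonal (fun i => ∑ j, if i < j then α j else 0))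
      rw [inv_inv] at h5
      rw [← h5, hd, hk, orthogonalPart_inv, ← hk]
      simp only [mul_apply_eq_comp]
      conv_rhs => rw [h.inner_map]
      rfl
    have h6 : ((k⁻¹).1 * Matrix.diagonal (fun i => ∑ j, if i < j then α j else 0) * k.1 * μ).trace
        = ∑ i, (∑ j, if i < j then α j else 0) * (k.1 * μ * k.1ᵀ) i i := by
      rw [hk, orthogonalPart_inv, ← hk, coe_transpose, mul_assoc, mul_assoc, Matrix.trace_mul_comm,
        mul_assoc]
      simp only [Matrix.trace, Matrix.diag_apply, Matrix.diagonal_mul]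
    rw [h4, hμ, h6, Finset.mul_sum]
    refine Finset.sum_congr rfl fun i _ => ?_
    rw [Matrix.mul_apply, mul_left_comm]
    congr 1
    simp only [Matrix.mul_apply, Finset.sum_mul, Finset.mul_sum, Matrix.transpose_apply]
    rw [Finset.sum_comm]
    refine Finset.sum_congr rfl fun a _ => Finset.sum_congr rfl fun b _ => ?_
    ring
  have hmin : IsLocalMin (fun τ => ∑ s ∈ S, ω s * (gramPow α (u s * g) * Real.exp (φ s τ))) 0 := by
    refine Eventually.of_forall fun τ => ?_
    simp only [hφ0, Real.exp_zero, mul_one]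
    refine (hg (g * expSL (τ • μ))).trans (Finset.sum_le_sum fun s hs => ?_)
    rw [← mul_assoc]
    exact mul_le_mul_of_nonneg_left (gramPow_mul_le hα _ _) (hω s hs).le
  have hderiv := hmin.hasDerivAt_eq_zero (HasDerivAt.fun_sum fun s _ =>
    (((hφd s).exp).const_mul (gramPow α (u s * g))).const_mul (ω s))
  intro s hs
  refine (hneg s hs).2 ?_
  rw [Finset.sum_eq_zero_iff_of_nonpos] at hderiv
  · have h1 := hderiv s hs
    simp only [hφ0, Real.exp_zero, one_mul, mul_eq_zero, (hω s hs).ne', (gramPow_pos α _).ne',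
      two_ne_zero, false_or] at h1
    exact h1
  · intro s hs
    refine mul_nonpos_of_nonneg_of_nonpos (hω s hs).le
      (mul_nonpos_of_nonneg_of_nonpos (gramPow_pos α _).le ?_)
    simp only [hφ0, Real.exp_zero, one_mul]
    linarith [(hneg s hs).1]

end Minimizers
-- Existence of minimisers with uniform bounds.
section Coercivity

open Matrix Matrix.SpecialLinearGroup

variable {D : ℕ}

theorem prod_lowerPart (M : SpecialLinearGroup (Fin (D + 1)) ℝ) : ∏ i, lowerPart M i i = 1 := by
  rw [← Matrix.det_of_isLowerTriangular _ (isLowerTriangular_lowerPart M)]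
  simp

/-- The constant `c` disappears because the diagonal entries of `lowerPart M` have product one. -/
theorem gramPow_eq_exp {A α : Fin (D + 1) → ℝ} {c : ℝ}
    (hA : ∀ i, A i = (∑ j, if i < j then α j else 0) + c)
    (M : SpecialLinearGroup (Fin (D + 1)) ℝ) :
    gramPow α M = Real.exp (2 * ∑ i, A i * Real.log (lowerPart M i i)) := by
  have h0 : ∑ i, Real.log (lowerPart M i i) = 0 := by
    rw [← Real.log_prod fun i _ => (lowerPart_apply_self_pos M i).ne', prod_lowerPart, Real.log_one]
  have h1 : ∑ i, A i * Real.log (lowerPart M i i)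
      = ∑ j, α j * ∑ i : {i // i < j}, Real.log (lowerPart M i i) := by
    rw [sum_mul_sum_lt α fun i => Real.log (lowerPart M i i)]
    simp only [hA, add_mul, Finset.sum_add_distrib, ← Finset.mul_sum, h0, mul_zero, add_zero]
  rw [h1, Finset.mul_sum, Real.exp_sum, gramPow]
  refine Finset.prod_congr rfl fun j _ => ?_
  have hpos : 0 < ∏ i : {i // i < j}, lowerPart M i i :=
    Finset.prod_pos fun i _ => lowerPart_apply_self_pos M i
  rw [det_lead_gram, Real.rpow_def_of_pos (pow_pos hpos 2), Real.log_pow,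
    Real.log_prod fun i _ => (lowerPart_apply_self_pos M _).ne']
  congr 1
  push_cast
  ring

theorem gram_apply_self (M : SpecialLinearGroup (Fin (D + 1)) ℝ) (i : Fin (D + 1)) :
    ∑ l, M i l ^ 2 = ∑ l, lowerPart M i l ^ 2 := by
  have h1 : M.1 * M.1ᵀ = (lowerPart M).1 * (lowerPart M).1ᵀ := by
    rw [← coe_transpose, ← coe_mul, ← coe_transpose, ← coe_mul]
    congr 1
    conv_lhs => rw [← lowerPart_mul_orthogonalPart M]
    have h2 : ((lowerPart M) * (orthogonalPart M)).transpose
        = (orthogonalPart M).transpose * (lowerPart M).transpose := by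
      apply Subtype.ext
      simp [Matrix.transpose_mul]
    rw [h2, mul_assoc, ← mul_assoc _ _ (lowerPart M).transpose, orthogonalPart_mul_transpose,
      one_mul]
  have h3 := congrFun (congrFun h1 i) i
  simpa only [Matrix.mul_apply, Matrix.transpose_apply, ← pow_two] using h3

theorem lowerPart_sq_le (M : SpecialLinearGroup (Fin (D + 1)) ℝ) (i : Fin (D + 1)) :
    lowerPart M i i ^ 2 ≤ ∑ l, M i l ^ 2 := by
  rw [gram_apply_self]
  exact Finset.single_le_sum (f := fun l => lowerPart M i l ^ 2) (fun _ _ => sq_nonneg _)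
    (Finset.mem_univ i)

theorem lowerPart_zero_sq (M : SpecialLinearGroup (Fin (D + 1)) ℝ) :
    lowerPart M 0 0 ^ 2 = ∑ l, M 0 l ^ 2 := by
  rw [gram_apply_self, Finset.sum_eq_single 0]
  · intro l _ hl
    have : lowerPart M 0 l = 0 := isLowerTriangular_lowerPart M (Fin.pos_iff_ne_zero.2 hl)
    rw [this]
    ring
  · simp

theorem abs_apply_zero_le (M : SpecialLinearGroup (Fin (D + 1)) ℝ) (l : Fin (D + 1)) :
    |M 0 l| ≤ lowerPart M 0 0 := by
  refine abs_le_of_sq_le_sq ?_ (lowerPart_apply_self_pos M 0).le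
  rw [lowerPart_zero_sq]
  exact Finset.single_le_sum (f := fun l => M 0 l ^ 2) (fun _ _ => sq_nonneg _) (Finset.mem_univ l)

theorem lowerPart_le_of_abs_le {M : SpecialLinearGroup (Fin (D + 1)) ℝ} {i : Fin (D + 1)} {C : ℝ}
    (hC : ∀ l, |M i l| ≤ C) : lowerPart M i i ≤ (D + 1) * C := by
  have hC0 : 0 ≤ C := (abs_nonneg _).trans (hC 0)
  have h1 : lowerPart M i i ≤ ∑ l, |M i l| := by
    refine le_of_sq_le_sq ?_ (Finset.sum_nonneg fun _ _ => abs_nonneg _)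
    refine (lowerPart_sq_le M i).trans ?_
    simp only [← sq_abs (M i _)]
    exact Finset.sum_sq_le_sq_sum_of_nonneg fun _ _ => abs_nonneg _
  refine h1.trans ((Finset.sum_le_sum fun l _ => hC l).trans ?_)
  simp

/-- The rows of `g` are fixed combinations of the first rows of the `u s * g`, whose lengths are the
entries `lowerPart (u s * g) 0 0`. The parameter with the longest first row therefore controls all
of `g`, and with it all of `u s * g`. -/
theorem exists_bound_of_span {S₀ : Finset ℝ} {u : ℝ → SpecialLinearGroup (Fin (D + 1)) ℝ}
    (hspan : Submodule.span ℝ ((fun s => (u s).1 0) '' S₀) = ⊤) :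
    ∃ K : ℝ, 1 ≤ K ∧ ∀ g : SpecialLinearGroup (Fin (D + 1)) ℝ, ∃ s ∈ S₀,
      (∀ i, lowerPart (u s * g) i i ≤ K * lowerPart (u s * g) 0 0) ∧
      ∀ i j, |g i j| ≤ K * lowerPart (u s * g) 0 0 := by
  have hcoef : ∀ i : Fin (D + 1), ∃ c : ℝ → ℝ,
      ∑ s ∈ S₀, c s • (u s).1 0 = Pi.single i 1 := by
    intro i
    have : (Pi.single i 1 : Fin (D + 1) → ℝ) ∈ Submodule.span ℝ ((fun s => (u s).1 0) '' S₀) := by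
      rw [hspan]; trivial
    rw [Submodule.mem_span_image_finset_iff_exists_fun] at this
    obtain ⟨c, hc⟩ := this
    refine ⟨fun s => if h : s ∈ S₀ then c ⟨s, h⟩ else 0, ?_⟩
    rw [← hc, ← Finset.sum_coe_sort S₀]
    exact Finset.sum_congr rfl fun s _ => by simp only [dif_pos s.2]
  choose c hc using hcoef
  have hne : S₀.Nonempty := by
    rw [Finset.nonempty_iff_ne_empty]
    rintro rfl
    have := congrFun (hc 0) 0
    simp at this
  set K₁ : ℝ := ∑ i, ∑ s ∈ S₀, |c i s| with hK₁
  set K₂ : ℝ := ∑ s ∈ S₀, ∑ i, ∑ j, |u s i j| with hK₂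
  have hK₁0 : 0 ≤ K₁ := Finset.sum_nonneg fun _ _ => Finset.sum_nonneg fun _ _ => abs_nonneg _
  have hK₂0 : 0 ≤ K₂ := Finset.sum_nonneg fun _ _ => Finset.sum_nonneg fun _ _ =>
    Finset.sum_nonneg fun _ _ => abs_nonneg _
  refine ⟨1 + K₁ + (D + 1) * (K₂ * K₁), ?_, fun g => ?_⟩
  · have : 0 ≤ ((D : ℝ) + 1) * (K₂ * K₁) := by positivity
    linarith
  obtain ⟨s, hs, hmax⟩ := Finset.exists_max_image S₀ (fun s => lowerPart (u s * g) 0 0) hne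
  set y := lowerPart (u s * g) 0 0 with hy
  have hy0 : 0 < y := lowerPart_apply_self_pos _ _
  have hent : ∀ i j, |g i j| ≤ K₁ * y := by
    intro i j
    have h1 : g i j = ∑ s ∈ S₀, c i s * (u s * g) 0 j := by
      have h2 : (Pi.single i 1 : Fin (D + 1) → ℝ) ᵥ* g.1 = g.1 i := by
        rw [Matrix.single_one_vecMul]
        rfl
      have h3 := congrFun h2 j
      rw [← hc i, Matrix.sum_vecMul] at h3
      rw [← h3, Finset.sum_apply]
      refine Finset.sum_congr rfl fun s _ => ?_
      rw [Matrix.smul_vecMul]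
      rfl
    rw [h1]
    calc |∑ s ∈ S₀, c i s * (u s * g) 0 j| ≤ ∑ s ∈ S₀, |c i s * (u s * g) 0 j| :=
          Finset.abs_sum_le_sum_abs _ _
      _ ≤ ∑ s ∈ S₀, |c i s| * y := Finset.sum_le_sum fun s' hs' => by
          rw [abs_mul]
          exact mul_le_mul_of_nonneg_left ((abs_apply_zero_le _ _).trans (hmax s' hs'))
            (abs_nonneg _)
      _ = (∑ s ∈ S₀, |c i s|) * y := by rw [Finset.sum_mul]
      _ ≤ K₁ * y := mul_le_mul_of_nonneg_right
          (Finset.single_le_sum (f := fun i => ∑ s ∈ S₀, |c i s|)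
            (fun _ _ => Finset.sum_nonneg fun _ _ => abs_nonneg _) (Finset.mem_univ i)) hy0.le
  refine ⟨s, hs, fun i => ?_, fun i j => ?_⟩
  · have h1 : ∀ l, |(u s * g) i l| ≤ K₂ * (K₁ * y) := by
      intro l
      rw [coe_mul, Matrix.mul_apply]
      calc |∑ j, u s i j * g j l| ≤ ∑ j, |u s i j * g j l| := Finset.abs_sum_le_sum_abs _ _
        _ ≤ ∑ j, |u s i j| * (K₁ * y) := Finset.sum_le_sum fun j _ => by
            rw [abs_mul]
            exact mul_le_mul_of_nonneg_left (hent j l) (abs_nonneg _)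
        _ = (∑ j, |u s i j|) * (K₁ * y) := by rw [← Finset.sum_mul]
        _ ≤ K₂ * (K₁ * y) := mul_le_mul_of_nonneg_right
            ((Finset.single_le_sum (f := fun i => ∑ j, |u s i j|)
              (fun _ _ => Finset.sum_nonneg fun _ _ => abs_nonneg _) (Finset.mem_univ i)).trans
            (Finset.single_le_sum (f := fun s => ∑ i, ∑ j, |u s i j|)
              (fun _ _ => Finset.sum_nonneg fun _ _ => Finset.sum_nonneg fun _ _ => abs_nonneg _)
              hs)) (by positivity)
    refine (lowerPart_le_of_abs_le h1).trans ?_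
    have : 0 ≤ (1 + K₁) * y := by positivity
    nlinarith
  · refine (hent i j).trans (mul_le_mul_of_nonneg_right ?_ hy0.le)
    have : 0 ≤ ((D : ℝ) + 1) * (K₂ * K₁) := by positivity
    linarith

/-- With `r i` the diagonal of the triangular part and `∑ A = 0`, the exponent `∑ A i log (r i)`
equals `∑ -A i (log (r 0) - log (r i))` over `i ≠ 0`. For the parameter chosen by
`exists_bound_of_span` each difference is at least `-log K`, and since `∑ log (r i) = 0` the
differences add up to `(D + 1) log (r 0)`. A bound on the exponent thus bounds `r 0`. -/
theorem exists_abs_le_of_gramPow_le {A α : Fin (D + 1) → ℝ} {c : ℝ}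
    (hA : ∀ i, A i = (∑ j, if i < j then α j else 0) + c) (hsum : ∑ i, A i = 0) {a : ℝ} (ha : 0 < a)
    (hAa : ∀ i ≠ 0, A i ≤ -a)
    {S₀ : Finset ℝ} {u : ℝ → SpecialLinearGroup (Fin (D + 1)) ℝ}
    (hspan : Submodule.span ℝ ((fun s => (u s).1 0) '' S₀) = ⊤) (B : ℝ) :
    ∃ C, ∀ g : SpecialLinearGroup (Fin (D + 1)) ℝ, (∀ s ∈ S₀, gramPow α (u s * g) ≤ B) →
      ∀ i j, |g i j| ≤ C := by
  obtain ⟨K, hK, hKg⟩ := exists_bound_of_span hspan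
  refine ⟨Real.exp ((Real.log B / 2 + Real.log K * (a + A 0)) / (a * (D + 1))), fun g hg i j => ?_⟩
  obtain ⟨s, hs, h1, h2⟩ := hKg g
  refine (h2 i j).trans ?_
  have hK0 : 0 < K := by linarith
  set r := fun i => lowerPart (u s * g) i i with hr
  have hr0 : ∀ i, 0 < r i := fun i => lowerPart_apply_self_pos _ _
  have hKr : 0 < K * r 0 := mul_pos hK0 (hr0 0)
  change K * r 0 ≤ _
  rw [← Real.log_le_iff_le_exp hKr, le_div_iff₀ (by positivity)]
  have hlog : ∀ i, Real.log (r i) ≤ Real.log (K * r 0) := fun i => Real.log_le_log (hr0 i) (h1 i)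
  have hlogK : Real.log (K * r 0) = Real.log K + Real.log (r 0) :=
    Real.log_mul hK0.ne' (hr0 0).ne'
  have h0 : ∑ i, Real.log (r i) = 0 := by
    rw [← Real.log_prod fun i _ => (hr0 i).ne', prod_lowerPart, Real.log_one]
  have h3 := hg s hs
  rw [gramPow_eq_exp hA] at h3
  have h4 := Real.log_le_log (Real.exp_pos _) h3
  rw [Real.log_exp] at h4
  rw [Fin.sum_univ_succ] at h0 hsum h4
  have h5 : ∀ i : Fin D, a * (Real.log (r 0) - Real.log (r i.succ) + Real.log K)
      ≤ -A i.succ * (Real.log (r 0) - Real.log (r i.succ) + Real.log K) := by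
    intro i
    refine mul_le_mul_of_nonneg_right ?_ ?_
    · linarith [hAa i.succ (Fin.succ_ne_zero i)]
    · linarith [hlog i.succ]
  have h6 := Finset.sum_le_sum fun i (_ : i ∈ Finset.univ) => h5 i
  have h7 : ∑ i : Fin D, -A i.succ * (Real.log (r 0) - Real.log (r i.succ) + Real.log K)
      = A 0 * (Real.log (r 0) + Real.log K) + ∑ i : Fin D, A i.succ * Real.log (r i.succ) := by
    have : A 0 = ∑ i : Fin D, -A i.succ := by
      rw [Finset.sum_neg_distrib]
      linarith
    rw [this, Finset.sum_mul, ← Finset.sum_add_distrib]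
    refine Finset.sum_congr rfl fun i _ => ?_
    ring
  rw [h7, ← Finset.mul_sum, Finset.sum_add_distrib, Finset.sum_sub_distrib] at h6
  simp only [Finset.sum_const, Finset.card_univ, Fintype.card_fin, nsmul_eq_mul] at h6
  have h8 : ∑ i : Fin D, Real.log (r i.succ) = -Real.log (r 0) := by linarith
  rw [h8] at h6
  change 2 * (A 0 * Real.log (r 0) + ∑ i : Fin D, A i.succ * Real.log (r i.succ)) ≤ _ at h4
  have h9 : Real.log (K * r 0) * (a * (D + 1))
      = a * (D * Real.log (r 0) - -Real.log (r 0) + D * Real.log K) + a * Real.log K := by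
    rw [hlogK]
    ring
  rw [h9]
  linarith

/-- The bound `C` must not depend on `S`, since the mesh of `S` is chosen later in terms of `C`. -/
theorem exists_minimizer {A α : Fin (D + 1) → ℝ} {c : ℝ}
    (hA : ∀ i, A i = (∑ j, if i < j then α j else 0) + c) (hsum : ∑ i, A i = 0)
    (hneg : ∀ i ≠ 0, A i < 0) {S₀ : Finset ℝ} {u : ℝ → SpecialLinearGroup (Fin (D + 1)) ℝ}
    (hspan : Submodule.span ℝ ((fun s => (u s).1 0) '' S₀) = ⊤)
    {J : Set ℝ} (hJ : IsCompact J) (hu : ContinuousOn u J) :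
    ∃ C, ∀ S : Finset ℝ, S₀ ⊆ S → ↑S ⊆ J → ∃ ω : ℝ → ℝ, (∀ s ∈ S, 0 < ω s) ∧
      ∃ g : SpecialLinearGroup (Fin (D + 1)) ℝ, (∀ i j, |g i j| ≤ C) ∧
        ∀ g', ∑ s ∈ S, ω s * gramPow α (u s * g) ≤ ∑ s ∈ S, ω s * gramPow α (u s * g') := by
  obtain ⟨a, ha, hAa⟩ : ∃ a : ℝ, 0 < a ∧ ∀ i ≠ 0, A i ≤ -a := by
    have h1 : ∀ᶠ a in 𝓝[>] (0 : ℝ), ∀ i : Fin (D + 1), i ≠ 0 → A i ≤ -a := by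
      rw [eventually_all]
      intro i
      by_cases hi : i = 0
      · simp [hi]
      · have := Ioo_mem_nhdsGT (neg_pos.2 (hneg i hi))
        filter_upwards [this] with a ha _
        linarith [ha.2]
    obtain ⟨a, h, h'⟩ := (h1.and self_mem_nhdsWithin).exists
    exact ⟨a, h', h⟩
  obtain ⟨B, hB⟩ := hJ.exists_bound_of_continuousOn ((continuous_gramPow α).comp_continuousOn hu)
  obtain ⟨C, hC⟩ := exists_abs_le_of_gramPow_le hA hsum ha hAa hspan (S₀.card * B + B)
  refine ⟨C, fun S hS hSJ => ?_⟩
  -- Weight at least one on `S₀` gives coercivity. The summand `1 / |S|` makes every weight positive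
  -- and adds only `1` to the total weight, so the value at `g = 1` stays bounded uniformly in `S`.
  let ω : ℝ → ℝ := fun s => (if s ∈ S₀ then 1 else 0) + (S.card : ℝ)⁻¹
  have hne : S₀.Nonempty := by
    rw [Finset.nonempty_iff_ne_empty]
    rintro rfl
    simp at hspan
  have hcard : 0 < (S.card : ℝ) := by
    exact_mod_cast Finset.card_pos.2 (hne.mono hS)
  have hω : ∀ s, 0 < ω s := fun s => by
    simp only [ω]
    split_ifs <;> positivity
  have hω1 : ∀ s ∈ S₀, 1 ≤ ω s := fun s hs => by
    simp only [ω, if_pos hs]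
    have : 0 < (S.card : ℝ)⁻¹ := by positivity
    linarith
  refine ⟨ω, fun s _ => hω s, ?_⟩
  set F : SpecialLinearGroup (Fin (D + 1)) ℝ → ℝ :=
    fun g => ∑ s ∈ S, ω s * gramPow α (u s * g) with hF
  have hFc : Continuous F := continuous_finsetSum _ fun s _ =>
    continuous_const.mul ((continuous_gramPow α).comp (continuous_const.mul continuous_id))
  have hF1 : F 1 ≤ S₀.card * B + B := by
    have h1 : ∀ s ∈ S, ω s * gramPow α (u s * 1) ≤ ω s * B := fun s hs => by
      refine mul_le_mul_of_nonneg_left ?_ (hω s).le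
      rw [mul_one]
      exact (le_abs_self _).trans (hB s (hSJ hs))
    refine (Finset.sum_le_sum h1).trans (le_of_eq ?_)
    rw [← Finset.sum_mul, Finset.sum_add_distrib, Finset.sum_const, nsmul_eq_mul,
      mul_inv_cancel₀ hcard.ne', Finset.sum_ite_mem, Finset.inter_eq_right.2 hS]
    simp
    ring
  have hmem : ∀ g, F g ≤ F 1 → ∀ i j, |g i j| ≤ C := by
    intro g hg
    refine hC g fun s hs => ?_
    calc gramPow α (u s * g) ≤ ω s * gramPow α (u s * g) :=
          le_mul_of_one_le_left (gramPow_pos α _).le (hω1 s hs)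
      _ ≤ F g := Finset.single_le_sum (f := fun s => ω s * gramPow α (u s * g))
          (fun s _ => (mul_pos (hω s) (gramPow_pos α _)).le) (hS hs)
      _ ≤ _ := hg.trans hF1
  obtain ⟨g, hg, hmin⟩ := (isCompact_setOf_abs_le (n := Fin (D + 1)) C).exists_isMinOn
    ⟨1, hmem 1 le_rfl⟩ hFc.continuousOn
  refine ⟨g, hg, fun g' => ?_⟩
  by_cases h : F g' ≤ F 1
  · exact hmin (hmem g' h)
  · exact (hmin (hmem 1 le_rfl)).trans (not_le.1 h).le

end Coercivity
-- Annihilators of a vector in the Lie algebra.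
section Annihilators

open Matrix Matrix.SpecialLinearGroup
open scoped InnerProductSpace

theorem IsDifferential.lie_apply_eq_zero {n : Type*} [Fintype n] [DecidableEq n] [Nonempty n]
    {E : Type*} [NormedAddCommGroup E] [NormedSpace ℝ E] [CompleteSpace E]
    {R : SpecialLinearGroup n ℝ →* (E →L[ℝ] E)} {dR : Matrix n n ℝ →ₗ[ℝ] (E →L[ℝ] E)}
    (h : IsDifferential R dR) {w : E} {X Y : Matrix n n ℝ} (hX : dR X w = 0) (hY : dR Y w = 0) :
    dR (X * Y - Y * X) w = 0 := by
  rw [h.lie]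
  simp [hX, hY]

theorem IsDifferential.conj_apply {n : Type*} [Fintype n] [DecidableEq n] [Nonempty n]
    {E : Type*} [NormedAddCommGroup E] [NormedSpace ℝ E]
    {R : SpecialLinearGroup n ℝ →* (E →L[ℝ] E)} {dR : Matrix n n ℝ →ₗ[ℝ] (E →L[ℝ] E)}
    (h : IsDifferential R dR) {w : E} {g : SpecialLinearGroup n ℝ} {Y : Matrix n n ℝ}
    (hY : dR Y (R g w) = 0) : dR ((g⁻¹).1 * Y * g.1) w = 0 := by
  have h1 := h.conj g⁻¹ Y
  rw [inv_inv] at h1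
  rw [← h1]
  simp [mul_apply_eq_comp, hY]

/-- The bracket with `diagonal A` multiplies the entry at `(i, j)` by `A i - A j` and preserves the
annihilator of `w`; so does every polynomial in this operator. -/
theorem IsDifferential.eval_apply_eq_zero {n : Type*} [Fintype n] [DecidableEq n] [Nonempty n]
    {E : Type*} [NormedAddCommGroup E] [NormedSpace ℝ E] [CompleteSpace E]
    {R : SpecialLinearGroup n ℝ →* (E →L[ℝ] E)} {dR : Matrix n n ℝ →ₗ[ℝ] (E →L[ℝ] E)}
    (h : IsDifferential R dR) {w : E} {A : n → ℝ} (hA : dR (Matrix.diagonal A) w = 0)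
    {Y : Matrix n n ℝ} (hY : dR Y w = 0) (p : Polynomial ℝ) :
    dR (Matrix.of fun i j => p.eval (A i - A j) * Y i j) w = 0 := by
  induction p using Polynomial.induction_on with
  | C a =>
    have : (Matrix.of fun i j => (Polynomial.C a).eval (A i - A j) * Y i j) = a • Y := by
      ext i j
      simp
    rw [this, map_smul, _root_.smul_apply, hY, smul_zero]
  | add p q hp hq =>
    have : (Matrix.of fun i j => (p + q).eval (A i - A j) * Y i j)
        = (Matrix.of fun i j => p.eval (A i - A j) * Y i j)
          + Matrix.of fun i j => q.eval (A i - A j) * Y i j := by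
      ext i j
      simp [add_mul]
    rw [this, map_add, _root_.add_apply, hp, hq, add_zero]
  | monomial k a ih =>
    have : (Matrix.of fun i j => (Polynomial.C a * Polynomial.X ^ (k + 1)).eval (A i - A j) * Y i j)
        = Matrix.diagonal A *
            (Matrix.of fun i j => (Polynomial.C a * Polynomial.X ^ k).eval (A i - A j) * Y i j)
          - (Matrix.of fun i j => (Polynomial.C a * Polynomial.X ^ k).eval (A i - A j) * Y i j)
            * Matrix.diagonal A := by
      ext i j
      rw [Matrix.sub_apply, Matrix.diagonal_mul, Matrix.mul_diagonal]
      simp only [Matrix.of_apply, Polynomial.eval_mul, Polynomial.eval_C, Polynomial.eval_pow,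
        Polynomial.eval_X]
      ring
    rw [this]
    exact h.lie_apply_eq_zero hA ih

theorem exists_polynomial_eval_eq (S : Finset ℝ) (f : ℝ → ℝ) :
    ∃ p : Polynomial ℝ, ∀ x ∈ S, p.eval x = f x :=
  ⟨Lagrange.interpolate S id f, fun _ hx =>
    Lagrange.eval_interpolate_at_node f Function.injective_id.injOn hx⟩

theorem neg_le_apply_zero {D : ℕ} {A : Fin (D + 1) → ℝ} (hsum : ∑ i, A i = 0)
    (hneg : ∀ i ≠ 0, A i < 0) {j : Fin (D + 1)} (hj : j ≠ 0) : -A j ≤ A 0 := by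
  rw [Fin.sum_univ_succ] at hsum
  obtain ⟨l, rfl⟩ := Fin.exists_succ_eq_of_ne_zero hj
  have h1 : -A l.succ ≤ ∑ i : Fin D, -A i.succ :=
    Finset.single_le_sum (f := fun i : Fin D => -A i.succ)
      (fun i _ => by linarith [hneg i.succ (Fin.succ_ne_zero i)]) (Finset.mem_univ l)
  rw [Finset.sum_neg_distrib] at h1
  linarith

variable {D : ℕ} {E : Type*} [NormedAddCommGroup E] [NormedSpace ℝ E] [FiniteDimensional ℝ E]
  {R : SpecialLinearGroup (Fin (D + 1)) ℝ →* (E →L[ℝ] E)}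
  {dR : Matrix (Fin (D + 1)) (Fin (D + 1)) ℝ →ₗ[ℝ] (E →L[ℝ] E)}

/-- If the diagonal matrix `A` annihilates `w`, so does the first row of every annihilator of `w`,
off the diagonal. -/
theorem IsDifferential.firstRow_apply_eq_zero (h : IsDifferential R dR) {w : E}
    {A : Fin (D + 1) → ℝ} (hsum : ∑ i, A i = 0) (hneg : ∀ i ≠ 0, A i < 0)
    (hA : dR (Matrix.diagonal A) w = 0)
    {Y : Matrix (Fin (D + 1)) (Fin (D + 1)) ℝ} (hY : dR Y w = 0) :
    dR (Matrix.vecMulVec (Pi.single 0 1) fun j => if j = 0 then 0 else Y 0 j) w = 0 := by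
  classical
  have : CompleteSpace E := FiniteDimensional.complete ℝ E
  have hA0 : ∀ j ≠ 0, -A j ≤ A 0 := fun j hj => neg_le_apply_zero hsum hneg hj
  -- The weights `A 0 - A l` with `l ≠ 0` exceed `A 0`, and by trace zero every entry outside the
  -- off-diagonal first row has a smaller weight. Interpolation therefore isolates that row.
  obtain ⟨p, hp'⟩ := exists_polynomial_eval_eq
    (Finset.univ.image fun ij : Fin (D + 1) × Fin (D + 1) => A ij.1 - A ij.2)
    (fun x => if ∃ l, l ≠ 0 ∧ x = A 0 - A l then 1 else 0)
  have hp : ∀ i j, p.eval (A i - A j) = if ∃ l, l ≠ 0 ∧ A i - A j = A 0 - A l then 1 else 0 :=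
    fun i j => hp' _ (Finset.mem_image_of_mem
      (fun ij : Fin (D + 1) × Fin (D + 1) => A ij.1 - A ij.2) (Finset.mem_univ (i, j)))
  have h1 := h.eval_apply_eq_zero hA hY p
  convert h1 using 3
  ext i j
  rw [Matrix.of_apply, hp, Matrix.vecMulVec_apply]
  by_cases hi : i = 0
  · subst hi
    by_cases hj : j = 0
    · subst hj
      have h2 : ¬ ∃ l, l ≠ 0 ∧ A 0 - A 0 = A 0 - A l := by
        rintro ⟨l, hl, h2⟩
        linarith [hneg l hl, hA0 l hl]
      rw [if_neg h2]
      simp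
    · have h2 : ∃ l, l ≠ 0 ∧ A 0 - A j = A 0 - A l := ⟨j, hj, rfl⟩
      rw [if_pos h2]
      simp [hj]
  · have h2 : ¬ ∃ l, l ≠ 0 ∧ A i - A j = A 0 - A l := by
      rintro ⟨l, hl, h2⟩
      by_cases hj : j = 0
      · subst hj
        linarith [hneg l hl, hA0 l hl, hneg i hi]
      · linarith [hneg l hl, hA0 j hj, hneg i hi]
    rw [if_neg h2]
    simp [hi]

/-- If `A` and `n⁻¹ A n` annihilate `w`, then so does the elementary matrix built from the first
row of the upper triangular matrix `n`. -/
theorem IsDifferential.firstRow_upper_apply_eq_zero (h : IsDifferential R dR) {w : E}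
    {A : Fin (D + 1) → ℝ} (hsum : ∑ i, A i = 0) (hneg : ∀ i ≠ 0, A i < 0)
    (hA : dR (Matrix.diagonal A) w = 0) {N : SpecialLinearGroup (Fin (D + 1)) ℝ}
    (hN : N.1.IsUpperTriangular)
    (hAN : dR ((N⁻¹).1 * Matrix.diagonal A * N.1) w = 0) :
    dR (Matrix.vecMulVec (Pi.single 0 1) fun j => if j = 0 then 0 else N 0 j) w = 0 := by
  have : CompleteSpace E := FiniteDimensional.complete ℝ E
  have hA0 : ∀ j ≠ 0, A j - A 0 ≠ 0 := by
    intro j hj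
    have := neg_le_apply_zero hsum hneg hj
    have := hneg j hj
    intro h0
    linarith
  set Z := (N⁻¹).1 * Matrix.diagonal A * N.1 with hZ
  have hNinv : N.1 * (N⁻¹).1 = 1 := by rw [← coe_mul]; simp
  have hNinv' : (N⁻¹).1 * N.1 = 1 := by rw [← coe_mul]; simp
  have hZu : Z.IsUpperTriangular := Matrix.BlockTriangular.mul
    (Matrix.BlockTriangular.mul (isUpperTriangular_inv hN) (Matrix.blockTriangular_diagonal _)) hN
  have hZd : ∀ i, Z i i = A i := by
    intro i
    have h1 := mul_apply_self_of_isUpperTriangular (isUpperTriangular_inv hN) hN i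
    rw [hNinv', Matrix.one_apply_eq] at h1
    rw [hZ, mul_apply_self_of_isUpperTriangular (Matrix.BlockTriangular.mul
      (isUpperTriangular_inv hN) (Matrix.blockTriangular_diagonal _)) hN, Matrix.mul_diagonal,
      mul_right_comm, ← h1, one_mul]
  have hNZ : ∀ j, ∑ k, N 0 k * Z k j = A 0 * N 0 j := by
    intro j
    rw [← Matrix.mul_apply, hZ, ← mul_assoc, ← mul_assoc, hNinv, one_mul, Matrix.diagonal_mul]
  let e : (Fin (D + 1) → ℝ) →ₗ[ℝ] Matrix (Fin (D + 1)) (Fin (D + 1)) ℝ :=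
    { toFun := fun ℓ => Matrix.vecMulVec (Pi.single 0 1) ℓ
      map_add' := fun _ _ => Matrix.vecMulVec_add _ _ _
      map_smul' := fun _ _ => Matrix.vecMulVec_smul _ _ _ }
  have he : ∀ ℓ, e ℓ = Matrix.vecMulVec (Pi.single 0 1) ℓ := fun _ => rfl
  set ζ : Fin (D + 1) → ℝ := fun j => if j = 0 then 0 else Z 0 j with hζ
  have hζw := h.firstRow_apply_eq_zero hsum hneg hA hAN
  set Z' := Z - e ζ with hZ'
  have hZ'w : dR Z' w = 0 := by
    rw [hZ', map_sub, _root_.sub_apply, hAN, he, hζw, sub_zero]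
  -- the annihilating row vectors
  let L : Submodule ℝ (Fin (D + 1) → ℝ) :=
    LinearMap.ker (((ContinuousLinearMap.apply ℝ E w : (E →L[ℝ] E) →ₗ[ℝ] E) ∘ₗ dR) ∘ₗ e) ⊓
      LinearMap.ker (LinearMap.proj 0 : (Fin (D + 1) → ℝ) →ₗ[ℝ] ℝ)
  have hL : ∀ ℓ, ℓ ∈ L ↔ dR (e ℓ) w = 0 ∧ ℓ 0 = 0 := fun ℓ => Iff.rfl
  -- On rows with vanishing first entry, the bracket with `Z'` is right multiplication by `Z' - A
  -- 0`. Adding the matrix unit at `(0, 0)` changes nothing on such rows and makes the upper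
  -- triangular matrix invertible.
  let Z'' := Z' - A 0 • (1 : Matrix (Fin (D + 1)) (Fin (D + 1)) ℝ) + Matrix.single 0 0 1
  have hZ'0 : Z' *ᵥ Pi.single 0 1 = A 0 • (Pi.single 0 1 : Fin (D + 1) → ℝ) := by
    ext i
    rw [Matrix.mulVec_single_one]
    by_cases hi : i = 0
    · subst hi
      simp [hZ', he, Matrix.vecMulVec_apply, hζ, hZd]
    · have : Z i 0 = 0 := hZu (Fin.pos_iff_ne_zero.2 hi)
      simp [hZ', he, Matrix.vecMulVec_apply, hi, this]
  have hT : ∀ ℓ : Fin (D + 1) → ℝ, ℓ 0 = 0 → ℓ ᵥ* Z'' = ℓ ᵥ* Z' - A 0 • ℓ := by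
    intro ℓ hℓ
    simp only [Z'', Matrix.vecMul_add, Matrix.vecMul_sub, Matrix.vecMul_smul, Matrix.vecMul_one]
    rw [add_eq_left]
    ext j
    simp only [Matrix.vecMul, dotProduct, Matrix.single_apply, Pi.zero_apply]
    refine Finset.sum_eq_zero fun i _ => ?_
    split_ifs with hi
    · rw [← hi.1, hℓ, zero_mul]
    · rw [mul_zero]
  have hinj : Function.Injective Z''.vecMulLinear := by
    rw [Matrix.coe_vecMulLinear, Matrix.vecMul_injective_iff_isUnit, Matrix.isUnit_iff_isUnit_det,
      isUnit_iff_ne_zero, Matrix.det_of_isUpperTriangular]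
    · rw [Finset.prod_ne_zero_iff]
      intro i _
      by_cases hi : i = 0
      · subst hi
        simp [Z'', hZ', he, Matrix.vecMulVec_apply, hζ, hZd]
      · have := hA0 i hi
        simpa [Z'', hZ', he, Matrix.vecMulVec_apply, hi, Ne.symm hi, hZd] using this
    · intro i j hij
      have hij : j < i := hij
      have hi : i ≠ 0 := ((Fin.zero_le j).trans_lt hij).ne'
      simp [Z'', hZ', he, Matrix.vecMulVec_apply, hi, Ne.symm hi, hZu hij, hij.ne']
  have hmaps : ∀ ℓ ∈ L, Z''.vecMulLinear ℓ ∈ L := by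
    intro ℓ hℓ
    rw [hL] at hℓ ⊢
    rw [Matrix.vecMulLinear_apply, hT ℓ hℓ.2]
    refine ⟨?_, ?_⟩
    · have h1 := h.lie_apply_eq_zero hℓ.1 hZ'w
      have h2 : e ℓ * Z' - Z' * e ℓ = e (ℓ ᵥ* Z' - A 0 • ℓ) := by
        rw [map_sub, map_smul, he, he, Matrix.vecMulVec_mul, Matrix.mul_vecMulVec, hZ'0,
          Matrix.smul_vecMulVec]
      rwa [h2] at h1
    · have h3 : (ℓ ᵥ* Z') 0 = ℓ ⬝ᵥ (Z' *ᵥ Pi.single 0 1) := by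
        rw [Matrix.mulVec_single_one]
        rfl
      rw [Pi.sub_apply, h3, hZ'0]
      simp [hℓ.2]
  set z : Fin (D + 1) → ℝ := fun j => if j = 0 then 0 else N 0 j with hz
  -- This is the first row of the identity `N Z = diag(A) N`.
  have hTz : z ᵥ* Z'' = -(N 0 0) • ζ := by
    rw [hT z (by simp [hz])]
    have h1 : N.1 0 = N 0 0 • (Pi.single 0 1 : Fin (D + 1) → ℝ) + z := by
      ext j
      by_cases hj : j = 0
      · subst hj
        simp [hz]
      · simp [hz, hj]
    have h2 : N.1 0 ᵥ* Z = A 0 • N.1 0 := funext hNZ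
    have h3 : Z = Z' + e ζ := by rw [hZ']; abel
    have h4 : (Pi.single 0 1 : Fin (D + 1) → ℝ) ᵥ* Z' = A 0 • Pi.single 0 1 := by
      ext j
      rw [Matrix.single_one_vecMul]
      by_cases hj : j = 0
      · subst hj
        simp [hZ', he, Matrix.vecMulVec_apply, hζ, hZd]
      · simp [hZ', he, Matrix.vecMulVec_apply, hζ, hj]
    have h5 : z ᵥ* e ζ = 0 := by
      rw [he, Matrix.vecMul_vecMulVec]
      simp [hz]
    have h6 : (Pi.single 0 1 : Fin (D + 1) → ℝ) ᵥ* e ζ = ζ := by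
      rw [he, Matrix.vecMul_vecMulVec]
      simp
    rw [h1, h3, Matrix.vecMul_add, Matrix.add_vecMul, Matrix.add_vecMul, Matrix.smul_vecMul,
      Matrix.smul_vecMul, h4, h5, h6, smul_add, add_zero, smul_comm] at h2
    ext j
    have h7 := congrFun h2 j
    simp only [Pi.add_apply, Pi.smul_apply, smul_eq_mul, Pi.sub_apply] at h7 ⊢
    linarith
  -- An injective endomorphism of the finite-dimensional `L` is onto. As the image of `z` lies in
  -- `L`, injectivity on all rows puts `z` itself in `L`.
  have hsurj : Function.Surjective (Z''.vecMulLinear.restrict hmaps) := by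
    rw [← LinearMap.injective_iff_surjective]
    intro x y hxy
    exact Subtype.ext (hinj (congrArg Subtype.val hxy))
  have hζL : -(N 0 0) • ζ ∈ L := by
    refine L.smul_mem _ ((hL _).2 ⟨hζw, by simp [hζ]⟩)
  obtain ⟨y, hy⟩ := hsurj ⟨_, hζL⟩
  have h8 : Z''.vecMulLinear y = Z''.vecMulLinear z := by
    exact (congrArg Subtype.val hy).trans hTz.symm
  have h9 := ((hL _).1 y.2).1
  rw [hinj h8] at h9
  exact h9

end Annihilators

/-! ### Rank one annihilators from neighbouring parameters. -/

section Propagation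

open Matrix Matrix.SpecialLinearGroup
open scoped InnerProductSpace

variable {D : ℕ} {E : Type*} [NormedAddCommGroup E] [InnerProductSpace ℝ E] [FiniteDimensional ℝ E]
  {R : SpecialLinearGroup (Fin (D + 1)) ℝ →* (E →L[ℝ] E)}
  {dR : Matrix (Fin (D + 1)) (Fin (D + 1)) ℝ →ₗ[ℝ] (E →L[ℝ] E)}

theorem IsTransposeRep.exists_bound_of_apply_eq_zero {n : Type*} [Fintype n] [LinearOrder n]
    {R : SpecialLinearGroup n ℝ →* (E →L[ℝ] E)} {dR : Matrix n n ℝ →ₗ[ℝ] (E →L[ℝ] E)}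
    (h : IsTransposeRep R dR) {A : n → ℝ} (hsum : ∑ i, A i = 0)
    {b : SpecialLinearGroup n ℝ} (hb : ∀ i j, b i j ≠ 0 → A i ≤ A j) {w : E}
    (hw : dR (Matrix.diagonal A) w = 0) :
    ∃ C, ∀ x : ℝ, 0 ≤ x → ‖NormedSpace.exp (x • dR (Matrix.diagonal A)) (R b w)‖ ≤ C := by
  have : CompleteSpace E := FiniteDimensional.complete ℝ E
  have htr : (Matrix.diagonal A).trace = 0 := by simp [hsum]
  have h1 := h.exists_bound_apply hsum hb (w := w) ⟨‖w‖, fun x _ => by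
    rw [h.map_expSL htr, exp_apply_of_apply_eq_zero (by simp [hw])]⟩
  simpa only [h.map_expSL htr] using h1

theorem isLowerTriangular_mul_row_zero {b : SpecialLinearGroup (Fin (D + 1)) ℝ}
    (hb : b.1.IsLowerTriangular) (P : SpecialLinearGroup (Fin (D + 1)) ℝ) :
    (b * P).1 0 = b 0 0 • P.1 0 := by
  ext j
  rw [coe_mul, Matrix.mul_apply, Finset.sum_eq_single 0]
  · rfl
  · intro l _ hl
    have : b.1 0 l = 0 := hb (show (0 : Fin (D + 1)) < l from Fin.pos_iff_ne_zero.2 hl)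
    rw [this, zero_mul]
  · simp

theorem orthogonalPart_row_zero_dotProduct (M : SpecialLinearGroup (Fin (D + 1)) ℝ) :
    orthogonalPart M 0 ⬝ᵥ orthogonalPart M 0 = 1 := by
  have h := congrFun (congrFun (congrArg Subtype.val (orthogonalPart_mul_transpose M)) 0) 0
  rw [coe_mul, coe_transpose, coe_one, Matrix.mul_apply, Matrix.one_apply_eq] at h
  exact h

theorem row_zero_eq_smul (M : SpecialLinearGroup (Fin (D + 1)) ℝ) :
    M.1 0 = lowerPart M 0 0 • (orthogonalPart M).1 0 := by
  conv_lhs => rw [← lowerPart_mul_orthogonalPart M]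
  exact isLowerTriangular_mul_row_zero (isLowerTriangular_lowerPart M) _

/-- The `LU` decomposition of `M' Mᵀ` gives `k' = b₁ N₁ k` with `b₁` lower and `N₁` upper
triangular. Both `A` and its conjugate by `N₁` annihilate `k v`, hence so does the off-diagonal
first row of `N₁`. Carried back by `k`, that row is a multiple of the part of `M' 0` orthogonal to
the first row of `k`. -/
theorem IsTransposeRep.rankOne_apply_eq_zero (h : IsTransposeRep R dR)
    {A : Fin (D + 1) → ℝ} (hanti : Antitone A) (hsum : ∑ i, A i = 0) (hneg : ∀ i ≠ 0, A i < 0)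
    {M M' : SpecialLinearGroup (Fin (D + 1)) ℝ} {v : E}
    (hM : dR (Matrix.diagonal A) (R (orthogonalPart M) v) = 0)
    (hM' : dR (Matrix.diagonal A) (R (orthogonalPart M') v) = 0)
    (hlead : ∀ j, (lead (M'.1 * M.1ᵀ) j).det ≠ 0) :
    dR (Matrix.vecMulVec (orthogonalPart M 0)
      (M' 0 - (orthogonalPart M 0 ⬝ᵥ M' 0) • orthogonalPart M 0)) v = 0 := by
  set k := orthogonalPart M with hk
  set k' := orthogonalPart M' with hk'
  have hkk : k * k.transpose = 1 := orthogonalPart_mul_transpose M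
  have hkinv : k⁻¹ = k.transpose := orthogonalPart_inv M
  obtain ⟨b, N, hb, hN, hN1, hbN⟩ := exists_lower_mul_upper (M' * M.transpose) hlead
  set c := lowerPart M with hc
  set c' := lowerPart M' with hc'
  have hcM : c * k = M := lowerPart_mul_orthogonalPart M
  have hcM' : c' * k' = M' := lowerPart_mul_orthogonalPart M'
  have hctu : (c.transpose).1.IsUpperTriangular := fun i j hij => isLowerTriangular_lowerPart M hij
  -- the `LU` decomposition of the orthogonal parts
  set b₁ := c'⁻¹ * b with hb₁
  set N₁ := N * (c.transpose)⁻¹ with hN₁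
  have hb₁l : b₁.1.IsLowerTriangular :=
    Matrix.BlockTriangular.mul (isLowerTriangular_inv (isLowerTriangular_lowerPart M')) hb
  have hN₁u : N₁.1.IsUpperTriangular := Matrix.BlockTriangular.mul hN (isUpperTriangular_inv hctu)
  have hkey : b₁ * N₁ * k = k' := by
    have h1 : M.transpose = k.transpose * c.transpose := by
      rw [← hcM]
      apply Subtype.ext
      simp [Matrix.transpose_mul]
    calc b₁ * N₁ * k = c'⁻¹ * (b * N) * (c.transpose)⁻¹ * k := by rw [hb₁, hN₁]; group
      _ = k' * (k.transpose * k) := by rw [← hbN, h1, ← hcM']; group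
      _ = k' := by rw [← hkinv]; group
  -- The vector `N₁ k v` equals `b₁⁻¹ k' v`. The upper triangular factor keeps its backward orbit
  -- bounded, and the lower triangular one its forward orbit.
  have hNw : dR (Matrix.diagonal A) (R N₁ (R k v)) = 0 := by
    refine apply_eq_zero_of_exp_bounded (fun x y => by
      rw [h.inner_differential, Matrix.diagonal_transpose]) ?_ ?_
    · have h1 : R N₁ (R k v) = R b₁⁻¹ (R k' v) := by
        rw [← map_mul_apply, ← map_mul_apply, ← hkey]
        group
      rw [h1]
      exact h.exists_bound_of_apply_eq_zero hsum (fun i j hij => hanti (not_lt.1 fun hlt =>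
        hij (isLowerTriangular_inv hb₁l hlt))) hM'
    · have h1 : -dR (Matrix.diagonal A) = dR (Matrix.diagonal fun i => -A i) := by
        rw [← map_neg, Matrix.diagonal_neg]
      rw [h1]
      refine h.exists_bound_of_apply_eq_zero (A := fun i => -A i) (by simp [hsum])
        (fun i j hij => neg_le_neg (hanti (not_lt.1 fun hlt => hij (hN₁u hlt)))) ?_
      rw [← h1, _root_.neg_apply, hM, neg_zero]
  have h1 := h.firstRow_upper_apply_eq_zero hsum hneg hM hN₁u (h.conj_apply hNw)
  have h2 := h.conj_apply h1
  set z : Fin (D + 1) → ℝ := fun j => if j = 0 then 0 else N₁ 0 j with hz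
  have h3 : (k⁻¹).1 * Matrix.vecMulVec (Pi.single 0 1) z * k.1 = Matrix.vecMulVec (k 0) (z ᵥ* k.1) := by
    rw [Matrix.mul_vecMulVec, Matrix.vecMulVec_mul, hkinv, coe_transpose, Matrix.mulVec_single_one]
    rfl
  rw [h3] at h2
  have hk0 : k.1 *ᵥ k 0 = Pi.single 0 1 := by
    have h4 := congrArg Subtype.val hkk
    rw [coe_mul, coe_transpose, coe_one] at h4
    ext i
    have h5 := congrFun (congrFun h4 i) 0
    rw [Matrix.mul_apply, Matrix.one_apply] at h5
    rw [Pi.single_apply]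
    exact h5
  have hM'0 : M'.1 0 = (c' 0 0 * b₁ 0 0) • (N₁ 0 0 • k 0 + z ᵥ* k.1) := by
    have h6 : N₁.1 0 = N₁ 0 0 • (Pi.single 0 1 : Fin (D + 1) → ℝ) + z := by
      ext j
      by_cases hj : j = 0
      · subst hj
        simp [hz]
      · simp [hz, hj]
    have h7 : ∀ P : SpecialLinearGroup (Fin (D + 1)) ℝ,
      (Pi.single 0 1 : Fin (D + 1) → ℝ) ᵥ* P.1 = P.1 0 := fun P => by
        rw [Matrix.single_one_vecMul]
        rfl
    have h9 : (N₁ * k).1 0 = N₁ 0 0 • k.1 0 + z ᵥ* k.1 := by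
      have h10 := congrArg (fun t => t ᵥ* k.1) h6
      rw [Matrix.add_vecMul, Matrix.smul_vecMul, h7] at h10
      exact h10
    rw [← h9, ← hcM', isLowerTriangular_mul_row_zero (isLowerTriangular_lowerPart M'), ← hkey, mul_assoc, isLowerTriangular_mul_row_zero hb₁l,
      smul_smul]
  have hperp : k 0 ⬝ᵥ (z ᵥ* k.1) = 0 := by
    rw [dotProduct_comm, ← Matrix.dotProduct_mulVec, hk0]
    simp [hz]
  have hone : k 0 ⬝ᵥ k 0 = 1 := orthogonalPart_row_zero_dotProduct M
  have hfin : M'.1 0 - (k 0 ⬝ᵥ M'.1 0) • k 0 = (c' 0 0 * b₁ 0 0) • (z ᵥ* k.1) := by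
    rw [hM'0, dotProduct_smul, dotProduct_add, dotProduct_smul, hperp, hone]
    simp only [smul_eq_mul, mul_one, add_zero, smul_add, smul_smul]
    abel
  rw [hfin, Matrix.vecMulVec_smul, map_smul, _root_.smul_apply, h2, smul_zero]

end Propagation
-- From rank one annihilators to all of `sl`.
section Spreading

open Matrix Matrix.SpecialLinearGroup

variable {n : Type*} [Fintype n] [DecidableEq n] [Nonempty n]
  {E : Type*} [NormedAddCommGroup E] [NormedSpace ℝ E] [CompleteSpace E]
  {R : SpecialLinearGroup n ℝ →* (E →L[ℝ] E)} {dR : Matrix n n ℝ →ₗ[ℝ] (E →L[ℝ] E)}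

/-- The matrices `xᵀ ℓ` with `ℓ ⟂ x` obtained from `ℓ` annihilate `v`. -/
def RankOneKills (dR : Matrix n n ℝ →ₗ[ℝ] (E →L[ℝ] E)) (v : E) (x ℓ : n → ℝ) : Prop :=
  dR (Matrix.vecMulVec x ℓ) v = (x ⬝ᵥ ℓ) • dR (Matrix.vecMulVec x x) v

/-- If `y = ± x` everything is immediate. Otherwise bracket the annihilators built from `y, x - c y`
and from `x, ℓ - (x ⬝ᵥ ℓ) x`; up to the nonzero factor `1 - c ^ 2` this transports the relation for
`ℓ` from `x` to `y`. The case `ℓ = y` identifies the two diagonal values. -/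
theorem IsDifferential.rankOneKills_step (h : IsDifferential R dR) {v : E} {x y : n → ℝ}
    (hx : x ⬝ᵥ x = 1) (hy : y ⬝ᵥ y = 1) (hxy : RankOneKills dR v x y)
    (hyx : RankOneKills dR v y x) :
    (∀ ℓ, RankOneKills dR v x ℓ → RankOneKills dR v y ℓ) ∧
      dR (Matrix.vecMulVec x x) v = dR (Matrix.vecMulVec y y) v := by
  unfold RankOneKills at *
  rw [dotProduct_comm y x] at hyx
  set c := x ⬝ᵥ y with hc
  have hc' : y ⬝ᵥ x = c := dotProduct_comm _ _
  by_cases h1 : c ^ 2 = 1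
  · have h2 : y = c • x := by
      have h3 : (y - c • x) ⬝ᵥ (y - c • x) = 0 := by
        simp only [sub_dotProduct, dotProduct_sub, smul_dotProduct, dotProduct_smul, hx, hy, hc',
          ← hc, smul_eq_mul]
        nlinarith
      rw [dotProduct_self_eq_zero, sub_eq_zero] at h3
      exact h3
    have h3 : c * c = 1 := by rw [← pow_two, h1]
    rw [h2]
    simp only [Matrix.smul_vecMulVec, Matrix.vecMulVec_smul, map_smul, _root_.smul_apply,
      smul_dotProduct, smul_smul, smul_eq_mul, h3, one_smul, and_true]
    intro ℓ hℓ
    rw [hℓ, smul_smul]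
  have h2 : 1 - c ^ 2 ≠ 0 := fun h3 => h1 (by linarith)
  have key : ∀ ℓ, dR (Matrix.vecMulVec x ℓ) v = (x ⬝ᵥ ℓ) • dR (Matrix.vecMulVec x x) v →
      dR (Matrix.vecMulVec y (ℓ - (x ⬝ᵥ ℓ) • x)) v
        = ((ℓ - (x ⬝ᵥ ℓ) • x) ⬝ᵥ y) • dR (Matrix.vecMulVec x x) v := by
    intro ℓ hℓ
    have h3 : dR (Matrix.vecMulVec y (x - c • y)) v = 0 := by
      simp [Matrix.vecMulVec_sub, Matrix.vecMulVec_smul, hyx]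
    have h4 : dR (Matrix.vecMulVec x (ℓ - (x ⬝ᵥ ℓ) • x)) v = 0 := by
      simp [Matrix.vecMulVec_sub, Matrix.vecMulVec_smul, hℓ]
    have h5 := h.lie_apply_eq_zero h3 h4
    rw [Matrix.vecMulVec_mul_vecMulVec, Matrix.vecMulVec_mul_vecMulVec] at h5
    have h6 : (x - c • y) ⬝ᵥ x = 1 - c ^ 2 := by
      simp only [sub_dotProduct, smul_dotProduct, hx, hc', smul_eq_mul]
      ring
    have h7 : dR (Matrix.vecMulVec x (x - c • y)) v = (1 - c ^ 2) • dR (Matrix.vecMulVec x x) v := by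
      simp only [Matrix.vecMulVec_sub, Matrix.vecMulVec_smul, map_sub, map_smul,
        _root_.sub_apply, _root_.smul_apply, hxy, sub_smul, one_smul, pow_two, mul_smul]
    simp only [h6, map_sub, Matrix.vecMulVec_smul, map_smul, _root_.sub_apply, _root_.smul_apply,
      h7] at h5
    rw [smul_comm, ← smul_sub, smul_eq_zero, or_iff_right h2, sub_eq_zero] at h5
    exact h5
  have h3 : dR (Matrix.vecMulVec y y) v = dR (Matrix.vecMulVec x x) v := by
    have h4 := key y hxy
    have h5 : (y - (x ⬝ᵥ y) • x) ⬝ᵥ y = 1 - c ^ 2 := by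
      simp only [sub_dotProduct, smul_dotProduct, hy, smul_eq_mul, ← hc]
      ring
    rw [h5, ← hc, Matrix.vecMulVec_sub, Matrix.vecMulVec_smul, map_sub, map_smul, _root_.sub_apply,
      _root_.smul_apply, hyx, smul_smul, ← pow_two] at h4
    have h6 : (1 - c ^ 2) • dR (Matrix.vecMulVec y y) v
        = (1 - c ^ 2) • dR (Matrix.vecMulVec x x) v := by
      rw [← h4, sub_smul, one_smul]
    exact smul_right_injective E h2 h6
  refine ⟨fun ℓ hℓ => ?_, h3.symm⟩
  have h4 := key ℓ hℓ
  rw [Matrix.vecMulVec_sub, Matrix.vecMulVec_smul, map_sub, map_smul, _root_.sub_apply,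
      _root_.smul_apply, hyx, smul_smul, sub_eq_iff_eq_add, ← h3, ← add_smul] at h4
  rw [h4]
  congr 1
  simp only [sub_dotProduct, smul_dotProduct, ← hc, smul_eq_mul, dotProduct_comm ℓ y]
  ring

/-- Transport along chains gives every pair in `S` the relation with one common diagonal value `e`.
Since the vectors span, bilinearity yields `dR Y v = Y.trace • e` for all `Y`, and `Y = 1` forces `e
= 0`. -/
theorem IsDifferential.apply_eq_zero_of_connected (h : IsDifferential R dR) {v : E} {ι : Type*}
    (S : Set ι) (x : ι → n → ℝ) (hx : ∀ s, x s ⬝ᵥ x s = 1)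
    (hspan : Submodule.span ℝ (x '' S) = ⊤)
    (hconn : ∀ s ∈ S, ∀ s' ∈ S, Relation.ReflTransGen
      (fun s s' => RankOneKills dR v (x s) (x s') ∧ RankOneKills dR v (x s') (x s)) s s')
    (Y : Matrix n n ℝ) : dR Y v = 0 := by
  have hne : S.Nonempty := by
    rw [Set.nonempty_iff_ne_empty]
    rintro rfl
    simp at hspan
  obtain ⟨s₀, hs₀⟩ := hne
  have hstep : ∀ s s', Relation.ReflTransGen
      (fun s s' => RankOneKills dR v (x s) (x s') ∧ RankOneKills dR v (x s') (x s)) s s' →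
      (∀ ℓ, RankOneKills dR v (x s) ℓ → RankOneKills dR v (x s') ℓ) ∧
      dR (Matrix.vecMulVec (x s) (x s)) v = dR (Matrix.vecMulVec (x s') (x s')) v := by
    intro s s' hss'
    induction hss' with
    | refl => exact ⟨fun _ h => h, rfl⟩
    | tail _ h1 ih =>
      have h2 := h.rankOneKills_step (hx _) (hx _) h1.1 h1.2
      exact ⟨fun ℓ hℓ => h2.1 ℓ (ih.1 ℓ hℓ), ih.2.trans h2.2⟩
  set e := dR (Matrix.vecMulVec (x s₀) (x s₀)) v with he
  have h1 : ∀ s ∈ S, ∀ ℓ, dR (Matrix.vecMulVec (x s) ℓ) v = (x s ⬝ᵥ ℓ) • e := by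
    intro s hs ℓ
    have hℓ : ℓ ∈ Submodule.span ℝ (x '' S) := by rw [hspan]; trivial
    rw [he, (hstep s₀ s (hconn s₀ hs₀ s hs)).2]
    induction hℓ using Submodule.span_induction with
    | mem ℓ hℓ =>
      obtain ⟨s', hs', rfl⟩ := hℓ
      refine (hstep s' s (hconn s' hs' s hs)).1 _ ?_
      rw [RankOneKills, hx, one_smul]
    | zero => simp
    | add ℓ ℓ' _ _ h1 h2 =>
      rw [Matrix.vecMulVec_add, map_add, _root_.add_apply, h1, h2, dotProduct_add, add_smul]
    | smul c ℓ _ h1 =>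
      rw [Matrix.vecMulVec_smul, map_smul, _root_.smul_apply, h1, dotProduct_smul, smul_assoc]
  have h2 : ∀ y ℓ, dR (Matrix.vecMulVec y ℓ) v = (y ⬝ᵥ ℓ) • e := by
    intro y ℓ
    have hy : y ∈ Submodule.span ℝ (x '' S) := by rw [hspan]; trivial
    induction hy using Submodule.span_induction with
    | mem y hy =>
      obtain ⟨s', hs', rfl⟩ := hy
      exact h1 s' hs' ℓ
    | zero => simp
    | add y y' _ _ h1 h2 =>
      rw [Matrix.add_vecMulVec, map_add, _root_.add_apply, h1, h2, add_dotProduct, add_smul]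
    | smul c y _ h1 =>
      rw [Matrix.smul_vecMulVec, map_smul, _root_.smul_apply, h1, smul_dotProduct, smul_assoc]
  have h3 : ∀ i j : n, Matrix.single i j (1 : ℝ) = Matrix.vecMulVec (Pi.single i 1) (Pi.single j 1) :=
    fun i j => by
      ext k l
      simp only [Matrix.single_apply, Matrix.vecMulVec_apply, Pi.single_apply, ite_and, mul_ite,
        mul_one, mul_zero, eq_comm]
      split_ifs <;> rfl
  have h4 : ∀ Y, dR Y v = Y.trace • e := by
    intro Y
    conv_lhs => rw [Matrix.matrix_eq_sum_single Y]
    simp only [map_sum, _root_.sum_apply]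
    rw [Matrix.trace, Finset.sum_smul]
    refine Finset.sum_congr rfl fun i _ => ?_
    have h5 : ∀ j, Matrix.single i j (Y i j) = Y i j • Matrix.single i j (1 : ℝ) := by simp
    simp only [h5, map_smul, h3, _root_.smul_apply, h2]
    rw [Finset.sum_eq_single i]
    · simp
    · intro j _ hj
      simp [hj]
    · simp
  have h5 : e = 0 := by
    have h6 := h4 1
    rw [h.map_one, Matrix.trace_one] at h6
    have h7 : (Fintype.card n : ℝ) ≠ 0 := by positivity
    simpa [h7] using h6.symm
  rw [h4, h5, smul_zero]

theorem IsDifferential.apply_eq_self [Nontrivial n] (h : IsDifferential R dR) {v : E}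
    (hv : ∀ Y, dR Y v = 0) (g : SpecialLinearGroup n ℝ) : R g v = v := by
  have htrans : ∀ (i j : n) (hij : i ≠ j) (a : ℝ), R (transvection hij a) v = v := by
    intro i j hij a
    rw [h.map_transvection]
    exact exp_apply_of_apply_eq_zero (by simp [hv])
  have hmul : ∀ a b : SpecialLinearGroup n ℝ, R a v = v → R b v = v → R (a * b) v = v := by
    intro a b ha hb
    rw [map_mul, mul_apply_eq_comp, hb, ha]
  refine diagonal_transvection_induction' (fun g => R g v = v) g (fun i j hij c hc => ?_)
    (fun i j hij a => htrans i j hij a) hmul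
  rw [diag2n_eq_prod_transvection hij c hc]
  repeat' refine hmul _ _ ?_ ?_
  all_goals exact htrans _ _ _ _

end Spreading
-- The core case: the full group `SL(D + 1)`.
section Core

open Matrix Matrix.SpecialLinearGroup

/-- The `α j` are the successive decrements of `A`. The value `α 0` is immaterial, in accordance
with the empty leading block before `0`. -/
theorem exists_partialSums_eq {D : ℕ} (A : Fin (D + 1) → ℝ) (hA : Antitone A) :
    ∃ α : Fin (D + 1) → ℝ, (∀ j, 0 ≤ α j) ∧
      ∀ i, A i = (∑ j, if i < j then α j else 0) + A (Fin.last D) := by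
  induction D with
  | zero => exact ⟨0, fun _ => le_rfl, fun i => by simp [Fin.eq_zero i]⟩
  | succ D ih =>
    obtain ⟨α, hα, h⟩ := ih (fun i => A i.castSucc) (fun i j hij => hA (by simpa using hij))
    refine ⟨Fin.snoc α (A (Fin.last D).castSucc - A (Fin.last (D + 1))), fun j => ?_, fun i => ?_⟩
    · refine Fin.lastCases ?_ (fun j => ?_) j
      · simpa using hA (Fin.le_last _)
      · simpa using hα j
    · rw [Fin.sum_univ_castSucc]
      refine Fin.lastCases ?_ (fun i => ?_) i
      · simp [not_lt_of_ge (Fin.castSucc_lt_last _).le]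
      · simp only [Fin.castSucc_lt_castSucc_iff, Fin.snoc_castSucc, Fin.castSucc_lt_last,
          if_true, Fin.snoc_last]
        rw [h i]
        ring

theorem exists_finset_span_eq_top {V : Type*} [AddCommGroup V] [Module ℝ V] [FiniteDimensional ℝ V]
    {J : Set ℝ} {f : ℝ → V} (hspan : Submodule.span ℝ (f '' J) = ⊤) :
    ∃ S : Finset ℝ, ↑S ⊆ J ∧ Submodule.span ℝ (f '' S) = ⊤ := by
  classical
  obtain ⟨b, hb, hspan', hli⟩ := exists_linearIndependent ℝ (f '' J)
  have hfin : b.Finite := hli.setFinite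
  obtain ⟨S, hS, hSb⟩ := Finset.subset_set_image_iff.1 (show ↑hfin.toFinset ⊆ f '' J by simpa using hb)
  refine ⟨S, hS, ?_⟩
  have : f '' S = b := by
    rw [← Finset.coe_image, hSb, hfin.coe_toFinset]
  rw [this, hspan', hspan]

theorem exists_uniform_ne_zero {X : Type*} [TopologicalSpace X] [T2Space X] {J : Set ℝ} {K : Set X}
    (hJ : IsCompact J) (hK : IsCompact K) {F : ℝ × ℝ × X → ℝ} (hF : ContinuousOn F (J ×ˢ J ×ˢ K))
    (hdiag : ∀ s ∈ J, ∀ x ∈ K, F (s, s, x) ≠ 0) :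
    ∃ ε > 0, ∀ s ∈ J, ∀ s' ∈ J, |s - s'| < ε → ∀ x ∈ K, F (s, s', x) ≠ 0 := by
  have hc : IsCompact (J ×ˢ J ×ˢ K) := hJ.prod (hJ.prod hK)
  have hbad : IsCompact ((J ×ˢ J ×ˢ K) ∩ F ⁻¹' {0}) :=
    hc.of_isClosed_subset (hF.preimage_isClosed_of_isClosed hc.isClosed isClosed_singleton)
      Set.inter_subset_left
  have hgood : ∀ ε : ℝ, (∀ p ∈ (J ×ˢ J ×ˢ K) ∩ F ⁻¹' {0}, ε ≤ |p.1 - p.2.1|) →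
      ∀ s ∈ J, ∀ s' ∈ J, |s - s'| < ε → ∀ x ∈ K, F (s, s', x) ≠ 0 := by
    intro ε hε s hs s' hs' hss' x hx h0
    exact absurd (hε (s, s', x) ⟨⟨hs, hs', hx⟩, h0⟩) (not_le.2 hss')
  rcases ((J ×ˢ J ×ˢ K) ∩ F ⁻¹' {0}).eq_empty_or_nonempty with h0 | h0
  · exact ⟨1, one_pos, hgood 1 (by simp [h0])⟩
  · obtain ⟨⟨s, s', x⟩, hp, hmin⟩ := hbad.exists_isMinOn h0
      (f := fun p : ℝ × ℝ × X => |p.1 - p.2.1|) (by fun_prop)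
    refine ⟨|s - s'|, ?_, hgood _ fun q hq => hmin hq⟩
    refine abs_pos.2 (sub_ne_zero.2 ?_)
    rintro rfl
    exact hdiag s hp.1.1 x hp.1.2.2 hp.2

theorem continuous_prod_det_lead {n : Type*} [Fintype n] [LinearOrder n] :
    Continuous fun q : SpecialLinearGroup n ℝ × SpecialLinearGroup n ℝ =>
      ∏ j, (lead (q.1.1 * q.2.1ᵀ) j).det := by
  refine continuous_finsetProd _ fun j _ => Continuous.matrix_det
    (Continuous.matrix_submatrix ?_ _ _)
  exact (continuous_subtype_val.comp continuous_fst).mul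
    (continuous_subtype_val.comp continuous_snd).matrix_transpose

/-- For `s = s'` the minors are Gram determinants, hence positive; compactness in both parameters
and in `g` provides a common `ε`. -/
theorem exists_uniform_lead_ne_zero {n : Type*} [Fintype n] [LinearOrder n] {J : Set ℝ}
    (hJ : IsCompact J) {u : ℝ → SpecialLinearGroup n ℝ} (hu : ContinuousOn u J) (C : ℝ) :
    ∃ ε > 0, ∀ s ∈ J, ∀ s' ∈ J, |s - s'| < ε → ∀ g : SpecialLinearGroup n ℝ,
      (∀ i j, |g i j| ≤ C) → ∀ j, (lead ((u s' * g).1 * (u s * g).1ᵀ) j).det ≠ 0 := by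
  have hF : ContinuousOn (fun p : ℝ × ℝ × SpecialLinearGroup n ℝ =>
      (u p.2.1 * p.2.2, u p.1 * p.2.2)) (J ×ˢ J ×ˢ {g | ∀ i j, |g i j| ≤ C}) :=
    ((hu.comp (continuous_fst.comp continuous_snd).continuousOn fun p hp => hp.2.1).mul
      (continuous_snd.comp continuous_snd).continuousOn).prodMk
    ((hu.comp continuous_fst.continuousOn fun p hp => hp.1).mul
      (continuous_snd.comp continuous_snd).continuousOn)
  obtain ⟨ε, hε, h⟩ := exists_uniform_ne_zero hJ (isCompact_setOf_abs_le C)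
    (continuous_prod_det_lead.comp_continuousOn hF) fun s _ g _ =>
      Finset.prod_ne_zero_iff.2 fun j _ => (det_lead_pos (u s * g) j).ne'
  exact ⟨ε, hε, fun s hs s' hs' hss' g hg j =>
    Finset.prod_ne_zero_iff.1 (h s hs s' hs' hss' g hg) j (Finset.mem_univ j)⟩

/-- A finite subset of an interval may be enlarged to one that is connected by steps shorter
than `ε`. -/
theorem exists_chain {a b : ℝ} (S₀ : Finset ℝ) (hS₀ : ↑S₀ ⊆ Icc a b) {ε : ℝ} (hε : 0 < ε) :
    ∃ S : Finset ℝ, S₀ ⊆ S ∧ ↑S ⊆ Icc a b ∧ ∀ r : ℝ → ℝ → Prop, (∀ s s', r s s' → r s' s) →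
      (∀ s ∈ S, ∀ s' ∈ S, |s - s'| < ε → r s s') →
      ∀ s ∈ S, ∀ s' ∈ S, Relation.ReflTransGen r s s' := by
  classical
  rcases lt_or_ge b a with hab | hab
  · have h0 : S₀ = ∅ := by
      rw [Icc_eq_empty hab.not_ge] at hS₀
      simpa using hS₀
    exact ⟨∅, by simp [h0], by simp, by simp⟩
  -- A mesh of width `ε / 2`, cut off at `b`; every point of `S₀` lies within `ε / 2` of it.
  let t : ℕ → ℝ := fun i => min (a + i * (ε / 2)) b
  let K := ⌈(b - a) / (ε / 2)⌉₊
  let G := (Finset.range (K + 1)).image t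
  have ht : ∀ i, t i ∈ Icc a b := fun i =>
    ⟨le_min (by have : 0 ≤ i * (ε / 2) := by positivity
                linarith) hab, min_le_right _ _⟩
  have htG : ∀ i ≤ K, t i ∈ S₀ ∪ G := fun i hi =>
    Finset.mem_union_right _ (Finset.mem_image_of_mem _ (Finset.mem_range.2 (by omega)))
  refine ⟨S₀ ∪ G, Finset.subset_union_left, ?_, ?_⟩
  · intro s hs
    rw [Finset.mem_coe, Finset.mem_union] at hs
    rcases hs with hs | hs
    · exact hS₀ hs
    · obtain ⟨i, -, rfl⟩ := Finset.mem_image.1 hs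
      exact ht i
  · intro r hsymm hr
    have hstep : ∀ i, |t (i + 1) - t i| < ε := by
      intro i
      refine (abs_min_sub_min_le_max _ _ _ _).trans_lt ?_
      push_cast
      rw [sub_self, abs_zero, show a + ((i : ℝ) + 1) * (ε / 2) - (a + i * (ε / 2)) = ε / 2 by ring,
        abs_of_pos (by positivity), max_eq_left (by positivity)]
      linarith
    have h0 : ∀ i ≤ K, Relation.ReflTransGen r (t i) (t 0) := by
      intro i
      induction i with
      | zero => exact fun _ => Relation.ReflTransGen.refl
      | succ i ih =>
        intro hi
        exact Relation.ReflTransGen.head (hr _ (htG _ hi) _ (htG i (by omega)) (hstep i))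
          (ih (by omega))
    have hs0 : ∀ s ∈ S₀ ∪ G, Relation.ReflTransGen r s (t 0) := by
      intro s hs
      rcases Finset.mem_union.1 hs with hs' | hs'
      · have hsJ := hS₀ hs'
        have hx : 0 ≤ (s - a) / (ε / 2) := div_nonneg (by linarith [hsJ.1]) (by positivity)
        set i := ⌊(s - a) / (ε / 2)⌋₊ with hi
        have h1 : (i : ℝ) * (ε / 2) ≤ s - a := by
          rw [← le_div_iff₀ (by positivity)]
          exact Nat.floor_le hx
        have h2 : s - a < (i + 1) * (ε / 2) := by
          rw [← div_lt_iff₀ (by positivity)]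
          exact Nat.lt_floor_add_one _
        have h3 : t i = a + i * (ε / 2) := min_eq_left (by linarith [hsJ.2])
        have hiK : i ≤ K := by
          have : (s - a) / (ε / 2) ≤ (b - a) / (ε / 2) := by
            gcongr
            exact hsJ.2
          exact (Nat.floor_le_floor this).trans (Nat.floor_le_ceil _)
        refine Relation.ReflTransGen.head (hr s hs _ (htG i hiK) ?_) (h0 i hiK)
        rw [h3, abs_lt]
        constructor <;> linarith
      · obtain ⟨i, hi, rfl⟩ := Finset.mem_image.1 hs'
        exact h0 i (by have := Finset.mem_range.1 hi; omega)
    intro s hs s' hs'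
    have : Std.Symm r := ⟨hsymm⟩
    exact (hs0 s hs).trans (symm (hs0 s' hs'))

/-- A vector whose translates along a curve in `SL` with spanning first rows stay bounded under an
expanding diagonal flow is fixed by `SL`. -/
theorem IsTransposeRep.apply_eq_self_of_bounded {D : ℕ} (hD : D ≠ 0) {E : Type*}
    [NormedAddCommGroup E] [InnerProductSpace ℝ E] [FiniteDimensional ℝ E]
    {R : SpecialLinearGroup (Fin (D + 1)) ℝ →* (E →L[ℝ] E)}
    {dR : Matrix (Fin (D + 1)) (Fin (D + 1)) ℝ →ₗ[ℝ] (E →L[ℝ] E)} (h : IsTransposeRep R dR)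
    {A : Fin (D + 1) → ℝ} (hanti : Antitone A) (hsum : ∑ i, A i = 0) (hneg : ∀ i ≠ 0, A i < 0)
    {a b : ℝ} {u : ℝ → SpecialLinearGroup (Fin (D + 1)) ℝ} (hu : ContinuousOn u (Icc a b))
    (hspan : Submodule.span ℝ ((fun s => (u s).1 0) '' Icc a b) = ⊤) {v : E}
    (hv : ∀ s ∈ Icc a b, ∃ C, ∀ x : ℝ, 0 ≤ x →
      ‖R (expSL (x • Matrix.diagonal A)) (R (u s) v)‖ ≤ C)
    (g : SpecialLinearGroup (Fin (D + 1)) ℝ) : R g v = v := by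
  have : CompleteSpace E := FiniteDimensional.complete ℝ E
  have : Nontrivial (Fin (D + 1)) := Fin.nontrivial_iff_two_le.2 (by omega)
  obtain ⟨α, hα, hA⟩ := exists_partialSums_eq A hanti
  obtain ⟨S₀, hS₀, hspan₀⟩ := exists_finset_span_eq_top hspan
  -- The order of choices avoids a circle: `C` is uniform in `S`, then `ε` depends on `C`, then the
  -- chain `S` on `ε`, and only then the minimiser on `S`.
  obtain ⟨C, hC⟩ := exists_minimizer hA hsum hneg hspan₀ isCompact_Icc hu
  obtain ⟨ε, hε, hlead⟩ := exists_uniform_lead_ne_zero isCompact_Icc hu C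
  obtain ⟨S, hS₀S, hSJ, hchain⟩ := exists_chain S₀ hS₀ hε
  obtain ⟨ω, hω, g₀, hg₀, hmin⟩ := hC S hS₀S hSJ
  have hkill := h.apply_eq_zero_of_isMinOn hα hA hsum S ω hω u v (fun s hs => hv s (hSJ hs)) g₀ hmin
  set v' := R g₀⁻¹ v with hv'
  let x : ℝ → Fin (D + 1) → ℝ := fun s => orthogonalPart (u s * g₀) 0
  have hrow : ∀ s, (u s * g₀).1 0 = lowerPart (u s * g₀) 0 0 • x s := fun s => row_zero_eq_smul _
  have hx : ∀ s, x s ⬝ᵥ x s = 1 := fun s => orthogonalPart_row_zero_dotProduct _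
  have hadj : ∀ s ∈ S, ∀ s' ∈ S, |s - s'| < ε → RankOneKills dR v' (x s) (x s') := by
    intro s hs s' hs' hss'
    have h1 := h.rankOne_apply_eq_zero hanti hsum hneg (hkill s hs) (hkill s' hs')
      (hlead s (hSJ hs) s' (hSJ hs') hss' g₀ hg₀)
    change dR (Matrix.vecMulVec (x s) ((u s' * g₀).1 0 - (x s ⬝ᵥ (u s' * g₀).1 0) • x s)) v' = 0 at h1
    rw [hrow s', dotProduct_smul, smul_assoc, ← smul_sub, Matrix.vecMulVec_smul, map_smul,
      _root_.smul_apply, smul_eq_zero, or_iff_right (lowerPart_apply_self_pos _ _).ne',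
      Matrix.vecMulVec_sub, Matrix.vecMulVec_smul, map_sub, map_smul, _root_.sub_apply,
      _root_.smul_apply, sub_eq_zero] at h1
    exact h1
  have hspanx : Submodule.span ℝ (x '' S) = ⊤ := by
    rw [eq_top_iff]
    intro y _
    have hy : y ᵥ* (g₀⁻¹).1 ∈ Submodule.span ℝ ((fun s => (u s).1 0) '' S₀) := by
      rw [hspan₀]; trivial
    have hmap := Submodule.mem_map_of_mem (f := g₀.1.vecMulLinear) hy
    rw [Submodule.map_span, Matrix.vecMulLinear_apply, Matrix.vecMul_vecMul, ← coe_mul,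
      inv_mul_cancel, coe_one, Matrix.vecMul_one] at hmap
    refine (Submodule.span_le.2 ?_) hmap
    rintro _ ⟨_, ⟨s, hs, rfl⟩, rfl⟩
    have h1 : (g₀.1.vecMulLinear) ((u s).1 0) = (u s * g₀).1 0 := rfl
    simp only [h1, hrow]
    exact Submodule.smul_mem _ _ (Submodule.subset_span ⟨s, hS₀S hs, rfl⟩)
  have hzero := h.apply_eq_zero_of_connected (v := v') (S : Set ℝ) x hx hspanx
    (hchain _ (fun s s' h => ⟨h.2, h.1⟩) fun s hs s' hs' hss' =>
      ⟨hadj s hs s' hs' hss', hadj s' hs' s hs (by rwa [abs_sub_comm])⟩)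
  have hfix : ∀ g, R g v' = v' := h.apply_eq_self hzero
  have hvv : v = v' := by
    rw [← hfix g₀, hv', ← map_mul_apply]
    simp
  rw [hvv, hfix]

end Core
-- Replacing the sequence by a single positive direction.
section Averaging

open Matrix

/-- Given a sequence `T i` with all coordinates tending to infinity, there is a single vector with
positive coordinates at which the functionals that are bounded along `T` vanish and those tending
to `-∞` are nonpositive. -/
theorem exists_pos_of_bounded {k : ℕ} {ι : Type*} [Finite ι] (χ : ι → Fin k → ℝ)
    {T : ℕ → Fin k → ℝ} (hT : ∀ l, Tendsto (fun i => T i l) atTop atTop) (B N : Set ι)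
    (hB : ∀ j ∈ B, ∃ C, ∀ i, |T i ⬝ᵥ χ j| ≤ C)
    (hN : ∀ j ∈ N, Tendsto (fun i => T i ⬝ᵥ χ j) atTop atBot) :
    ∃ t : Fin k → ℝ, (∀ l, 0 < t l) ∧ (∀ j ∈ B, t ⬝ᵥ χ j = 0) ∧ ∀ j ∈ N, t ⬝ᵥ χ j ≤ 0 := by
  classical
  have := Fintype.ofFinite ι
  let L : (Fin k → ℝ) →ₗ[ℝ] (B → ℝ) := LinearMap.pi fun j => dotProductBilin ℝ ℝ (χ j)
  have hL : ∀ t j, L t j = t ⬝ᵥ χ j := fun t j => by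
    simp [L, dotProduct_comm]
  obtain ⟨S, hS⟩ := L.rangeRestrict.exists_rightInverse_of_surjective L.range_rangeRestrict
  -- A bounded correction with the same values as `T i` on the functionals from `B`. The difference
  -- `T i - q i` for one large `i` has all the required properties.
  let q : ℕ → Fin k → ℝ := fun i => S (L.rangeRestrict (T i))
  have hLq : ∀ i, L (q i) = L (T i) := fun i =>
    congrArg Subtype.val (LinearMap.congr_fun hS (L.rangeRestrict (T i)))
  choose! C hC using hB
  have hLT : ∀ i, ‖L.rangeRestrict (T i)‖ ≤ ∑ j, |C j| := by
    intro i
    refine (pi_norm_le_iff_of_nonneg (Finset.sum_nonneg fun _ _ => abs_nonneg _)).2 fun j => ?_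
    refine (le_of_eq (congrArg _ (hL _ _))).trans ((hC j j.2 i).trans ((le_abs_self _).trans ?_))
    exact Finset.single_le_sum (f := fun j => |C j|) (fun _ _ => abs_nonneg _) (Finset.mem_univ j.1)
  have hbound : ∀ f : (Fin k → ℝ) →ₗ[ℝ] ℝ, ∃ M, ∀ i, |f (q i)| ≤ M := by
    intro f
    refine ⟨‖(f ∘ₗ S).toContinuousLinearMap‖ * ∑ j, |C j|, fun i => ?_⟩
    exact ((f ∘ₗ S).toContinuousLinearMap.le_opNorm _).trans
      (mul_le_mul_of_nonneg_left (hLT i) (norm_nonneg _))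
  have h1 : ∀ l, ∀ᶠ i in atTop, 0 < (T i - q i) l := by
    intro l
    obtain ⟨M, hM⟩ := hbound (LinearMap.proj l)
    filter_upwards [(hT l).eventually_gt_atTop M] with i hi
    exact sub_pos.2 ((le_abs_self _).trans_lt ((hM i).trans_lt hi))
  have h2 : ∀ j, ∀ᶠ i in atTop, j ∈ N → (T i - q i) ⬝ᵥ χ j ≤ 0 := by
    intro j
    by_cases hj : j ∈ N
    · obtain ⟨M, hM⟩ := hbound (dotProductBilin ℝ ℝ (χ j))
      filter_upwards [(hN j hj).eventually_le_atBot (-M)] with i hi _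
      have h3 := (abs_le.1 (hM i)).1
      rw [dotProductBilin_apply_apply, dotProduct_comm] at h3
      rw [sub_dotProduct]
      linarith
    · exact Eventually.of_forall fun i h => absurd h hj
  obtain ⟨i, hi1, hi2⟩ := ((eventually_all.2 h1).and (eventually_all.2 h2)).exists
  refine ⟨T i - q i, hi1, fun j hj => ?_, hi2⟩
  have h3 := congrFun (hLq i) ⟨j, hj⟩
  rw [hL, hL] at h3
  rw [sub_dotProduct, h3, sub_self]

open scoped InnerProductSpace

variable {E : Type*} [NormedAddCommGroup E] [InnerProductSpace ℝ E] [FiniteDimensional ℝ E]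

theorem exists_joint_eigenbasis {κ : Type*} [Finite κ] {H : κ → (E →L[ℝ] E)}
    (hsymm : ∀ l x y, ⟪H l x, y⟫_ℝ = ⟪x, H l y⟫_ℝ) (hcomm : ∀ l l', Commute (H l) (H l')) :
    ∃ (ι : Type) (_ : Finite ι) (b : Module.Basis ι ℝ E) (χ : ι → κ → ℝ),
      ∀ j l, H l (b j) = χ j l • b j := by
  classical
  let A : (κ → ℝ) → Submodule ℝ E := fun α => ⨅ l, Module.End.eigenspace (H l : E →ₗ[ℝ] E) (α l)
  have hA : DirectSum.IsInternal A :=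
    LinearMap.IsSymmetric.directSum_isInternal_of_pairwise_commute (T := fun l => (H l : E →ₗ[ℝ] E))
      (fun l => hsymm l)
      (fun l l' _ => LinearMap.ext fun x => DFunLike.congr_fun (hcomm l l').eq x)
  let b := hA.collectedBasis fun α => Module.finBasis ℝ (A α)
  have hfin := Module.Finite.finite_basis b
  have e := (Finite.equivFin (Σ α, Fin (Module.finrank ℝ (A α))))
  refine ⟨_, inferInstance, b.reindex e, fun j => (e.symm j).1, fun j l => ?_⟩
  have h1 : b (e.symm j) ∈ A (e.symm j).1 := hA.collectedBasis_mem _ _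
  have h2 := (Submodule.mem_iInf _).1 h1 l
  rw [Module.Basis.reindex_apply]
  exact Module.End.mem_eigenspace_iff.1 h2

theorem repr_exp_apply {ι : Type*} [Finite ι] (b : Module.Basis ι ℝ E) {H : E →L[ℝ] E} {c : ι → ℝ}
    (hb : ∀ j, H (b j) = c j • b j) (x : ℝ) (w : E) (j : ι) :
    b.repr (NormedSpace.exp (x • H) w) j = Real.exp (x * c j) * b.repr w j := by
  have h : b.coord j ∘ₗ (NormedSpace.exp (x • H) : E →L[ℝ] E).toLinearMap
      = Real.exp (x * c j) • b.coord j := by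
    classical
    refine b.ext fun i => ?_
    simp only [LinearMap.comp_apply, ContinuousLinearMap.coe_coe,
      exp_smul_apply_of_apply_eq_smul (hb i), map_smul, LinearMap.smul_apply,
      Module.Basis.coord_apply, Module.Basis.repr_self, smul_eq_mul, Finsupp.single_apply]
    split_ifs with hij
    · rw [hij]
    · simp
  exact LinearMap.congr_fun h w

/-- A family of commuting symmetric operators `H l`: along a suitable direction with positive
coordinates, all sums of vectors bounded in both directions and of vectors contracted
along the sequence `T i` remain bounded. -/
theorem exists_pos_forall_exp_bounded {k : ℕ} {H : Fin k → (E →L[ℝ] E)}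
    (hsymm : ∀ l x y, ⟪H l x, y⟫_ℝ = ⟪x, H l y⟫_ℝ) (hcomm : ∀ l l', Commute (H l) (H l'))
    {T : ℕ → Fin k → ℝ} (hT : ∀ l, Tendsto (fun i => T i l) atTop atTop) :
    ∃ t : Fin k → ℝ, (∀ l, 0 < t l) ∧ ∀ w₀ w₁ : E,
      (∃ C, ∀ i, ‖NormedSpace.exp (∑ l, T i l • H l) w₀‖ ≤ C) →
      (∃ C, ∀ i, ‖NormedSpace.exp (-∑ l, T i l • H l) w₀‖ ≤ C) →
      Tendsto (fun i => NormedSpace.exp (∑ l, T i l • H l) w₁) atTop (𝓝 0) →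
      ∃ C, ∀ x : ℝ, 0 ≤ x → ‖NormedSpace.exp (x • ∑ l, t l • H l) (w₀ + w₁)‖ ≤ C := by
  classical
  obtain ⟨ι, hι, b, χ, hb⟩ := exists_joint_eigenbasis hsymm hcomm
  have := Fintype.ofFinite ι
  have hbt : ∀ (t : Fin k → ℝ) j, (∑ l, t l • H l) (b j) = (t ⬝ᵥ χ j) • b j := by
    intro t j
    rw [_root_.sum_apply, dotProduct, Finset.sum_smul]
    refine Finset.sum_congr rfl fun l _ => ?_
    rw [_root_.smul_apply, hb, smul_smul]
  have hrepr : ∀ t (x : ℝ) w j, b.repr (NormedSpace.exp (x • ∑ l, t l • H l) w) j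
      = Real.exp (x * (t ⬝ᵥ χ j)) * b.repr w j := fun t x w j => repr_exp_apply b (hbt t) x w j
  have hrepr1 : ∀ t w j, b.repr (NormedSpace.exp (∑ l, t l • H l) w) j
      = Real.exp (t ⬝ᵥ χ j) * b.repr w j := fun t w j => by simpa using hrepr t 1 w j
  have hrepr2 : ∀ t w j, b.repr (NormedSpace.exp (-∑ l, t l • H l) w) j
      = Real.exp (-(t ⬝ᵥ χ j)) * b.repr w j := fun t w j => by simpa using hrepr t (-1) w j
  have hcoord : ∀ j w, |b.repr w j| ≤ ‖(b.coord j).toContinuousLinearMap‖ * ‖w‖ := fun j w =>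
    (b.coord j).toContinuousLinearMap.le_opNorm w
  let P₀ : E → Prop := fun w => (∃ C, ∀ i, ‖NormedSpace.exp (∑ l, T i l • H l) w‖ ≤ C) ∧
      ∃ C, ∀ i, ‖NormedSpace.exp (-∑ l, T i l • H l) w‖ ≤ C
  let P₁ : E → Prop := fun w =>
    Tendsto (fun i => NormedSpace.exp (∑ l, T i l • H l) w) atTop (𝓝 0)
  have hle : ∀ j w (c : ℕ → ℝ) C, b.repr w j ≠ 0 →
      (∀ i, |Real.exp (c i) * b.repr w j| ≤ ‖(b.coord j).toContinuousLinearMap‖ * C) →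
      ∃ C', ∀ i, c i ≤ C' := by
    intro j w c C hj h
    refine ⟨‖(b.coord j).toContinuousLinearMap‖ * C / |b.repr w j|, fun i => ?_⟩
    rw [le_div_iff₀ (abs_pos.2 hj)]
    refine le_trans ?_ (h i)
    rw [abs_mul, Real.abs_exp]
    exact mul_le_mul_of_nonneg_right (by linarith [Real.add_one_le_exp (c i)]) (abs_nonneg _)
  -- The index sets collect the weights seen by at least one bounded, respectively contracted,
  -- vector; thus `t` does not depend on the vectors, which will vary along the curve.
  obtain ⟨t, ht, htB, htN⟩ := exists_pos_of_bounded χ hT {j | ∃ w, P₀ w ∧ b.repr w j ≠ 0}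
    {j | ∃ w, P₁ w ∧ b.repr w j ≠ 0} (by
      rintro j ⟨w, ⟨⟨C, hC⟩, ⟨C', hC'⟩⟩, hj⟩
      obtain ⟨M, hM⟩ := hle j w (fun i => T i ⬝ᵥ χ j) C hj fun i => by
        rw [← hrepr1]
        exact (hcoord j _).trans (mul_le_mul_of_nonneg_left (hC i) (norm_nonneg _))
      obtain ⟨M', hM'⟩ := hle j w (fun i => -(T i ⬝ᵥ χ j)) C' hj fun i => by
        rw [← hrepr2]
        exact (hcoord j _).trans (mul_le_mul_of_nonneg_left (hC' i) (norm_nonneg _))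
      exact ⟨max M M', fun i => abs_le.2 ⟨by linarith [hM' i, le_max_right M M'],
        (hM i).trans (le_max_left _ _)⟩⟩) (by
      rintro j ⟨w, hw, hj⟩
      have h1 : Tendsto (fun i => Real.exp (T i ⬝ᵥ χ j) * b.repr w j) atTop (𝓝 0) := by
        have h2 := ((b.coord j).toContinuousLinearMap.continuous.tendsto 0).comp hw
        rw [map_zero] at h2
        exact h2.congr fun i => hrepr1 _ _ _
      have h2 := h1.div_const (b.repr w j)
      simp only [mul_div_cancel_right₀ _ hj, zero_div] at h2
      exact Real.tendsto_exp_comp_nhds_zero.1 h2)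
  refine ⟨t, ht, fun w₀ w₁ h₀ h₀' h₁ => ?_⟩
  have hbd : ∀ w : E, (∀ j, b.repr w j ≠ 0 → t ⬝ᵥ χ j ≤ 0) →
      ∀ x : ℝ, 0 ≤ x → ‖NormedSpace.exp (x • ∑ l, t l • H l) w‖ ≤ ∑ j, |b.repr w j| * ‖b j‖ := by
    intro w hw x hx
    rw [← b.sum_repr (NormedSpace.exp (x • ∑ l, t l • H l) w)]
    refine (norm_sum_le _ _).trans (Finset.sum_le_sum fun j _ => ?_)
    rw [norm_smul, hrepr, norm_mul, Real.norm_eq_abs, Real.norm_eq_abs, Real.abs_exp]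
    refine mul_le_mul_of_nonneg_right ?_ (norm_nonneg _)
    rcases eq_or_ne (b.repr w j) 0 with h | h
    · simp [h]
    · exact mul_le_of_le_one_left (abs_nonneg _)
        (Real.exp_le_one_iff.2 (mul_nonpos_of_nonneg_of_nonpos hx (hw j h)))
  refine ⟨∑ j, |b.repr w₀ j| * ‖b j‖ + ∑ j, |b.repr w₁ j| * ‖b j‖, fun x hx => ?_⟩
  rw [map_add]
  exact (norm_add_le _ _).trans (add_le_add
    (hbd w₀ (fun j hj => (htB j ⟨w₀, ⟨h₀, h₀'⟩, hj⟩).le) x hx)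
    (hbd w₁ (fun j hj => htN j ⟨w₁, h₁, hj⟩) x hx))

end Averaging
-- Homogeneous components and exponentials of degree one operators.
section Grading

open scoped InnerProductSpace

variable {E : Type*} [NormedAddCommGroup E] [InnerProductSpace ℝ E] [FiniteDimensional ℝ E]

/-- The adjoint `T'` maps `K'` into `K`, so `T` maps the orthogonal complement of `K` into that of
`K'`. -/
theorem starProjection_apply_comm {T T' : E →L[ℝ] E} (hadj : ∀ x y, ⟪T x, y⟫_ℝ = ⟪x, T' y⟫_ℝ)
    {K K' : Submodule ℝ E} (hT : ∀ x ∈ K, T x ∈ K') (hT' : ∀ y ∈ K', T' y ∈ K) (x : E) :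
    K'.starProjection (T x) = T (K.starProjection x) := by
  refine Submodule.eq_starProjection_of_mem_orthogonal
    (hT _ (K.starProjection_apply_mem x)) ?_
  rw [← map_sub, Submodule.mem_orthogonal']
  intro y hy
  rw [hadj]
  exact (Submodule.mem_orthogonal' _ _).1 (K.sub_starProjection_mem_orthogonal x) _ (hT' y hy)

theorem exp_apply_sub_mem {N : E →L[ℝ] E} {F : Submodule ℝ E} {w : E}
    (hF : ∀ k, (N ^ (k + 2)) w ∈ F) : NormedSpace.exp N w - (w + N w) ∈ F := by
  have : CompleteSpace E := FiniteDimensional.complete ℝ E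
  have h1 := (ContinuousLinearMap.apply ℝ E w).hasSum
    (NormedSpace.exp_series_hasSum_exp' (𝕂 := ℝ) N)
  rw [← hasSum_nat_add_iff' 2] at h1
  have h2 := F.closed_of_finiteDimensional.mem_of_tendsto h1
    (Eventually.of_forall fun s => F.sum_mem fun k _ => ?_)
  · simpa [Finset.sum_range_succ] using h2
  · simpa using F.smul_mem _ (hF k)

/-- The orthogonal projection to the eigenspace of `H` for `c`. -/
noncomputable def eigenProj (H : E →L[ℝ] E) (c : ℝ) : E →L[ℝ] E :=
  (Module.End.eigenspace (H : E →ₗ[ℝ] E) c).starProjection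

theorem apply_eigenProj (H : E →L[ℝ] E) (c : ℝ) (x : E) :
    H (eigenProj H c x) = c • eigenProj H c x :=
  Module.End.mem_eigenspace_iff.1 (Submodule.starProjection_apply_mem _ x)

theorem eigenProj_apply_comm {H T T' : E →L[ℝ] E} (hadj : ∀ x y, ⟪T x, y⟫_ℝ = ⟪x, T' y⟫_ℝ) {c c' : ℝ}
    (hT : ∀ x, H x = c • x → H (T x) = c' • T x)
    (hT' : ∀ x, H x = c' • x → H (T' x) = c • T' x) (x : E) :
    eigenProj H c' (T x) = T (eigenProj H c x) :=
  starProjection_apply_comm hadj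
    (fun x hx => Module.End.mem_eigenspace_iff.2 (hT x (Module.End.mem_eigenspace_iff.1 hx)))
    (fun x hx => Module.End.mem_eigenspace_iff.2 (hT' x (Module.End.mem_eigenspace_iff.1 hx))) x

/-- Eigenvalues are bounded by the norm; this starts the induction on the degree. -/
theorem eigenProj_eq_zero_of_lt {H : E →L[ℝ] E} {c : ℝ} (hc : c < -‖H‖) (x : E) :
    eigenProj H c x = 0 := by
  by_contra h
  have h1 := H.le_opNorm (eigenProj H c x)
  rw [apply_eigenProj, norm_smul, Real.norm_eq_abs] at h1
  have h2 := le_of_mul_le_mul_right h1 (norm_pos_iff.2 h)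
  linarith [neg_abs_le c, norm_nonneg H]

theorem exists_sum_eigenProj {H : E →L[ℝ] E} (hsymm : ∀ x y, ⟪H x, y⟫_ℝ = ⟪x, H y⟫_ℝ) :
    ∃ S : Finset ℝ, ∀ x, ∑ c ∈ S, eigenProj H c x = x := by
  classical
  have hs : (H : E →ₗ[ℝ] E).IsSymmetric := hsymm
  refine ⟨Finset.univ.image fun c : Module.End.Eigenvalues (H : E →ₗ[ℝ] E) => (c : ℝ), fun x => ?_⟩
  refine (Finset.sum_image fun c _ c' _ h => Subtype.ext h).trans ?_
  refine hs.orthogonalFamily_eigenspaces'.sum_projection_of_mem_iSup x ?_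
  have h := hs.orthogonalComplement_iSup_eigenspaces_eq_bot'
  rw [Submodule.orthogonal_eq_bot_iff] at h
  rw [h]
  trivial

/-- If `N` raises the degree by one, the component of `exp N x` in degree `c` has only two terms
provided that `N` kills all components of `x` in degrees `c - 2, c - 3, …`. -/
theorem eigenProj_exp_apply {H N N' : E →L[ℝ] E} (hadj : ∀ x y, ⟪N x, y⟫_ℝ = ⟪x, N' y⟫_ℝ)
    (hN : ∀ (c : ℝ) x, H x = c • x → H (N x) = (c + 1) • N x)
    (hN' : ∀ (c : ℝ) x, H x = c • x → H (N' x) = (c - 1) • N' x) {c : ℝ} {x : E}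
    (hx : ∀ k : ℕ, N (eigenProj H (c - (k + 2)) x) = 0) :
    eigenProj H c (NormedSpace.exp N x) = eigenProj H c x + N (eigenProj H (c - 1) x) := by
  have hcomm : ∀ c x, eigenProj H c (N x) = N (eigenProj H (c - 1) x) := fun c x =>
    eigenProj_apply_comm (c := c - 1) (c' := c) hadj
      (fun x hx => by simpa using hN (c - 1) x hx) (hN' c) x
  have hpow : ∀ (k : ℕ) c, eigenProj H c ((N ^ k) x) = (N ^ k) (eigenProj H (c - k) x) := by
    intro k
    induction k with
    | zero => simp
    | succ k ih =>
      intro c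
      rw [pow_succ', mul_apply_eq_comp, mul_apply_eq_comp, hcomm, ih, sub_sub, Nat.cast_add_one,
        add_comm (1 : ℝ)]
  have h := exp_apply_sub_mem (N := N) (F := LinearMap.ker (eigenProj H c).toLinearMap) (w := x)
    (fun k => by
      rw [LinearMap.mem_ker, ContinuousLinearMap.coe_coe, hpow, pow_succ, mul_apply_eq_comp]
      rw [show c - ((k + 2 : ℕ) : ℝ) = c - (k + 2) by push_cast; ring, hx k, map_zero])
  rw [LinearMap.mem_ker, ContinuousLinearMap.coe_coe, map_sub, sub_eq_zero, map_add, hcomm] at h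
  exact h

end Grading

/-! ### The upper left block, the corner and the degree operator. -/

section Block

open Matrix Matrix.SpecialLinearGroup

theorem IsDifferential.conj_map_apply {n : Type*} [Fintype n] [DecidableEq n] [Nonempty n]
    {E : Type*} [NormedAddCommGroup E] [NormedSpace ℝ E]
    {R : SpecialLinearGroup n ℝ →* (E →L[ℝ] E)} {dR : Matrix n n ℝ →ₗ[ℝ] (E →L[ℝ] E)}
    (h : IsDifferential R dR) (g : SpecialLinearGroup n ℝ) (Y : Matrix n n ℝ) (w : E) :
    dR (g.1 * Y * (g⁻¹).1) (R g w) = R g (dR Y w) := by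
  rw [← h.conj]
  change R g (dR Y ((R g⁻¹ * R g) w)) = _
  rw [← map_mul]
  simp

variable {p q : Type*} [Fintype p] [Fintype q] [DecidableEq p] [DecidableEq q]

/-- The embedding of `SL(p)` as the upper left block of `SL(p ⊕ q)`. -/
noncomputable def blockEmbed : SpecialLinearGroup p ℝ →* SpecialLinearGroup (p ⊕ q) ℝ where
  toFun g := ⟨fromBlocks g.1 0 0 1, by simp⟩
  map_one' := Subtype.ext (by simp)
  map_mul' g k := Subtype.ext (by
    change fromBlocks (g * k).1 0 0 1 = fromBlocks g.1 0 0 1 * fromBlocks k.1 0 0 1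
    simp [fromBlocks_multiply])

@[simp] theorem coe_blockEmbed (g : SpecialLinearGroup p ℝ) :
    (blockEmbed (q := q) g).1 = fromBlocks g.1 0 0 1 := rfl

theorem continuous_blockEmbed : Continuous (blockEmbed (p := p) (q := q)) :=
  Continuous.subtype_mk (Continuous.matrix_fromBlocks continuous_subtype_val continuous_const
    continuous_const continuous_const) _

theorem blockEmbed_transpose (g : SpecialLinearGroup p ℝ) :
    blockEmbed (q := q) g.transpose = (blockEmbed g).transpose :=
  Subtype.ext (by simp [fromBlocks_transpose])

/-- The matrix with upper right block `M` and all other entries zero. -/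
def corner : Matrix p q ℝ →ₗ[ℝ] Matrix (p ⊕ q) (p ⊕ q) ℝ where
  toFun M := fromBlocks 0 M 0 0
  map_add' M M' := by simp [fromBlocks_add]
  map_smul' c M := by simp [fromBlocks_smul]

theorem corner_apply (M : Matrix p q ℝ) : corner M = fromBlocks 0 M 0 0 := rfl

/-- The unipotent matrix `1 + corner M`. -/
noncomputable def cornerSL (M : Matrix p q ℝ) : SpecialLinearGroup (p ⊕ q) ℝ :=
  ⟨fromBlocks 1 M 0 1, by simp⟩

@[simp] theorem coe_cornerSL (M : Matrix p q ℝ) : (cornerSL M).1 = fromBlocks 1 M 0 1 := rfl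

theorem blockEmbed_mul_corner (g : SpecialLinearGroup p ℝ) (M : Matrix p q ℝ) :
    (blockEmbed g).1 * corner M * ((blockEmbed g)⁻¹).1 = corner (g.1 * M) := by
  rw [← map_inv, coe_blockEmbed, coe_blockEmbed, corner_apply, corner_apply]
  simp [fromBlocks_multiply]

variable {E : Type*} [NormedAddCommGroup E] [NormedSpace ℝ E]
  {R : SpecialLinearGroup (p ⊕ q) ℝ →* (E →L[ℝ] E)}
  {dR : Matrix (p ⊕ q) (p ⊕ q) ℝ →ₗ[ℝ] (E →L[ℝ] E)}

theorem IsDifferential.map_cornerSL [CompleteSpace E] (h : IsDifferential R dR) (M : Matrix p q ℝ) :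
    R (cornerSL M) = NormedSpace.exp (dR (corner M)) := by
  have h1 := h.map_oneParameter (fun x => cornerSL (x • M)) (Z := corner M)
    (by simp [corner_apply, Matrix.trace]) (Subtype.ext (by simp))
    (fun x y => Subtype.ext (by simp [fromBlocks_multiply, add_smul, add_comm])) (fun i j => ?_) 1
  · simpa using h1
  · have h2 : (fun x : ℝ => (cornerSL (x • M)).1 i j)
        = fun x => (1 : Matrix (p ⊕ q) (p ⊕ q) ℝ) i j + x * corner M i j := by
      funext x
      rw [coe_cornerSL, corner_apply, ← fromBlocks_one]
      rcases i with i | i <;> rcases j with j | j <;> simp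
    rw [h2]
    simpa using ((hasDerivAt_id (0 : ℝ)).mul_const (corner M i j)).const_add
      ((1 : Matrix (p ⊕ q) (p ⊕ q) ℝ) i j)

variable [Nonempty p]

theorem IsDifferential.blockEmbed_corner_apply (h : IsDifferential R dR)
    (g : SpecialLinearGroup p ℝ) (M : Matrix p q ℝ) (w : E) :
    R (blockEmbed g) (dR (corner M) w) = dR (corner (g.1 * M)) (R (blockEmbed g) w) := by
  rw [← h.conj_map_apply, blockEmbed_mul_corner]

theorem IsDifferential.blockEmbed_degree_apply (h : IsDifferential R dR)
    (g : SpecialLinearGroup p ℝ) (w : E) :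
    dR (fromBlocks 1 0 0 0) (R (blockEmbed g) w) = R (blockEmbed g) (dR (fromBlocks 1 0 0 0) w) := by
  have h2 : (blockEmbed g).1 * fromBlocks 1 0 0 0 * ((blockEmbed g)⁻¹).1
      = (fromBlocks 1 0 0 0 : Matrix (p ⊕ q) (p ⊕ q) ℝ) := by
    rw [← map_inv, coe_blockEmbed, coe_blockEmbed]
    simp only [fromBlocks_multiply, Matrix.mul_one, Matrix.mul_zero, Matrix.zero_mul, add_zero,
      ← coe_mul, mul_inv_cancel, coe_one]
  rw [← h.conj_map_apply, h2]

/-- The bracket of the degree matrix with a corner is the corner itself. -/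
theorem IsDifferential.degree_corner_apply [CompleteSpace E] (h : IsDifferential R dR)
    (M : Matrix p q ℝ) {c : ℝ} {w : E} (hw : dR (fromBlocks 1 0 0 0) w = c • w) :
    dR (fromBlocks 1 0 0 0) (dR (corner M) w) = (c + 1) • dR (corner M) w := by
  have h1 := DFunLike.congr_fun (h.lie (fromBlocks 1 0 0 0) (corner M)) w
  have h2 : (fromBlocks 1 0 0 0 : Matrix (p ⊕ q) (p ⊕ q) ℝ) * corner M
      - corner M * fromBlocks 1 0 0 0 = corner M := by
    simp [corner_apply, fromBlocks_multiply]
  rw [h2, _root_.sub_apply, mul_apply_eq_comp, mul_apply_eq_comp, hw, map_smul, eq_sub_iff_add_eq]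
    at h1
  rw [← h1, add_smul, one_smul, add_comm]

theorem IsDifferential.degree_corner_transpose_apply [CompleteSpace E] (h : IsDifferential R dR)
    (M : Matrix p q ℝ) {c : ℝ} {w : E} (hw : dR (fromBlocks 1 0 0 0) w = c • w) :
    dR (fromBlocks 1 0 0 0) (dR (corner M)ᵀ w) = (c - 1) • dR (corner M)ᵀ w := by
  have h1 := DFunLike.congr_fun (h.lie (fromBlocks 1 0 0 0) (corner M)ᵀ) w
  have h2 : (fromBlocks 1 0 0 0 : Matrix (p ⊕ q) (p ⊕ q) ℝ) * (corner M)ᵀ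
      - (corner M)ᵀ * fromBlocks 1 0 0 0 = -(corner M)ᵀ := by
    ext i j
    rcases i with i | i <;> rcases j with j | j <;>
      simp [corner_apply, fromBlocks_multiply, fromBlocks_transpose]
  rw [h2, _root_.sub_apply, mul_apply_eq_comp, mul_apply_eq_comp, hw, map_smul, map_neg,
    _root_.neg_apply, eq_sub_iff_add_eq] at h1
  rw [← h1, sub_smul, one_smul]
  abel

end Block
-- One step of the induction on the degree.
section Reduction

open Matrix Matrix.SpecialLinearGroup
open scoped InnerProductSpace

theorem eq_zero_of_exp_mul_norm_le {E : Type*} [NormedAddCommGroup E] {w : E} {c C : ℝ} (hc : 0 < c)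
    (h : ∀ x : ℝ, 0 ≤ x → Real.exp (x * c) * ‖w‖ ≤ C) : w = 0 := by
  by_contra hw
  have hw' := norm_pos_iff.2 hw
  have hC : 0 ≤ C := (by positivity : 0 ≤ Real.exp (0 * c) * ‖w‖).trans (h 0 le_rfl)
  have h1 := h (C / (c * ‖w‖)) (by positivity)
  have h2 := Real.add_one_le_exp (C / (c * ‖w‖) * c)
  have h3 : (C / (c * ‖w‖) * c + 1) * ‖w‖ = C + ‖w‖ := by
    field_simp
  nlinarith [mul_le_mul_of_nonneg_right h2 hw'.le]

theorem exists_isTransposeRep {n : Type*} [Fintype n] [DecidableEq n] [Nontrivial n] {E : Type*}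
    [NormedAddCommGroup E] [InnerProductSpace ℝ E] [FiniteDimensional ℝ E]
    {R : SpecialLinearGroup n ℝ →* (E →L[ℝ] E)} (hR : Continuous R)
    (hinner : ∀ g x y, ⟪R g x, y⟫_ℝ = ⟪x, R g.transpose y⟫_ℝ) :
    ∃ dR : Matrix n n ℝ →ₗ[ℝ] (E →L[ℝ] E), IsTransposeRep R dR := by
  obtain ⟨dR, h⟩ := exists_isDifferential R hR
  exact ⟨dR, h, hR, hinner⟩

variable {D : ℕ} {q : Type*} [Fintype q] [DecidableEq q] {E : Type*}
  [NormedAddCommGroup E] [InnerProductSpace ℝ E] [FiniteDimensional ℝ E]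
  {R : SpecialLinearGroup (Fin (D + 1) ⊕ q) ℝ →* (E →L[ℝ] E)}
  {dR : Matrix (Fin (D + 1) ⊕ q) (Fin (D + 1) ⊕ q) ℝ →ₗ[ℝ] (E →L[ℝ] E)}
  {A : Fin (D + 1) → ℝ} {a b : ℝ} {u : ℝ → SpecialLinearGroup (Fin (D + 1)) ℝ} {z : ℝ → q → ℝ}

/-- The effect of the block diagonal flow on the corner matrices. -/
theorem map_expSL_mul_eq_sum {F : Type*} [AddCommGroup F] [Module ℝ F]
    (γ : Matrix (Fin (D + 1)) q ℝ →ₗ[ℝ] F) (hsum : ∑ i, A i = 0) (x : ℝ)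
    (X : Matrix (Fin (D + 1)) q ℝ) :
    γ ((expSL (x • Matrix.diagonal A)).1 * X)
      = ∑ i, Real.exp (x * A i) • γ (vecMulVec (Pi.single i 1) (X i)) := by
  simp only [← map_smul, ← map_sum]
  congr 1
  ext i j
  rw [coe_expSL_diagonal hsum, Matrix.diagonal_mul, Matrix.sum_apply, Finset.sum_eq_single i]
  · simp [vecMulVec_apply]
  · intro k _ hk
    simp [vecMulVec_apply, hk.symm]
  · simp

/-- One step of the reduction: `y` and `w` are neighbouring homogeneous components. -/
theorem IsTransposeRep.reduction_step (hD : D ≠ 0) (h : IsTransposeRep R dR) (hanti : Antitone A)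
    (hsum : ∑ i, A i = 0) (hneg : ∀ i ≠ 0, A i < 0) (hu : ContinuousOn u (Icc a b))
    (hspan : Submodule.span ℝ ((fun s => Sum.elim ((u s).1 0) (z s)) '' Icc a b) = ⊤) {y w : E}
    (hw : ∀ g, R (blockEmbed g) w = w)
    (hbound : ∀ s ∈ Icc a b, ∃ C, ∀ x : ℝ, 0 ≤ x → ‖R (blockEmbed (expSL (x • Matrix.diagonal A)))
      (R (blockEmbed (u s)) y + dR (corner (vecMulVec (Pi.single 0 1) (z s))) w)‖ ≤ C) :
    (∀ g, R (blockEmbed g) y = y) ∧ ∀ M, dR (corner M) w = 0 := by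
  have : Nontrivial (Fin (D + 1)) := Fin.nontrivial_iff_two_le.2 (by omega)
  have hpos : 0 < A 0 := by
    rw [Fin.sum_univ_succ] at hsum
    have : ∑ i : Fin D, A i.succ < 0 := by
      have : Nonempty (Fin D) := ⟨⟨0, by omega⟩⟩
      exact Finset.sum_neg (fun i _ => hneg _ (Fin.succ_ne_zero i)) Finset.univ_nonempty
    linarith
  let γ : Matrix (Fin (D + 1)) q ℝ →ₗ[ℝ] E :=
    (ContinuousLinearMap.apply ℝ E w).toLinearMap ∘ₗ dR ∘ₗ corner
  have hγ : ∀ M, dR (corner M) w = γ M := fun _ => rfl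
  have hequi : ∀ g M, R (blockEmbed g) (γ M) = γ (g.1 * M) := by
    intro g M
    rw [← hγ, h.blockEmbed_corner_apply, hw, hγ]
  have hinner : ∀ g x y, ⟪R (blockEmbed g) x, y⟫_ℝ = ⟪x, R (blockEmbed g.transpose) y⟫_ℝ :=
    fun g x y => by rw [h.inner_map, blockEmbed_transpose]
  obtain ⟨dR₁, h₁⟩ := exists_isTransposeRep (R := R.comp blockEmbed)
    (h.continuous.comp continuous_blockEmbed) hinner
  set P := (LinearMap.range γ)ᗮ.starProjection with hP
  have hrange : ∀ g, ∀ x ∈ LinearMap.range γ, R (blockEmbed g) x ∈ LinearMap.range γ := by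
    rintro g _ ⟨M, rfl⟩
    exact ⟨_, (hequi g M).symm⟩
  have horth : ∀ g, ∀ x ∈ (LinearMap.range γ)ᗮ, R (blockEmbed g) x ∈ (LinearMap.range γ)ᗮ := by
    intro g x hx
    rw [Submodule.mem_orthogonal'] at hx ⊢
    intro y hy
    rw [hinner]
    exact hx _ (hrange _ _ hy)
  have hPcomm : ∀ g x, P (R (blockEmbed g) x) = R (blockEmbed g) (P x) := fun g x =>
    starProjection_apply_comm (hinner g) (horth g) (horth g.transpose) x
  have hPγ : ∀ M, P (γ M) = 0 := fun M =>
    Submodule.starProjection_apply_eq_zero_iff _ |>.2 (Submodule.le_orthogonal_orthogonal _ ⟨M, rfl⟩)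
  have hspan₁ : Submodule.span ℝ ((fun s => (u s).1 0) '' Icc a b) = ⊤ := by
    have h2 := congrArg (Submodule.map (LinearMap.funLeft ℝ ℝ (Sum.inl : Fin (D + 1) → _ ⊕ q))) hspan
    rw [Submodule.map_span, Set.image_image, Submodule.map_top, LinearMap.range_eq_top.2
      (LinearMap.funLeft_surjective_of_injective _ _ _ Sum.inl_injective)] at h2
    exact h2
  -- Orthogonally to the image of `γ` the corner term disappears, and the core case applies.
  have hfix : ∀ g, R (blockEmbed g) (P y) = P y := by
    refine h₁.apply_eq_self_of_bounded hD hanti hsum hneg hu hspan₁ fun s hs => ?_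
    obtain ⟨C, hC⟩ := hbound s hs
    refine ⟨‖P‖ * C, fun x hx => ?_⟩
    refine le_trans (le_of_eq ?_) ((P.le_opNorm _).trans
      (mul_le_mul_of_nonneg_left (hC x hx) (norm_nonneg _)))
    rw [hPcomm, map_add P, hγ, hPγ, add_zero, hPcomm]
    rfl
  obtain ⟨M₀, hM₀⟩ : y - P y ∈ LinearMap.range γ := by
    rw [hP, Submodule.starProjection_orthogonal_val, sub_sub_cancel]
    exact Submodule.starProjection_apply_mem _ _
  -- At the rows of the curve `F` is the part of the bounded vector that grows like `exp (x A 0)`;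
  -- it must vanish there, and these rows span.
  let F : (Fin (D + 1) ⊕ q → ℝ) →ₗ[ℝ] E :=
    { toFun := fun f => γ (vecMulVec (Pi.single 0 1) ((f ∘ Sum.inl) ᵥ* M₀ + f ∘ Sum.inr))
      map_add' := fun f f' => by
        rw [← map_add, ← vecMulVec_add]
        congr 2
        rw [show (f + f') ∘ Sum.inl = f ∘ Sum.inl + f' ∘ Sum.inl from rfl, add_vecMul]
        rw [show (f + f') ∘ Sum.inr = f ∘ Sum.inr + f' ∘ Sum.inr from rfl]
        abel
      map_smul' := fun c f => by
        rw [RingHom.id_apply, ← map_smul, ← vecMulVec_smul, smul_add, ← smul_vecMul]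
        rfl }
  have hF : F = 0 := by
    refine LinearMap.ext fun f => ?_
    have hle : Submodule.span ℝ ((fun s => Sum.elim ((u s).1 0) (z s)) '' Icc a b)
        ≤ LinearMap.ker F := by
      rw [Submodule.span_le]
      rintro _ ⟨s, hs, rfl⟩
      obtain ⟨C, hC⟩ := hbound s hs
      set X := (u s).1 * M₀ + vecMulVec (Pi.single 0 1) (z s) with hX
      have hX0 : X 0 = (u s).1 0 ᵥ* M₀ + z s := by
        ext j
        simp [hX, vecMulVec_apply, Matrix.mul_apply, vecMul, dotProduct]
      change γ (vecMulVec (Pi.single 0 1) ((u s).1 0 ᵥ* M₀ + z s)) = 0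
      rw [← hX0]
      have hy : R (blockEmbed (u s)) y + dR (corner (vecMulVec (Pi.single 0 1) (z s))) w
          = P y + γ X := by
        have h3 : y = P y + γ M₀ := by rw [hM₀]; abel
        rw [hX, map_add γ, ← hequi, hγ, ← add_assoc]
        conv_lhs => rw [h3, map_add, hfix]
      refine eq_zero_of_exp_mul_norm_le (c := A 0) (C := C + ‖P y‖ + ∑ i : Fin D,
        ‖γ (vecMulVec (Pi.single i.succ 1) (X i.succ))‖) hpos fun x hx => ?_
      have h4 := hC x hx
      rw [hy, map_add, hfix, hequi, map_expSL_mul_eq_sum γ hsum, Fin.sum_univ_succ] at h4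
      have h5 : ‖∑ i : Fin D, Real.exp (x * A i.succ) • γ (vecMulVec (Pi.single i.succ 1) (X i.succ))‖
          ≤ ∑ i : Fin D, ‖γ (vecMulVec (Pi.single i.succ 1) (X i.succ))‖ := by
        refine (norm_sum_le _ _).trans (Finset.sum_le_sum fun i _ => ?_)
        rw [norm_smul, Real.norm_eq_abs, Real.abs_exp]
        exact mul_le_of_le_one_left (norm_nonneg _) (Real.exp_le_one_iff.2
          (mul_nonpos_of_nonneg_of_nonpos hx (hneg _ (Fin.succ_ne_zero i)).le))
      rw [← abs_of_pos (Real.exp_pos (x * A 0)), ← Real.norm_eq_abs, ← norm_smul]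
      set e₀ := Real.exp (x * A 0) • γ (vecMulVec (Pi.single 0 1) (X 0))
      set e₁ := ∑ i : Fin D, Real.exp (x * A i.succ) • γ (vecMulVec (Pi.single i.succ 1) (X i.succ))
      calc ‖e₀‖ = ‖(P y + (e₀ + e₁)) - P y - e₁‖ := by congr 1; abel
        _ ≤ ‖P y + (e₀ + e₁)‖ + ‖P y‖ + ‖e₁‖ :=
          (norm_sub_le _ _).trans (add_le_add_left (norm_sub_le _ _) _)
        _ ≤ _ := by gcongr
    rw [hspan] at hle
    exact hle trivial
  -- Vectors with zero in the first block remove the unknown `M₀`; transvections then carry the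
  -- result from row `0` to every row.
  have h0 : ∀ ℓ : q → ℝ, γ (vecMulVec (Pi.single 0 1) ℓ) = 0 := by
    intro ℓ
    have h2 := LinearMap.congr_fun hF (Sum.elim 0 ℓ)
    simpa [F] using h2
  have hi : ∀ i (ℓ : q → ℝ), γ (vecMulVec (Pi.single i 1) ℓ) = 0 := by
    intro i ℓ
    by_cases hi0 : i = 0
    · rw [hi0, h0]
    · have h2 := hequi (transvection hi0 1) (vecMulVec (Pi.single 0 1) ℓ)
      rw [h0, map_zero, transvection_coe, Matrix.mul_vecMulVec, Matrix.add_mulVec, Matrix.one_mulVec,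
        Matrix.mulVec_single_one, Matrix.add_vecMulVec, map_add, h0, zero_add] at h2
      rw [h2]
      congr 2
      ext k
      simp [Matrix.single_apply, Pi.single_apply, eq_comm]
  have hγ0 : ∀ M, γ M = 0 := by
    intro M
    have h2 := map_expSL_mul_eq_sum γ hsum 0 M
    rw [zero_smul, expSL_zero, coe_one, Matrix.one_mul] at h2
    rw [h2]
    exact Finset.sum_eq_zero fun i _ => by rw [hi, smul_zero]
  refine ⟨fun g => ?_, hγ0⟩
  rw [hγ0] at hM₀
  rw [sub_eq_zero.1 hM₀.symm, hfix]

end Reduction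
-- The induction on the degree.
section Reduction

open Matrix Matrix.SpecialLinearGroup
open scoped InnerProductSpace

/-- A vector whose translates along a curve in `[SL(p), *; 0, 1]` with spanning first rows stay
bounded under an expanding diagonal flow of `SL(p)` is fixed by `SL(p)` and annihilated by the
upper right corner. -/
theorem IsTransposeRep.fixed_of_bounded {D : ℕ} {q : Type*} [Fintype q] [DecidableEq q] {E : Type*}
    [NormedAddCommGroup E] [InnerProductSpace ℝ E] [FiniteDimensional ℝ E]
    {R : SpecialLinearGroup (Fin (D + 1) ⊕ q) ℝ →* (E →L[ℝ] E)}
    {dR : Matrix (Fin (D + 1) ⊕ q) (Fin (D + 1) ⊕ q) ℝ →ₗ[ℝ] (E →L[ℝ] E)}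
    {A : Fin (D + 1) → ℝ} {a b : ℝ} {u : ℝ → SpecialLinearGroup (Fin (D + 1)) ℝ} {z : ℝ → q → ℝ}
    (hD : D ≠ 0) (h : IsTransposeRep R dR) (hanti : Antitone A)
    (hsum : ∑ i, A i = 0) (hneg : ∀ i ≠ 0, A i < 0) (hu : ContinuousOn u (Icc a b))
    (hspan : Submodule.span ℝ ((fun s => Sum.elim ((u s).1 0) (z s)) '' Icc a b) = ⊤) {v : E}
    (hv : ∀ s ∈ Icc a b, ∃ C, ∀ x : ℝ, 0 ≤ x → ‖R (blockEmbed (expSL (x • Matrix.diagonal A)))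
      (R (cornerSL (vecMulVec (Pi.single 0 1) (z s)) * blockEmbed (u s)) v)‖ ≤ C) :
    (∀ g, R (blockEmbed g) v = v) ∧ ∀ M, dR (corner M) v = 0 := by
  have : CompleteSpace E := FiniteDimensional.complete ℝ E
  set H := dR (fromBlocks 1 0 0 0) with hH
  have hsymm : ∀ x y, ⟪H x, y⟫_ℝ = ⟪x, H y⟫_ℝ := by
    intro x y
    rw [hH, h.inner_differential, fromBlocks_transpose]
    simp
  have hembed : ∀ c g x, eigenProj H c (R (blockEmbed g) x) = R (blockEmbed g) (eigenProj H c x) := by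
    intro c g x
    have h1 : ∀ g x, H x = c • x → H (R (blockEmbed g) x) = c • R (blockEmbed g) x := fun g x hx => by
      rw [hH, h.blockEmbed_degree_apply, ← hH, hx, map_smul]
    refine eigenProj_apply_comm (T' := R (blockEmbed g.transpose)) (fun x y => ?_) (h1 g)
      (h1 g.transpose) x
    rw [h.inner_map, blockEmbed_transpose]
  have hcorner : ∀ c M x, (∀ k : ℕ, dR (corner M) (eigenProj H (c - (k + 2)) x) = 0) →
      eigenProj H c (R (cornerSL M) x) = eigenProj H c x + dR (corner M) (eigenProj H (c - 1) x) := by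
    intro c M x hx
    rw [h.map_cornerSL]
    exact eigenProj_exp_apply (N' := dR (corner M)ᵀ) (h.inner_differential _)
      (fun c x => h.degree_corner_apply M) (fun c x => h.degree_corner_transpose_apply M) hx
  -- Upward induction in unit steps, over all real degrees at once, so that no integrality is
  -- needed. Since lower components are fixed and those at least two degrees down are killed by
  -- corners, the component of the translate in degree `c` has just the two terms that
  -- `reduction_step` handles.
  have key : ∀ n : ℕ, ∀ c < -‖H‖ + n, (∀ g, R (blockEmbed g) (eigenProj H c v) = eigenProj H c v) ∧
      ∀ M, dR (corner M) (eigenProj H (c - 1) v) = 0 := by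
    intro n
    induction n with
    | zero =>
      intro c hc
      rw [Nat.cast_zero, add_zero] at hc
      rw [eigenProj_eq_zero_of_lt hc, eigenProj_eq_zero_of_lt (by linarith)]
      simp
    | succ n ih =>
      intro c hc
      push_cast at hc
      refine h.reduction_step hD hanti hsum hneg hu hspan (ih (c - 1) (by linarith)).1 fun s hs => ?_
      obtain ⟨C, hC⟩ := hv s hs
      refine ⟨‖eigenProj H c‖ * C, fun x hx => ?_⟩
      refine le_trans (le_of_eq ?_) (((eigenProj H c).le_opNorm _).trans
        (mul_le_mul_of_nonneg_left (hC x hx) (norm_nonneg _)))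
      rw [hembed, map_mul_apply, hcorner, hembed, hembed, (ih (c - 1) (by linarith)).1]
      intro k
      have hk : (0 : ℝ) ≤ k := k.cast_nonneg
      rw [hembed, (ih (c - (k + 2)) (by linarith)).1]
      have h2 := (ih (c - (k + 1)) (by linarith)).2 (vecMulVec (Pi.single 0 1) (z s))
      rwa [show c - (k + 1) - 1 = c - ((k : ℝ) + 2) by ring] at h2
  have key' : ∀ c, (∀ g, R (blockEmbed g) (eigenProj H c v) = eigenProj H c v) ∧
      ∀ M, dR (corner M) (eigenProj H c v) = 0 := by
    intro c
    obtain ⟨n, hn⟩ := exists_nat_gt (c + 1 + ‖H‖)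
    refine ⟨(key n c (by linarith)).1, fun M => ?_⟩
    have h2 := (key n (c + 1) (by linarith)).2 M
    rwa [add_sub_cancel_right] at h2
  obtain ⟨S, hS⟩ := exists_sum_eigenProj hsymm
  constructor
  · intro g
    rw [← hS v, map_sum]
    exact Finset.sum_congr rfl fun c _ => (key' c).1 g
  · intro M
    rw [← hS v, map_sum]
    exact Finset.sum_eq_zero fun c _ => (key' c).2 M

end Reduction
-- Renumbering coordinates, the curve and the diagonal flow.
section Coordinates

open Matrix Matrix.SpecialLinearGroup
open scoped InnerProductSpace

/-- A continuous finite-dimensional representation may be conjugated to one on a Euclidean space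
which takes transposes to adjoints. -/
theorem exists_conj_isTransposeRep {n : Type*} [Fintype n] [DecidableEq n] [Nontrivial n] {V : Type*}
    [NormedAddCommGroup V] [NormedSpace ℝ V] [FiniteDimensional ℝ V]
    (ρ : Representation ℝ (SpecialLinearGroup n ℝ) V) (hρ : ∀ v, Continuous fun g => ρ g v) :
    ∃ (r : ℕ) (L : V ≃L[ℝ] EuclideanSpace ℝ (Fin r))
      (R : SpecialLinearGroup n ℝ →* (EuclideanSpace ℝ (Fin r) →L[ℝ] EuclideanSpace ℝ (Fin r)))
      (dR : Matrix n n ℝ →ₗ[ℝ] (EuclideanSpace ℝ (Fin r) →L[ℝ] EuclideanSpace ℝ (Fin r))),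
      IsTransposeRep R dR ∧ ∀ g v, R g (L v) = L (ρ g v) := by
  let R₀ : SpecialLinearGroup n ℝ →* (V →L[ℝ] V) :=
    { toFun := fun g => (ρ g).toContinuousLinearMap
      map_one' := by ext v; simp
      map_mul' := fun g k => by ext v; simp }
  obtain ⟨r, L, hL⟩ := exists_adjoint_transpose R₀ (continuous_clm_apply.2 hρ)
  let L' := L.toContinuousLinearEquiv
  let R : SpecialLinearGroup n ℝ →* (EuclideanSpace ℝ (Fin r) →L[ℝ] EuclideanSpace ℝ (Fin r)) :=
    { toFun := fun g => (L' : V →L[ℝ] _) ∘L R₀ g ∘L (L'.symm : _ →L[ℝ] V)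
      map_one' := by ext1 v; simp
      map_mul' := fun g k => by ext1 v; simp }
  have hR : ∀ g v, R g (L' v) = L' (ρ g v) := fun g v => by
    change L' (ρ g (L'.symm (L' v))) = _
    rw [L'.symm_apply_apply]
  obtain ⟨dR, h⟩ := exists_isTransposeRep (R := R) (continuous_clm_apply.2 fun v =>
    L'.continuous.comp (hρ (L'.symm v))) fun g x y => by
      obtain ⟨x, rfl⟩ := L'.surjective x
      obtain ⟨y, rfl⟩ := L'.surjective y
      rw [hR, hR]
      exact hL g x y
  exact ⟨r, L', R, dR, h, hR⟩

/-- Renumbering of rows and columns in `SL`. -/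
noncomputable def reindexSL {n n' : Type*} [Fintype n] [DecidableEq n] [Fintype n'] [DecidableEq n']
    (e : n ≃ n') : SpecialLinearGroup n ℝ →* SpecialLinearGroup n' ℝ where
  toFun g := ⟨g.1.submatrix e.symm e.symm, by rw [Matrix.det_submatrix_equiv_self]; exact g.2⟩
  map_one' := Subtype.ext (Matrix.submatrix_one_equiv _)
  map_mul' g k := Subtype.ext (Matrix.submatrix_mul_equiv g.1 k.1 _ _ _).symm

section Reindex

variable {n n' : Type*} [Fintype n] [DecidableEq n] [Fintype n'] [DecidableEq n']

theorem coe_reindexSL (e : n ≃ n') (g : SpecialLinearGroup n ℝ) :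
    (reindexSL e g).1 = g.1.submatrix e.symm e.symm := rfl

theorem continuous_reindexSL (e : n ≃ n') : Continuous (reindexSL e) :=
  Continuous.subtype_mk (continuous_subtype_val.matrix_submatrix _ _) _

theorem reindexSL_reindexSL_symm (e : n ≃ n') (g : SpecialLinearGroup n' ℝ) :
    reindexSL e (reindexSL e.symm g) = g :=
  Subtype.ext (by simp [coe_reindexSL])

end Reindex

section Blocks

variable {p q : Type*} [Fintype p] [Fintype q] [DecidableEq p] [DecidableEq q]
  {x : SpecialLinearGroup (p ⊕ q) ℝ}

theorem eq_fromBlocks_of_row (hx : ∀ i, x.1 (Sum.inr i) = Pi.single (Sum.inr i) 1) :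
    x.1 = fromBlocks x.1.toBlocks₁₁ x.1.toBlocks₁₂ 0 1 := by
  ext i j
  rcases i with i | i
  · rcases j with j | j <;> rfl
  · rw [hx]
    rcases j with j | j
    · simp
    · simp [Pi.single_apply, Matrix.one_apply, eq_comm]

theorem det_toBlocks₁₁_of_row (hx : ∀ i, x.1 (Sum.inr i) = Pi.single (Sum.inr i) 1) :
    x.1.toBlocks₁₁.det = 1 := by
  have h := x.2
  rw [eq_fromBlocks_of_row hx, det_fromBlocks_zero₂₁] at h
  simpa using h

theorem eq_cornerSL_mul_blockEmbed (hx : ∀ i, x.1 (Sum.inr i) = Pi.single (Sum.inr i) 1) :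
    x = cornerSL x.1.toBlocks₁₂ * blockEmbed ⟨x.1.toBlocks₁₁, det_toBlocks₁₁_of_row hx⟩ := by
  refine Subtype.ext ((eq_fromBlocks_of_row hx).trans ?_)
  change _ = fromBlocks 1 x.1.toBlocks₁₂ 0 1 * fromBlocks x.1.toBlocks₁₁ 0 0 1
  simp [fromBlocks_multiply]

theorem blockEmbed_expSL_diagonal {A : p → ℝ} (hA : ∑ i, A i = 0) (x : ℝ) :
    blockEmbed (expSL (x • Matrix.diagonal A))
      = expSL (x • Matrix.diagonal (Sum.elim A (0 : q → ℝ))) := by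
  apply Subtype.ext
  rw [coe_blockEmbed, coe_expSL_diagonal hA, coe_expSL_diagonal (by simp [hA])]
  ext i j
  rcases i with i | i <;> rcases j with j | j <;> simp [Matrix.diagonal_apply, Matrix.one_apply]

end Blocks

section Unipotent

variable {d : ℕ}

theorem unipotent_row_zero (ξ : EuclideanSpace ℝ (Fin d)) :
    (unipotent ξ).1 0 = Fin.cons 1 fun j => ξ j := by
  ext i
  refine Fin.cases ?_ (fun i => ?_) i
  · simp [unipotent, Matrix.sum_apply]
  · simp [unipotent, Matrix.sum_apply, Matrix.single_apply,
      (Fin.succ_ne_zero i).symm]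

theorem unipotent_row_of_ne_zero (ξ : EuclideanSpace ℝ (Fin d)) {i : Fin (d + 1)} (hi : i ≠ 0) :
    (unipotent ξ).1 i = Pi.single i 1 := by
  ext j
  simp [unipotent, Matrix.sum_apply, Matrix.one_apply, Pi.single_apply, hi.symm, eq_comm]

theorem continuous_unipotent : Continuous (unipotent (d := d)) :=
  Continuous.subtype_mk (continuous_const.add (continuous_finsetSum _ fun j _ => by
    refine continuous_matrix fun i k => ?_
    simp only [Matrix.single_apply]
    split_ifs <;> fun_prop)) _

/-- If the image of `φ` lies in no proper affine subspace, the vectors `(1, φ)` span. -/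
theorem span_unipotent_row_zero {φ : ℝ → EuclideanSpace ℝ (Fin d)} {J : Set ℝ}
    (hφ : ∀ S : AffineSubspace ℝ (EuclideanSpace ℝ (Fin d)), φ '' J ⊆ S → S = ⊤) :
    Submodule.span ℝ ((fun s => (unipotent (φ s)).1 0) '' J) = ⊤ := by
  set K := Submodule.span ℝ ((fun s => (unipotent (φ s)).1 0) '' J) with hK
  let S : AffineSubspace ℝ (EuclideanSpace ℝ (Fin d)) :=
    { carrier := {ξ | (unipotent ξ).1 0 ∈ K}
      smul_vsub_vadd_mem' := by
        intro c ξ₁ ξ₂ ξ₃ h₁ h₂ h₃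
        have h := K.add_mem (K.smul_mem c (K.sub_mem h₁ h₂)) h₃
        rw [Set.mem_ofPred_eq]
        convert h using 1
        simp only [unipotent_row_zero]
        ext i
        refine Fin.cases ?_ (fun i => ?_) i <;> simp }
  have hS : S = ⊤ := hφ S (by
    rintro _ ⟨s, hs, rfl⟩
    exact Submodule.subset_span ⟨s, hs, rfl⟩)
  have hmem : ∀ ξ, (unipotent ξ).1 0 ∈ K := fun ξ => by
    have : ξ ∈ S := by rw [hS]; trivial
    exact this
  rw [eq_top_iff]
  intro y _
  -- The vector `y` is `y 0 - 1` times the row at `ξ = 0` plus the row at the tail of `y`.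
  have h := K.add_mem (K.smul_mem (y 0 - 1) (hmem 0)) (hmem (WithLp.toLp 2 fun j => y j.succ))
  convert h using 1
  simp only [unipotent_row_zero]
  ext i
  refine Fin.cases ?_ (fun i => ?_) i <;> simp

end Unipotent

section Cartan

variable {d k : ℕ}

/-- The diagonal entries of `cartanMatrix`. -/
def cartanEntry (m : ℕ) (i : Fin (d + 1)) : ℝ := if i = 0 then (m : ℝ) else if (i : ℕ) ≤ m then -1 else 0

theorem coe_expCartan (m : Fin k → ℕ) (hm : ∀ l, m l ≤ d) (t : Fin k → ℝ) :
    (expCartan d m hm t).1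
      = Matrix.diagonal fun i => Real.exp (∑ l, t l * cartanEntry (m l) i) :=
  exp_cartanSum d m t

theorem reindexSL_expSL_diagonal {n : Type*} [Fintype n] [DecidableEq n] (e : n ≃ Fin (d + 1))
    (m : Fin k → ℕ) (hm : ∀ l, m l ≤ d) (t : Fin k → ℝ) :
    reindexSL e (expSL (∑ l, t l • Matrix.diagonal fun i => cartanEntry (m l) (e i)))
      = expCartan d m hm t := by
  have h0 : ∀ l, ∑ i, cartanEntry (m l) (e i) = 0 := fun l => by
    rw [e.sum_comp (cartanEntry (m l))]
    exact sum_cartan_entries d (m l) (hm l)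
  have h1 : ∑ l, t l • Matrix.diagonal (fun i => cartanEntry (m l) (e i))
      = (1 : ℝ) • Matrix.diagonal fun i => ∑ l, t l * cartanEntry (m l) (e i) := by
    ext i j
    simp only [Matrix.sum_apply, Matrix.smul_apply, Matrix.diagonal_apply, smul_eq_mul]
    split_ifs <;> simp
  apply Subtype.ext
  rw [h1, coe_reindexSL, coe_expSL_diagonal, coe_expCartan]
  · ext i j
    simp [Matrix.diagonal_apply]
  · rw [Finset.sum_comm]
    simp only [← Finset.mul_sum, h0, mul_zero, Finset.sum_const_zero]

/-- The identification of `Fin (m + 1) ⊕ Fin (d - m)` with `Fin (d + 1)` that keeps `0` and reverses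
the order of `1, …, m`. -/
def blockEquiv {m d : ℕ} (hm : m ≤ d) : Fin (m + 1) ⊕ Fin (d - m) ≃ Fin (d + 1) :=
  ((Equiv.neg (Fin (m + 1))).sumCongr (Equiv.refl _)).trans
    (finSumFinEquiv.trans (finCongr (by omega)))

theorem val_blockEquiv_inl {m d : ℕ} (hm : m ≤ d) (i : Fin (m + 1)) :
    (blockEquiv hm (Sum.inl i) : ℕ) = if i = 0 then 0 else m + 1 - i := by
  simp [blockEquiv, Fin.val_neg]

theorem val_blockEquiv_inr {m d : ℕ} (hm : m ≤ d) (i : Fin (d - m)) :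
    (blockEquiv hm (Sum.inr i) : ℕ) = m + 1 + i := by
  simp [blockEquiv]

theorem blockEquiv_inl_zero {m d : ℕ} (hm : m ≤ d) : blockEquiv hm (Sum.inl 0) = 0 :=
  Fin.ext (by rw [val_blockEquiv_inl]; simp)

theorem blockEquiv_inl_eq_zero_iff {m d : ℕ} (hm : m ≤ d) (i : Fin (m + 1)) :
    blockEquiv hm (Sum.inl i) = 0 ↔ i = 0 := by
  rw [← blockEquiv_inl_zero hm, EmbeddingLike.apply_eq_iff_eq, Sum.inl_injective.eq_iff]

theorem blockEquiv_inr_ne_zero {m d : ℕ} (hm : m ≤ d) (i : Fin (d - m)) :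
    blockEquiv hm (Sum.inr i) ≠ 0 := fun h => by
  have h1 := val_blockEquiv_inr hm i
  rw [h, Fin.val_zero] at h1
  omega

theorem cartanEntry_blockEquiv_inr {M d : ℕ} (hM : M ≤ d) {m : ℕ} (hm : m ≤ M) (i : Fin (d - M)) :
    cartanEntry m (blockEquiv hM (Sum.inr i)) = 0 := by
  rw [cartanEntry, if_neg (blockEquiv_inr_ne_zero hM i), val_blockEquiv_inr, if_neg (by omega)]

theorem cartanEntry_blockEquiv_inl_nonpos {M d : ℕ} (hM : M ≤ d) (m : ℕ) {i : Fin (M + 1)}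
    (hi : i ≠ 0) : cartanEntry m (blockEquiv hM (Sum.inl i)) ≤ 0 := by
  rw [cartanEntry, if_neg (mt (blockEquiv_inl_eq_zero_iff hM i).1 hi)]
  split_ifs <;> norm_num

theorem cartanEntry_blockEquiv_inl_neg {M d : ℕ} (hM : M ≤ d) {i : Fin (M + 1)} (hi : i ≠ 0) :
    cartanEntry M (blockEquiv hM (Sum.inl i)) < 0 := by
  have h : (i : ℕ) ≠ 0 := fun h => hi (Fin.ext h)
  rw [cartanEntry, if_neg (mt (blockEquiv_inl_eq_zero_iff hM i).1 hi), val_blockEquiv_inl, if_neg hi,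
    if_pos (by omega)]
  norm_num

/-- In the original numbering the entries after the first rise from `-1` to `0`. Reversing those
places makes them nonincreasing, as the triangular decompositions require, and one numbering serves
all `m`. -/
theorem cartanEntry_blockEquiv_antitone {M d : ℕ} (hM : M ≤ d) (m : ℕ) :
    Antitone fun i => cartanEntry m (blockEquiv hM (Sum.inl i)) := by
  intro i j hij
  have hm : (0 : ℝ) ≤ m := m.cast_nonneg
  simp only [cartanEntry, blockEquiv_inl_eq_zero_iff, val_blockEquiv_inl]
  rw [Fin.le_def] at hij
  by_cases hi : i = 0
  · simp only [hi, if_true]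
    split_ifs <;> linarith
  · have hj : j ≠ 0 := fun hj => hi (by rw [hj] at hij; exact Fin.ext (by simpa using hij))
    simp only [hi, hj, if_false]
    split_ifs <;> first | omega | norm_num

end Cartan

end Coordinates
-- Assembling the theorem.
section Conclusion

open Matrix Matrix.SpecialLinearGroup

theorem exists_bound_of_mem_convergent {G V W : Type*} [Monoid G] [NormedAddCommGroup V]
    [NormedSpace ℝ V] [NormedAddCommGroup W] [NormedSpace ℝ W] {ρ : Representation ℝ G V} {g : ℕ → G}
    (L : V →L[ℝ] W) {v : V} (hv : v ∈ convergent ρ g) : ∃ C, ∀ i, ‖L (ρ (g i) v)‖ ≤ C := by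
  obtain ⟨w, hw⟩ := hv
  obtain ⟨C, hC⟩ := ((L.continuous.tendsto w).comp hw).norm.bddAbove_range
  exact ⟨C, fun i => hC ⟨i, rfl⟩⟩

/-- After conjugation to a Euclidean space and renumbering, `exists_pos_forall_exp_bounded` supplies
one flow along which all translates are bounded, and `IsTransposeRep.fixed_of_bounded` applies to
the block of size `m₁ + 1`. -/
theorem apply_eq_self_of_mem_Vzero_sup_Vminus {d k : ℕ} (hk : 0 < k) {m : Fin k → ℕ}
    (hm_anti : StrictAnti m) (hm_pos : ∀ l, 1 ≤ m l) (hm_le : ∀ l, m l ≤ d) {V : Type*}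
    [NormedAddCommGroup V] [NormedSpace ℝ V] [FiniteDimensional ℝ V]
    (ρ : Representation ℝ (SpecialLinearGroup (Fin (d + 1)) ℝ) V)
    (hρ : ∀ v : V, Continuous fun g => ρ g v) {T : ℕ → Fin k → ℝ}
    (hT : ∀ l, Tendsto (fun i => T i l) atTop atTop) {a b : ℝ} {φ : ℝ → EuclideanSpace ℝ (Fin d)}
    (hφ : ContinuousOn φ (Icc a b))
    (hφ_full : ∀ S : AffineSubspace ℝ (EuclideanSpace ℝ (Fin d)), φ '' Icc a b ⊆ S → S = ⊤) {v : V}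
    (hv : ∀ s ∈ Icc a b, ρ (unipotent (φ s)) v ∈ Vzero ρ m hm_le T ⊔ Vminus ρ m hm_le T)
    {x : SpecialLinearGroup (Fin (d + 1)) ℝ} (hx : x ∈ Q (d + 1) (m ⟨0, hk⟩ + 1)) : ρ x v = v := by
  set M := m ⟨0, hk⟩
  have hM : M ≤ d := hm_le _
  have hM0 : M ≠ 0 := Nat.one_le_iff_ne_zero.1 (hm_pos _)
  have hmM : ∀ l, m l ≤ M := fun l => hm_anti.antitone (Fin.mk_le_of_le_val (Nat.zero_le _))
  have : Nontrivial (Fin (M + 1)) := Fin.nontrivial_iff_two_le.2 (by omega)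
  have : Nontrivial (Fin (M + 1) ⊕ Fin (d - M)) := Sum.inl_injective.nontrivial
  set σ := blockEquiv hM with hσ
  obtain ⟨r, L, R, dR, h, hR⟩ := exists_conj_isTransposeRep
    (ρ.comp (reindexSL σ)) fun v => (hρ v).comp (continuous_reindexSL σ)
  have hRρ : ∀ g v, R (reindexSL σ.symm g) (L v) = L (ρ g v) := fun g v => by
    rw [hR, MonoidHom.comp_apply, reindexSL_reindexSL_symm]
  -- the flow
  let c : Fin k → Fin (M + 1) ⊕ Fin (d - M) → ℝ := fun l i => cartanEntry (m l) (σ i)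
  have hcinr : ∀ l i, c l (Sum.inr i) = 0 := fun l => cartanEntry_blockEquiv_inr hM (hmM l)
  have hcsum : ∀ l, ∑ i, c l i = 0 := fun l =>
    (σ.sum_comp (cartanEntry (m l))).trans (sum_cartan_entries d (m l) (hm_le l))
  have hcsum' : ∀ l, ∑ i, c l (Sum.inl i) = 0 := fun l => by
    simpa [Fintype.sum_sum_type, hcinr] using hcsum l
  have hcneg : ∀ l i, i ≠ 0 → c l (Sum.inl i) ≤ 0 := fun l i hi =>
    cartanEntry_blockEquiv_inl_nonpos hM (m l) hi
  have hcneg' : ∀ i, i ≠ 0 → c ⟨0, hk⟩ (Sum.inl i) < 0 := fun i hi =>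
    cartanEntry_blockEquiv_inl_neg hM hi
  let H : Fin k → (EuclideanSpace ℝ (Fin r) →L[ℝ] EuclideanSpace ℝ (Fin r)) := fun l =>
    dR (Matrix.diagonal (c l))
  have hflow : ∀ t : Fin k → ℝ, ∑ l, t l • H l = dR (∑ l, t l • Matrix.diagonal (c l)) := fun t => by
    simp [H]
  have htrace : ∀ t : Fin k → ℝ, (∑ l, t l • Matrix.diagonal (c l)).trace = 0 := fun t => by
    simp [Matrix.trace_sum, hcsum]
  have hexp : ∀ (t : Fin k → ℝ) v, NormedSpace.exp (∑ l, t l • H l) (L v)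
      = L (ρ (expCartan d m hm_le t) v) := fun t v => by
    have h1 := h.map_expSL (htrace t) 1
    rw [one_smul, one_smul, ← hflow] at h1
    rw [← h1, hR, MonoidHom.comp_apply, reindexSL_expSL_diagonal σ m hm_le]
  have hexp' : ∀ (t : Fin k → ℝ) v, NormedSpace.exp (-∑ l, t l • H l) (L v)
      = L (ρ (expCartan d m hm_le t)⁻¹ v) := fun t v => by
    have h1 := h.map_expSL (htrace t) (-1)
    rw [neg_one_smul, neg_one_smul, ← hflow, expSL_neg (htrace t)] at h1
    rw [← h1, hR, MonoidHom.comp_apply, map_inv, reindexSL_expSL_diagonal σ m hm_le]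
  obtain ⟨t, ht, hbound⟩ := exists_pos_forall_exp_bounded (H := H)
    (fun l x y => by
      rw [h.inner_differential, Matrix.diagonal_transpose])
    (fun l l' => by
      rw [commute_iff_eq, ← sub_eq_zero, ← h.lie, Matrix.diagonal_mul_diagonal,
        Matrix.diagonal_mul_diagonal]
      simp [mul_comm]) hT
  let A : Fin (M + 1) → ℝ := fun i => ∑ l, t l * c l (Sum.inl i)
  have hAsum : ∑ i, A i = 0 := by
    simp only [A]
    rw [Finset.sum_comm]
    simp only [← Finset.mul_sum, hcsum', mul_zero, Finset.sum_const_zero]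
  -- Strictness comes from the largest of the `m l`: its matrix has entry `-1` at every place of the
  -- block after the first.
  have hAneg : ∀ i ≠ 0, A i < 0 := fun i hi =>
    Finset.sum_neg' (fun l _ => mul_nonpos_of_nonneg_of_nonpos (ht l).le (hcneg l i hi))
      ⟨⟨0, hk⟩, Finset.mem_univ _, mul_neg_of_pos_of_neg (ht _) (hcneg' i hi)⟩
  have hAanti : Antitone A := fun i j hij => Finset.sum_le_sum fun l _ =>
    mul_le_mul_of_nonneg_left (cartanEntry_blockEquiv_antitone hM (m l) hij) (ht l).le
  have hAdiag : ∑ l, t l • Matrix.diagonal (c l) = Matrix.diagonal (Sum.elim A 0) := by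
    ext i j
    simp only [Matrix.sum_apply, Matrix.smul_apply, Matrix.diagonal_apply, smul_eq_mul]
    by_cases hij : i = j
    · subst hij
      rcases i with i | i
      · simp [A]
      · simp [hcinr]
    · simp [hij]
  have hflowA : ∀ x : ℝ, R (blockEmbed (expSL (x • Matrix.diagonal A)))
      = NormedSpace.exp (x • ∑ l, t l • H l) := fun x => by
    rw [blockEmbed_expSL_diagonal hAsum, ← hAdiag, h.map_expSL (htrace t), hflow]
  -- the curve
  have hrow : ∀ (ξ : EuclideanSpace ℝ (Fin d)) i,
      (reindexSL σ.symm (unipotent ξ)).1 (Sum.inr i) = Pi.single (Sum.inr i) 1 := by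
    intro ξ i
    ext j
    change (unipotent ξ).1 (σ (Sum.inr i)) (σ j) = _
    rw [unipotent_row_of_ne_zero ξ (blockEquiv_inr_ne_zero hM i)]
    simp [hσ, Pi.single_apply]
  let W : ℝ → SpecialLinearGroup (Fin (M + 1) ⊕ Fin (d - M)) ℝ := fun s =>
    reindexSL σ.symm (unipotent (φ s))
  let u : ℝ → SpecialLinearGroup (Fin (M + 1)) ℝ := fun s =>
    ⟨(W s).1.toBlocks₁₁, det_toBlocks₁₁_of_row (hrow (φ s))⟩
  let z : ℝ → Fin (d - M) → ℝ := fun s => (W s).1.toBlocks₁₂ 0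
  have hcorner : ∀ s, (W s).1.toBlocks₁₂ = vecMulVec (Pi.single 0 1) (z s) := by
    intro s
    ext i j
    by_cases hi : i = 0
    · subst hi
      simp [z, vecMulVec_apply]
    · change (unipotent (φ s)).1 (σ (Sum.inl i)) (σ (Sum.inr j)) = _
      rw [unipotent_row_of_ne_zero _ (mt (blockEquiv_inl_eq_zero_iff hM i).1 hi)]
      simp [hσ, vecMulVec_apply, hi]
  have hW : ∀ s, W s = cornerSL (vecMulVec (Pi.single 0 1) (z s)) * blockEmbed (u s) := fun s => by
    rw [← hcorner]
    exact eq_cornerSL_mul_blockEmbed (hrow (φ s))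
  have hu : ContinuousOn u (Icc a b) := by
    have h1 : ContinuousOn W (Icc a b) :=
      ((continuous_reindexSL _).comp continuous_unipotent).comp_continuousOn hφ
    exact Topology.IsInducing.subtypeVal.continuousOn_iff.2
      ((continuous_subtype_val.matrix_submatrix Sum.inl Sum.inl).comp_continuousOn h1)
  have hspan : Submodule.span ℝ ((fun s => Sum.elim ((u s).1 0) (z s)) '' Icc a b) = ⊤ := by
    have h1 := congrArg (Submodule.map (LinearMap.funLeft ℝ ℝ σ)) (span_unipotent_row_zero hφ_full)
    rw [Submodule.map_span, Set.image_image, Submodule.map_top, LinearMap.range_eq_top.2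
      (LinearMap.funLeft_surjective_of_injective _ _ _ σ.injective)] at h1
    rw [← h1]
    congr 2
    funext s
    have h0 : σ (Sum.inl 0) = 0 := blockEquiv_inl_zero hM
    ext j
    rcases j with j | j
    · change (unipotent (φ s)).1 (σ (Sum.inl 0)) (σ (Sum.inl j)) = _
      rw [h0]
      rfl
    · change (unipotent (φ s)).1 (σ (Sum.inl 0)) (σ (Sum.inr j)) = _
      rw [h0]
      rfl
  obtain ⟨hfix, hkill⟩ := h.fixed_of_bounded hM0 hAanti hAsum hAneg hu hspan (v := L v) (by
    intro s hs
    obtain ⟨v₀, hv₀, v₁, hv₁, hv₀₁⟩ := Submodule.mem_sup.1 (hv s hs)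
    obtain ⟨C₀, hC₀⟩ := exists_bound_of_mem_convergent L.toContinuousLinearMap hv₀.2
    obtain ⟨C₁, hC₁⟩ := exists_bound_of_mem_convergent L.toContinuousLinearMap hv₀.1
    obtain ⟨C, hC⟩ := hbound (L v₀) (L v₁)
      ⟨C₀, fun i => by rw [hexp]; exact hC₀ i⟩ ⟨C₁, fun i => by rw [hexp']; exact hC₁ i⟩ (by
        have h1 := (L.continuous.tendsto 0).comp hv₁
        rw [map_zero] at h1
        exact h1.congr fun i => (hexp _ _).symm)
    refine ⟨C, fun x hx => ?_⟩
    rw [← hW, hRρ, hflowA, ← hv₀₁, map_add]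
    exact hC x hx)
  -- the group `Q`
  have hrowx : ∀ i, (reindexSL σ.symm x).1 (Sum.inr i) = Pi.single (Sum.inr i) 1 := by
    intro i
    have h1 := hx (σ (Sum.inr i)) (by rw [hσ, val_blockEquiv_inr]; omega)
    rw [Matrix.single_one_vecMul] at h1
    ext j
    refine (congrFun h1 (σ j)).trans ?_
    simp [Pi.single_apply]
  apply L.injective
  have : CompleteSpace (EuclideanSpace ℝ (Fin r)) := FiniteDimensional.complete ℝ _
  -- An element of `Q` is a corner unipotent times a block element; the block fixes the vector, and
  -- the corner acts as the exponential of an operator that kills it.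
  rw [← hRρ, eq_cornerSL_mul_blockEmbed hrowx, IsTransposeRep.map_mul_apply]
  refine (congrArg _ (hfix _)).trans ?_
  rw [h.map_cornerSL, exp_apply_of_apply_eq_zero (hkill _)]

end Conclusion
end ExpandingTranslates

theorem mainTheorem11
    (d k : ℕ) (hk : 0 < k)
    (m : Fin k → ℕ) (hm_anti : StrictAnti m) (hm_pos : ∀ l, 1 ≤ m l) (hm_le : ∀ l, m l ≤ d)
    {V : Type*} [NormedAddCommGroup V] [NormedSpace ℝ V] [FiniteDimensional ℝ V]
    (ρ : Representation ℝ (Matrix.SpecialLinearGroup (Fin (d + 1)) ℝ) V)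
    (hρ : ∀ v : V, Continuous fun g => ρ g v)
    (T : ℕ → Fin k → ℝ) (hT_nonneg : ∀ i l, 0 ≤ T i l)
    (hT : ∀ l, Tendsto (fun i => T i l) atTop atTop)
    (hV : DirectSum.IsInternal
      ![ExpandingTranslates.Vplus ρ m hm_le T, ExpandingTranslates.Vzero ρ m hm_le T,
        ExpandingTranslates.Vminus ρ m hm_le T])
    (a b : ℝ) (φ : ℝ → EuclideanSpace ℝ (Fin d))
    (hφ : DifferentiableOn ℝ φ (Icc a b))
    (hφ_full : ∀ S : AffineSubspace ℝ (EuclideanSpace ℝ (Fin d)),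
      φ '' Icc a b ⊆ S → S = ⊤)
    (v : V)
    (hv : ∀ s ∈ Icc a b, ρ (ExpandingTranslates.unipotent (φ s)) v ∈
      ExpandingTranslates.Vzero ρ m hm_le T ⊔ ExpandingTranslates.Vminus ρ m hm_le T) :
    ∀ x ∈ ExpandingTranslates.Q (d + 1) (m ⟨0, hk⟩ + 1), ρ x v = v := fun _ hx =>
  ExpandingTranslates.apply_eq_self_of_mem_Vzero_sup_Vminus hk hm_anti hm_pos hm_le ρ hρ hT
    hφ.continuousOn hφ_full hv hx
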